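/- **Conventions.** For a group $G$ put $G_1=G$ and $G_{k+1}=[G,G_k]$. A homomorphism $p:K\to G$ is an *$n$-equivalence* if it induces an isomorphism $K/K_n\cong G/G_n$. All homology and cohomology is with integer coefficients. For a torsion-free abelian group $H$, $\mathsf L(H)=\bigoplus_n \mathsf L_n(H)$ is the free Lie ring on $H$, mapped to the tensor ring $T(H)$ by sending brackets to commutators. Let $Y$ be a space or a group. For $\alpha_1,\dots,\alpha_n\in H^1(Y)$, $n\ge 2$, the *Massey product* $\langle\alpha_1,\dots,\alpha_n\rangle\subseteq H^2(Y)$ is the set of classes of the cocycles $\sum_{0<k<n}a_{0k}\smile a_{kn}$, where $(a_{ij})_{0\le i<j\le n,\,(i,j)\ne(0,n)}$ runs over the families of $1$-cochains such that $a_{i-1,i}$ is a cocycle representing $\alpha_i$ and $\delta a_{ij}=\sum_{i<k<j}a_{ik}\smile a_{kj}$. It is *defined* if this set is non-empty, and *vanishes* if it equals $\{0\}$. **Theorem (universal Massey products).** Let $X$ be a path-connected space with basepoint $x$, let $\pi=\pi_1(X,x)$, let $F$ be a free group (of any rank) with basis $(b_i)_{i\in I}$, let $p:F\to\pi$ be a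 $2$-equivalence, and let $n\ge 2$. (i) The following are equivalent: $p$ is an $n$-equivalence; all Massey products of length less than $n$ in $X$ are defined and vanish; all Massey products of length less than $n$ in $X$ contain $0$; the same two conditions for $\pi$ instead of $X$. (ii) Suppose that $p$ is an $n$-equivalence. Then every Massey product of length $n$ in $X$ or in $\pi$ consists of exactly one class, denoted by the same symbol. There is a unique homomorphism $\theta:H_2(X)\to\mathsf L_n(H_1(X))$ such that $$\big\langle\, \langle\alpha_1,\dots,\alpha_n\rangle,\ c\,\big\rangle=(\alpha_1\otimes\dots\otimes\alpha_n)(\theta(c))\qquad\text{for all } c\in H_2(X),\ \alpha_1,\dots,\alpha_n\in H^1(X),$$ where $\alpha_i$ is regarded as a functional on $H_1(X)$, and there is a unique homomorphism $\psi:\mathsf L_n(H_1(X))\to\pi_n/\pi_{n+1}$ taking $[h_1,[h_2,\dots,[h_{n-1},h_n]\dots]]$ to the class of the iterated commutator $[g_1,[g_2,\dots,[g_{n-1},g_n]\dots]]$ whenever $h_i\in H_1(X)$ is the class of $g_i\in\pi$. The sequence $$H_2(X)\xrightarrow{\ \theta\ }\mathsf L_n(H_1(X))\xrightarrow{\ \psi\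 }\pi_n/\pi_{n+1}\to 0$$ is exact. Moreover $\theta$ determines the Massey products of length $n$: a class $\beta\in H^2(X)$ is equal to $\langle\alpha_1,\dots,\alpha_n\rangle$ if and only if $\langle\beta,c\rangle=(\alpha_1\otimes\dots\otimes\alpha_n)(\theta(c))$ for all $c\in H_2(X)$. In coordinates: if $t_i\in H_1(X)$ is the class of $p(b_i)$ and $(u_i)$ are classes in $H^1(X)$ with $\langle u_i,t_j\rangle=\delta_{ij}$, then for every $c\in H_2(X)$ the image of $\theta(c)$ in $T(H_1(X))$ is $$\sum_{(i_1,\dots,i_n)\in I^n}\big\langle\,\langle u_{i_1},\dots,u_{i_n}\rangle,\ c\,\big\rangle\; t_{i_1}\otimes\dots\otimes t_{i_n},$$ a sum with only finitely many non-zero terms. (iii) If $p$ is an $n$-equivalence, then for all $\alpha_1,\dots,\alpha_{n+1}\in H^1(\pi)$ $$\alpha_1\smile\langle\alpha_2,\dots,\alpha_{n+1}\rangle=\langle\alpha_1,\dots,\alpha_n\rangle\smile\alpha_{n+1}\in H^3(\pi),$$ and likewise for all $\alpha_1,\dots,\alpha_{n+1}\in H^1(X)$ in $H^3(X)$. -/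

import Mathlib

open CategoryTheory Opposite

universe u v w

namespace UniversalMassey

noncomputable section

/-! ## Cochains and cohomology of a simplicial set, with integer coefficients -/

section Cochains

variable (S : SSet.{u})

/-- The set of `n`-simplices. -/
abbrev Simplex (n : ℕ) : Type u := S.obj (op (SimplexCategory.mk n))

/-- Integral `n`-cochains: arbitrary integer valued functions on `n`-simplices. -/
abbrev Cochain (n : ℕ) : Type u := Simplex S n → ℤ

/-- The coboundary `(δ a)(σ) = ∑ i, (-1)^i a(dᵢ σ)`. -/
def coboundary (n : ℕ) : Cochain S n →+ Cochain S (n + 1) where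
  toFun a := fun σ => ∑ i : Fin (n + 2), (-1) ^ (i : ℕ) * a (S.δ i σ)
  map_zero' := by ext σ; simp
  map_add' a b := by ext σ; simp [mul_add, Finset.sum_add_distrib]

/-- The group of `n`-cocycles. -/
def cocycles (n : ℕ) : AddSubgroup (Cochain S n) := (coboundary S n).ker

/-- The group of `n`-coboundaries. -/
def coboundaries : (n : ℕ) → AddSubgroup (Cochain S n)
  | 0 => ⊥
  | n + 1 => (coboundary S n).range

/-- The cohomology group `Hⁿ(S; ℤ)`. -/
abbrev Cohomology (n : ℕ) : Type u :=
  cocycles S n ⧸ (coboundaries S n).addSubgroupOf (cocycles S n)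

variable {S}

/-- The cohomology class of a cocycle. -/
def cohomologyClass (n : ℕ) : cocycles S n →+ Cohomology S n :=
  QuotientAddGroup.mk' _

/-- The front `p`-face (on the vertices `0, …, p`) of an `n`-simplex. -/
def frontFace {n : ℕ} (p : ℕ) (h : p ≤ n) (σ : Simplex S n) : Simplex S p :=
  S.map (SimplexCategory.subinterval 0 p (by omega)).op σ

/-- The back `q`-face (on the vertices `p, …, p + q = n`) of an `n`-simplex. -/
def backFace {n : ℕ} (p q : ℕ) (h : p + q = n) (σ : Simplex S n) : Simplex S q :=
  S.map (SimplexCategory.subinterval p q (by omega)).op σ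

/-- The Alexander–Whitney cup product of cochains. -/
def cup {p q n : ℕ} (h : p + q = n) (a : Cochain S p) (b : Cochain S q) : Cochain S n :=
  fun σ => a (frontFace p (by omega) σ) * b (backFace p q h σ)

lemma cup_add_left {p q n : ℕ} (h : p + q = n) (a a' : Cochain S p) (b : Cochain S q) :
    cup h (a + a') b = cup h a b + cup h a' b := by
  ext σ; simp [cup, add_mul]

lemma cup_add_right {p q n : ℕ} (h : p + q = n) (a : Cochain S p) (b b' : Cochain S q) :
    cup h a (b + b') = cup h a b + cup h a b' := by
  ext σ; simp [cup, mul_add]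

lemma cup_zero_left {p q n : ℕ} (h : p + q = n) (b : Cochain S q) :
    cup h (0 : Cochain S p) b = 0 := by
  ext σ; simp [cup]

lemma cup_zero_right {p q n : ℕ} (h : p + q = n) (a : Cochain S p) :
    cup h a (0 : Cochain S q) = 0 := by
  ext σ; simp [cup]

lemma map_face_eq {n m : ℕ} (i : Fin (n + 2)) (f : SimplexCategory.mk m ⟶ SimplexCategory.mk n)
    (g : SimplexCategory.mk m ⟶ SimplexCategory.mk (n + 1))
    (hfg : f ≫ SimplexCategory.δ i = g) (σ : Simplex S (n + 1)) :
    S.map f.op (S.δ i σ) = S.map g.op σ := by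
  subst hfg
  rw [op_comp, Functor.map_comp]
  rfl

lemma face_map_eq {n m : ℕ} (i : Fin (n + 2)) (f : SimplexCategory.mk (n + 1) ⟶ SimplexCategory.mk m)
    (g : SimplexCategory.mk n ⟶ SimplexCategory.mk m)
    (hfg : SimplexCategory.δ i ≫ f = g) (σ : Simplex S m) :
    S.δ i (S.map f.op σ) = S.map g.op σ := by
  subst hfg
  rw [op_comp, Functor.map_comp]
  rfl

lemma map_eq_map {n m : ℕ} (i : Fin (n + 2)) (j : Fin (m + 2))
    (f : SimplexCategory.mk m ⟶ SimplexCategory.mk n)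
    (g : SimplexCategory.mk (m + 1) ⟶ SimplexCategory.mk (n + 1))
    (hfg : f ≫ SimplexCategory.δ i = SimplexCategory.δ j ≫ g) (σ : Simplex S (n + 1)) :
    S.map f.op (S.δ i σ) = S.δ j (S.map g.op σ) := by
  rw [map_face_eq i f _ rfl σ, face_map_eq j g _ rfl σ, hfg]

lemma subinterval_val {n : ℕ} (j l : ℕ) (h : j + l ≤ n) (x : Fin (l + 1)) :
    ((SimplexCategory.subinterval (n := n) j l h).toOrderHom x).val = x.val + j := rfl

/-- The coface map `δᵢ` on vertices, as a function of natural numbers. -/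
def skip (i x : ℕ) : ℕ := if x < i then x else x + 1

lemma delta_val {n : ℕ} (i : Fin (n + 2)) (x : Fin (n + 1)) :
    ((SimplexCategory.δ i).toOrderHom x).val = skip i.val x.val := by
  change (i.succAbove x).val = _
  simp only [Fin.succAbove, Fin.lt_def, Fin.val_castSucc, skip]
  split_ifs <;> simp

lemma hom_ext_val {n m : ℕ} (f g : SimplexCategory.mk n ⟶ SimplexCategory.mk m)
    (h : ∀ x : Fin (n + 1), (f.toOrderHom x).val = (g.toOrderHom x).val) : f = g := by
  apply SimplexCategory.Hom.ext
  apply OrderHom.ext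
  funext x
  exact Fin.ext (h x)

lemma frontFace_face_of_le {p n : ℕ} (hp : p ≤ n) (i : Fin (n + 2)) (j : Fin (p + 2))
    (hij : i.val = j.val) (σ : Simplex S (n + 1)) :
    frontFace p hp (S.δ i σ) = S.δ j (frontFace (p + 1) (by omega) σ) := by
  refine map_eq_map i j _ _ (hom_ext_val _ _ fun x => ?_) σ
  simp only [SimplexCategory.comp_toOrderHom, OrderHom.comp_coe, Function.comp_apply,
    subinterval_val, delta_val, add_zero, hij]

lemma backFace_face_of_le {p q n : ℕ} (h : p + q = n) (i : Fin (n + 2)) (hi : i.val ≤ p)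
    (σ : Simplex S (n + 1)) :
    backFace p q h (S.δ i σ) = backFace (p + 1) q (by omega) σ := by
  refine map_face_eq i _ _ (hom_ext_val _ _ fun x => ?_) σ
  simp only [SimplexCategory.comp_toOrderHom, OrderHom.comp_coe, Function.comp_apply,
    subinterval_val, delta_val]
  unfold skip
  split_ifs <;> omega

lemma frontFace_face_of_lt {p n : ℕ} (hp : p ≤ n) (i : Fin (n + 2)) (hi : p < i.val)
    (σ : Simplex S (n + 1)) :
    frontFace p hp (S.δ i σ) = frontFace p (by omega) σ := by
  refine map_face_eq i _ _ (hom_ext_val _ _ fun x => ?_) σ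
  simp only [SimplexCategory.comp_toOrderHom, OrderHom.comp_coe, Function.comp_apply,
    subinterval_val, delta_val]
  have := x.isLt
  unfold skip
  split_ifs <;> omega

lemma backFace_face_of_lt {p q n : ℕ} (h : p + q = n) (i : Fin (n + 2)) (j : Fin (q + 2))
    (hij : i.val = p + j.val) (σ : Simplex S (n + 1)) :
    backFace p q h (S.δ i σ) = S.δ j (backFace p (q + 1) (by omega) σ) := by
  refine map_eq_map i j _ _ (hom_ext_val _ _ fun x => ?_) σ
  simp only [SimplexCategory.comp_toOrderHom, OrderHom.comp_coe, Function.comp_apply,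
    subinterval_val, delta_val]
  unfold skip
  split_ifs <;> omega

lemma face_last_frontFace {p n : ℕ} (hp : p + 1 ≤ n) (σ : Simplex S n) :
    S.δ (Fin.last (p + 1)) (frontFace (p + 1) hp σ) = frontFace p (by omega) σ := by
  refine face_map_eq _ _ _ (hom_ext_val _ _ fun x => ?_) σ
  simp only [SimplexCategory.comp_toOrderHom, OrderHom.comp_coe, Function.comp_apply,
    subinterval_val, delta_val, Fin.val_last]
  have := x.isLt
  unfold skip
  split_ifs <;> omega

lemma face_zero_backFace {p q n : ℕ} (h : p + (q + 1) = n) (σ : Simplex S n) :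
    S.δ 0 (backFace p (q + 1) h σ) = backFace (p + 1) q (by omega) σ := by
  refine face_map_eq _ _ _ (hom_ext_val _ _ fun x => ?_) σ
  simp only [SimplexCategory.comp_toOrderHom, OrderHom.comp_coe, Function.comp_apply,
    subinterval_val, delta_val]
  simp [skip]
  omega

/-- The Leibniz rule `δ(a ∪ b) = δa ∪ b + (-1)^p a ∪ δb`. -/
lemma coboundary_cup {p q n : ℕ} (h : p + q = n) (a : Cochain S p) (b : Cochain S q) :
    coboundary S n (cup h a b) =
      cup (show p + 1 + q = n + 1 by omega) (coboundary S p a) b +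
        (-1 : ℤ) ^ p • cup (show p + (q + 1) = n + 1 by omega) a (coboundary S q b) := by
  subst h
  ext σ
  simp only [coboundary, cup, AddMonoidHom.coe_mk, ZeroHom.coe_mk, Pi.add_apply, Pi.smul_apply,
    smul_eq_mul]
  rw [← Fin.sum_congr' _ (show (p + 1) + (q + 1) = p + q + 2 by omega), Fin.sum_univ_add,
    Fin.sum_univ_castSucc (n := p + 1), Fin.sum_univ_succ (n := q + 1)]
  have h1 : ∀ i : Fin (p + 1),
      (-1 : ℤ) ^ (Fin.cast (show (p + 1) + (q + 1) = p + q + 2 by omega)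
        (Fin.castAdd (q + 1) i)).val *
      (a (frontFace p (by omega) (S.δ (Fin.cast (by omega) (Fin.castAdd (q + 1) i)) σ)) *
        b (backFace p q rfl (S.δ (Fin.cast (by omega) (Fin.castAdd (q + 1) i)) σ))) =
      (-1) ^ i.castSucc.val * a (S.δ i.castSucc (frontFace (p + 1) (by omega) σ)) *
        b (backFace (p + 1) q (by omega) σ) := by
    intro i
    rw [frontFace_face_of_le (by omega) _ i.castSucc (by simp),
      backFace_face_of_le rfl _ (by simp; omega)]
    simp [mul_assoc]
  have h2 : ∀ j : Fin (q + 1),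
      (-1 : ℤ) ^ (Fin.cast (show (p + 1) + (q + 1) = p + q + 2 by omega)
        (Fin.natAdd (p + 1) j)).val *
      (a (frontFace p (by omega) (S.δ (Fin.cast (by omega) (Fin.natAdd (p + 1) j)) σ)) *
        b (backFace p q rfl (S.δ (Fin.cast (by omega) (Fin.natAdd (p + 1) j)) σ))) =
      (-1) ^ p * (a (frontFace p (by omega) σ) *
        ((-1) ^ j.succ.val * b (S.δ j.succ (backFace p (q + 1) (by omega) σ)))) := by
    intro j
    rw [frontFace_face_of_lt (by omega) _ (by simp; omega),
      backFace_face_of_lt rfl _ j.succ (by simp; omega)]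
    simp only [Fin.val_cast, Fin.val_natAdd, Fin.val_succ]
    ring
  rw [Finset.sum_congr rfl fun i _ => h1 i, Finset.sum_congr rfl fun j _ => h2 j,
    face_last_frontFace, face_zero_backFace, ← Finset.sum_mul, ← Finset.mul_sum, ← Finset.mul_sum]
  simp only [Fin.val_last, Fin.val_zero]
  ring

lemma cup_mem_cocycles {p q n : ℕ} (h : p + q = n) {a : Cochain S p} {b : Cochain S q}
    (ha : a ∈ cocycles S p) (hb : b ∈ cocycles S q) : cup h a b ∈ cocycles S n := by
  change coboundary S n (cup h a b) = 0
  rw [coboundary_cup, show coboundary S p a = 0 from ha, show coboundary S q b = 0 from hb,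
    cup_zero_left, cup_zero_right, smul_zero, add_zero]

lemma cup_mem_coboundaries_left {p q n : ℕ} (h : p + q = n) {a : Cochain S p} {b : Cochain S q}
    (ha : a ∈ coboundaries S p) (hb : b ∈ cocycles S q) : cup h a b ∈ coboundaries S n := by
  cases p with
  | zero =>
    obtain rfl : a = 0 := ha
    rw [cup_zero_left]
    exact zero_mem _
  | succ p =>
    obtain ⟨c, rfl⟩ := ha
    obtain ⟨n, rfl⟩ : ∃ m, n = m + 1 := ⟨p + q, by omega⟩
    refine ⟨cup (by omega) c b, ?_⟩
    rw [coboundary_cup, show coboundary S q b = 0 from hb, cup_zero_right, smul_zero, add_zero]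

lemma cup_mem_coboundaries_right {p q n : ℕ} (h : p + q = n) {a : Cochain S p} {b : Cochain S q}
    (ha : a ∈ cocycles S p) (hb : b ∈ coboundaries S q) : cup h a b ∈ coboundaries S n := by
  cases q with
  | zero =>
    obtain rfl : b = 0 := hb
    rw [cup_zero_right]
    exact zero_mem _
  | succ q =>
    obtain ⟨c, rfl⟩ := hb
    obtain ⟨n, rfl⟩ : ∃ m, n = m + 1 := ⟨p + q, by omega⟩
    have e : coboundary S n (cup (by omega) a c) = (-1 : ℤ) ^ p • cup h a (coboundary S q c) := by
      rw [coboundary_cup, show coboundary S p a = 0 from ha, cup_zero_left, zero_add]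
    refine ⟨(-1 : ℤ) ^ p • cup (by omega) a c, ?_⟩
    rw [map_zsmul, e, smul_smul, ← mul_pow]
    simp

/-- The cup product of cocycles, with values in cohomology. -/
def cupCocycle {p q n : ℕ} (h : p + q = n) : cocycles S p →+ cocycles S q →+ Cohomology S n :=
  AddMonoidHom.mk' (fun a => AddMonoidHom.mk'
      (fun b => cohomologyClass n ⟨cup h a.1 b.1, cup_mem_cocycles h a.2 b.2⟩)
      (fun b b' => by
        rw [← map_add]
        exact congrArg _ (Subtype.ext (cup_add_right h a.1 b.1 b'.1))))
    (fun a a' => by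
      ext b
      change cohomologyClass n _ = cohomologyClass n _ + cohomologyClass n _
      rw [← map_add]
      exact congrArg _ (Subtype.ext (cup_add_left h a.1 a'.1 b.1)))

/-- The cup product `Hᵖ(S; ℤ) × H^q(S; ℤ) → Hⁿ(S; ℤ)` for `p + q = n`. -/
def cupProduct {p q n : ℕ} (h : p + q = n) : Cohomology S p →+ Cohomology S q →+ Cohomology S n :=
  QuotientAddGroup.lift _
    (AddMonoidHom.mk'
      (fun a => QuotientAddGroup.lift _ (cupCocycle h a) (fun b hb =>
        (QuotientAddGroup.eq_zero_iff _).2 (cup_mem_coboundaries_right h a.2 hb)))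
      (fun a a' => by
        refine QuotientAddGroup.addMonoidHom_ext _ ?_
        ext b
        simp only [map_add]
        rfl))
    (fun a ha => by
      refine QuotientAddGroup.addMonoidHom_ext _ ?_
      ext b
      exact (QuotientAddGroup.eq_zero_iff _).2 (cup_mem_coboundaries_left h ha b.2))

lemma cupProduct_class {p q n : ℕ} (h : p + q = n) (a : cocycles S p) (b : cocycles S q) :
    cupProduct h (cohomologyClass p a) (cohomologyClass q b) =
      cohomologyClass n ⟨cup h a.1 b.1, cup_mem_cocycles h a.2 b.2⟩ := rfl

end Cochains

/-! ## Massey products of one-dimensional classes -/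

section Massey

variable {S : SSet.{u}}

/-- The cup product of two 1-cochains. -/
abbrev cup₁₁ (a b : Cochain S 1) : Cochain S 2 := cup (show 1 + 1 = 2 from rfl) a b

/-- A defining system for `⟨α₁, …, αₙ⟩`: 1-cochains `aᵢⱼ`, indexed by `0 ≤ i < j ≤ n` with
`(i, j) ≠ (0, n)`, such that `a_{i-1,i}` is a cocycle representing `αᵢ` and
`δ aᵢⱼ = ∑_{i<k<j} aᵢₖ ∪ aₖⱼ`. (The values of `a` at other pairs `(i, j)` are irrelevant.) -/
def IsDefiningSystem {n : ℕ} (α : Fin n → Cohomology S 1)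
    (a : Fin (n + 1) → Fin (n + 1) → Cochain S 1) : Prop :=
  (∀ i : Fin n, ∃ h : a i.castSucc i.succ ∈ cocycles S 1,
    cohomologyClass 1 ⟨a i.castSucc i.succ, h⟩ = α i) ∧
  ∀ i j : Fin (n + 1), i < j → ¬ (i = 0 ∧ j = Fin.last n) →
    coboundary S 1 (a i j) = ∑ k ∈ Finset.Ioo i j, cup₁₁ (a i k) (a k j)

/-- The Massey product `⟨α₁, …, αₙ⟩ ⊆ H²(S; ℤ)`: the set of the classes of the cocycles
`∑_{0<k<n} a₀ₖ ∪ aₖₙ`, where `a` runs over all defining systems. It is empty when there is no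
defining system, i.e. when the Massey product is not defined. -/
def massey {n : ℕ} (α : Fin n → Cohomology S 1) : Set (Cohomology S 2) :=
  {β | ∃ a : Fin (n + 1) → Fin (n + 1) → Cochain S 1, IsDefiningSystem α a ∧
    ∃ h : ∑ k ∈ Finset.Ioo 0 (Fin.last n), cup₁₁ (a 0 k) (a k (Fin.last n)) ∈ cocycles S 2,
      cohomologyClass 2 ⟨_, h⟩ = β}

variable (S)

/-- All Massey products of length less than `n` are defined and vanish (with no
indeterminacy). -/
def HasVanishingMassey (n : ℕ) : Prop :=
  ∀ k : ℕ, 2 ≤ k → k < n → ∀ α : Fin k → Cohomology S 1, massey α = {0}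

/-- All Massey products of length less than `n` contain zero. -/
def HasWeaklyVanishingMassey (n : ℕ) : Prop :=
  ∀ k : ℕ, 2 ≤ k → k < n → ∀ α : Fin k → Cohomology S 1, (0 : Cohomology S 2) ∈ massey α

end Massey

/-! ## Homology and the Kronecker pairing -/

section Homology

/-- The coefficient object `ℤ`, in the appropriate universe. -/
abbrev intCoeff : ModuleCat.{u} ℤ := ModuleCat.of ℤ (ULift.{u} ℤ)

variable (S : SSet.{u})

/-- The homology group `Hₙ(S; ℤ)` of a simplicial set. -/
def Homology (n : ℕ) : Type u := (SSet.homology S intCoeff.{u} n : ModuleCat.{u} ℤ)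

instance (n : ℕ) : AddCommGroup (Homology S n) :=
  inferInstanceAs (AddCommGroup (SSet.homology S intCoeff.{u} n : ModuleCat.{u} ℤ))

variable {S}

/-- The homomorphism `Cₙ(S; ℤ) → ℤ` that extends a cochain linearly. -/
def cochainHom {n : ℕ} (a : Cochain S n) : (S.chainComplex intCoeff.{u}).X n ⟶ intCoeff.{u} :=
  Limits.Cofan.IsColimit.desc (S.isColimitChainComplexXCofan intCoeff.{u} n)
    (fun σ => a σ • 𝟙 _)

lemma ι_cochainHom {n : ℕ} (a : Cochain S n) (σ : Simplex S n) :
    S.ιChainComplex σ ≫ cochainHom a = a σ • 𝟙 _ :=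
  Limits.Cofan.IsColimit.fac (S.isColimitChainComplexXCofan intCoeff.{u} n) _ σ

lemma d_cochainHom {n : ℕ} (a : Cochain S n) :
    (S.chainComplex intCoeff.{u}).d (n + 1) n ≫ cochainHom a = cochainHom (coboundary S n a) := by
  apply SSet.chainComplex_hom_ext
  intro σ
  rw [SSet.ιChainComplex_d_assoc, ι_cochainHom, Preadditive.sum_comp]
  simp only [Preadditive.zsmul_comp, ι_cochainHom, smul_smul]
  rw [← Finset.sum_smul]
  rfl

lemma cochainHom_add {n : ℕ} (a b : Cochain S n) :
    cochainHom (a + b) = cochainHom a + cochainHom b := by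
  apply SSet.chainComplex_hom_ext
  intro σ
  rw [Preadditive.comp_add, ι_cochainHom, ι_cochainHom, ι_cochainHom, Pi.add_apply, add_smul]

lemma cochainHom_zero {n : ℕ} : cochainHom (0 : Cochain S n) = 0 := by
  apply SSet.chainComplex_hom_ext
  intro σ
  rw [ι_cochainHom, Limits.comp_zero, Pi.zero_apply, zero_smul]

lemma d_cochainHom_cocycle {n : ℕ} (a : cocycles S n) :
    (S.chainComplex intCoeff.{u}).d (n + 1) n ≫ cochainHom a.1 = 0 := by
  rw [d_cochainHom, show coboundary S n a.1 = 0 from a.2, cochainHom_zero]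

/-- Evaluation of a cocycle on homology classes. -/
def evalCocycle {n : ℕ} (a : cocycles S n) : SSet.homology S intCoeff.{u} n ⟶ intCoeff.{u} :=
  (S.chainComplex intCoeff.{u}).homologyι n ≫
    (S.chainComplex intCoeff.{u}).descOpcycles (cochainHom a.1) (n + 1) (by simp)
      (d_cochainHom_cocycle a)

lemma evalCocycle_add {n : ℕ} (a b : cocycles S n) :
    evalCocycle (a + b) = evalCocycle a + evalCocycle b := by
  rw [evalCocycle, evalCocycle, evalCocycle, ← Preadditive.comp_add]
  congr 1
  rw [← cancel_epi ((S.chainComplex intCoeff.{u}).pOpcycles n), Preadditive.comp_add]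
  simp only [HomologicalComplex.p_descOpcycles]
  exact cochainHom_add a.1 b.1

lemma evalCocycle_coboundary {n : ℕ} (a : cocycles S n) (ha : a.1 ∈ coboundaries S n) :
    evalCocycle a = 0 := by
  cases n with
  | zero =>
    have h0 : a.1 = 0 := ha
    rw [evalCocycle, ← Limits.comp_zero (f := (S.chainComplex intCoeff.{u}).homologyι 0)]
    congr 1
    rw [← cancel_epi ((S.chainComplex intCoeff.{u}).pOpcycles 0)]
    simp only [HomologicalComplex.p_descOpcycles, Limits.comp_zero]
    rw [h0, cochainHom_zero]
  | succ n =>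
    obtain ⟨b, hb⟩ := ha
    exact HomologicalComplex.homologyι_descOpcycles_eq_zero_of_boundary _ _ _ (by simp)
      (i' := n) (cochainHom b) (by rw [d_cochainHom, hb])

/-- The Kronecker (evaluation) pairing `Hⁿ(S; ℤ) × Hₙ(S; ℤ) → ℤ`. -/
def kronecker (n : ℕ) : Cohomology S n →+ Homology S n →+ ℤ :=
  QuotientAddGroup.lift _
    (AddMonoidHom.mk'
      (fun a => AddEquiv.ulift.toAddMonoidHom.comp (evalCocycle a).hom.toAddMonoidHom)
      (fun a b => by rw [evalCocycle_add]; rfl))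
    (fun a ha => by
      change AddMonoidHom.comp _ (evalCocycle a).hom.toAddMonoidHom = 0
      rw [evalCocycle_coboundary a ha]; rfl)

/-- The singular simplicial set of a topological space. -/
abbrev Sing (X : Type u) [TopologicalSpace X] : SSet.{u} := TopCat.toSSet.obj (TopCat.of X)

/-- The homology of `Sing X` is Mathlib's singular homology of `X`. -/
lemma homology_sing (X : Type u) [TopologicalSpace X] (n : ℕ) :
    Homology (Sing X) n = ((AlgebraicTopology.singularHomologyFunctor (ModuleCat.{u} ℤ) n).obj
      intCoeff.{u}).obj (TopCat.of X) := rfl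

/-- The singular 1-simplex given by a path. -/
def pathSimplex {X : Type u} [TopologicalSpace X] {x y : X} (γ : Path x y) : Simplex (Sing X) 1 :=
  ((TopCat.of X).toSSetObjEquiv (op (SimplexCategory.mk 1))).symm
    (γ.toContinuousMap.comp ⟨stdSimplexHomeomorphUnitInterval,
      stdSimplexHomeomorphUnitInterval.continuous⟩)

/-- The class in `Hₙ(S; ℤ)` of an `n`-simplex that is a cycle. -/
def simplexClass {n : ℕ} (σ : Simplex S (n + 1))
    (h : S.ιChainComplex (R := intCoeff.{u}) σ ≫ (S.chainComplex intCoeff.{u}).d (n + 1) n = 0) :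
    Homology S (n + 1) :=
  ((S.chainComplex intCoeff.{u}).liftCycles (S.ιChainComplex σ) n (by simp) h ≫
    (S.chainComplex intCoeff.{u}).homologyπ (n + 1)) (ULift.up 1 : ULift.{u} ℤ)

lemma kronecker_simplexClass {n : ℕ} (σ : Simplex S (n + 1))
    (h : S.ιChainComplex (R := intCoeff.{u}) σ ≫ (S.chainComplex intCoeff.{u}).d (n + 1) n = 0)
    (a : cocycles S (n + 1)) :
    kronecker (n + 1) (cohomologyClass (n + 1) a) (simplexClass σ h) = a.1 σ := by
  have e : ((S.chainComplex intCoeff.{u}).liftCycles (S.ιChainComplex σ) n (by simp) h ≫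
    (S.chainComplex intCoeff.{u}).homologyπ (n + 1)) ≫ evalCocycle a = a.1 σ • 𝟙 _ := by
    simp [evalCocycle, ι_cochainHom]
  have e' := congrArg (fun f : intCoeff.{u} ⟶ intCoeff.{u} =>
    (f (ULift.up 1 : ULift.{u} ℤ) : ULift.{u} ℤ).down) e
  refine Eq.trans e' ?_
  change (a.1 σ • (ULift.up 1 : ULift.{u} ℤ)).down = _
  simp

lemma face_pathSimplex {X : Type u} [TopologicalSpace X] {x : X} (γ : Path x x) (i : Fin 2) :
    (TopCat.of X).toSSetObjEquiv (op (SimplexCategory.mk 0)) ((Sing X).δ i (pathSimplex γ)) =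
      ContinuousMap.const _ x := by
  ext t
  have ht : t = stdSimplex.vertex (S := ℝ) (0 : Fin 1) :=
    Subsingleton.elim (α := stdSimplex ℝ (Fin 1)) _ _
  have h1 := TopCat.toSSetObjEquiv_δ_apply (X := TopCat.of X) (pathSimplex γ) i t
  refine h1.trans ?_
  rw [pathSimplex, Equiv.apply_symm_apply, ht, stdSimplex.map_vertex]
  fin_cases i
  · exact (congrArg γ stdSimplexHomeomorphUnitInterval_one).trans γ.target
  · exact (congrArg γ stdSimplexHomeomorphUnitInterval_zero).trans γ.source

lemma pathSimplex_cycle {X : Type u} [TopologicalSpace X] {x : X} (γ : Path x x) :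
    (Sing X).ιChainComplex (R := intCoeff.{u}) (pathSimplex γ) ≫
      ((Sing X).chainComplex intCoeff.{u}).d 1 0 = 0 := by
  have h : (Sing X).δ 0 (pathSimplex γ) = (Sing X).δ 1 (pathSimplex γ) := by
    apply ((TopCat.of X).toSSetObjEquiv (op (SimplexCategory.mk 0))).injective
    rw [face_pathSimplex, face_pathSimplex]
  rw [SSet.ιChainComplex_d]
  simp [Fin.sum_univ_two, h]

/-- The class of a loop in `H₁(X; ℤ)`. -/
def loopClass {X : Type u} [TopologicalSpace X] {x : X} (γ : Path x x) : Homology (Sing X) 1 :=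
  simplexClass (pathSimplex γ) (pathSimplex_cycle γ)

end Homology

/-! ## The free Lie ring on an abelian group -/

section FreeLie

attribute [local instance 100] LieRing.ofAssociativeRing
attribute [local instance 100] LieAlgebra.ofAssociativeAlgebra
attribute [local instance 2000] FreeLieAlgebra.instLieAlgebra

variable (H : Type w) [AddCommGroup H]

/-- The Lie ideal expressing additivity of the generators. -/
def additivityIdeal : LieIdeal ℤ (FreeLieAlgebra ℤ H) :=
  LieSubmodule.lieSpan ℤ (FreeLieAlgebra ℤ H)
    {y | ∃ a b : H, y = FreeLieAlgebra.of ℤ (a + b) - FreeLieAlgebra.of ℤ a -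
      FreeLieAlgebra.of ℤ b}

/-- The free Lie ring `L(H)` on an abelian group `H`: the free Lie ring on the set `H` modulo
the relations making `H → L(H)` additive. -/
abbrev FreeLieRing : Type w := FreeLieAlgebra ℤ H ⧸ additivityIdeal H

variable {H}

/-- The canonical additive map `H → L(H)`. -/
def FreeLieRing.of : H →+ FreeLieRing H :=
  AddMonoidHom.mk' (fun a => LieSubmodule.Quotient.mk (FreeLieAlgebra.of ℤ a)) (fun a b => by
    have h : FreeLieAlgebra.of ℤ (a + b) - FreeLieAlgebra.of ℤ a - FreeLieAlgebra.of ℤ b ∈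
        additivityIdeal H := LieSubmodule.subset_lieSpan ⟨a, b, rfl⟩
    rw [← LieSubmodule.Quotient.mk_eq_zero'] at h
    change (LieSubmodule.Quotient.mk _ - LieSubmodule.Quotient.mk _ -
      LieSubmodule.Quotient.mk _ : FreeLieRing H) = 0 at h
    rw [sub_sub, sub_eq_zero] at h
    exact h)

/-- The iterated bracket `[h₁, [h₂, …, [hₙ₋₁, hₙ]…]]` in `L(H)`. -/
def iterBracket : List H → FreeLieRing H
  | [] => 0
  | [a] => FreeLieRing.of a
  | a :: b :: t => ⁅FreeLieRing.of a, iterBracket (b :: t)⁆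

/-- The degree `n` part `Lₙ(H)` of `L(H)`, generated by the brackets `[h₁, [h₂, …, [hₙ₋₁, hₙ]…]]`
of elements of `H` (by the Jacobi identity these generate all `n`-fold brackets). -/
def freeLieDegree (H : Type w) [AddCommGroup H] (n : ℕ) : AddSubgroup (FreeLieRing H) :=
  AddSubgroup.closure {y | ∃ h : Fin n → H, y = iterBracket (List.ofFn h)}

/-- The iterated bracket of `n` elements of `H`, as an element of `Lₙ(H)`. -/
def bracketElt {n : ℕ} (h : Fin n → H) : freeLieDegree H n :=
  ⟨iterBracket (List.ofFn h), AddSubgroup.subset_closure ⟨h, rfl⟩⟩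

/-- The canonical Lie homomorphism from the free Lie ring on the set `H` to `T(H)`. -/
def preToTensor (H : Type w) [AddCommGroup H] : FreeLieAlgebra ℤ H →ₗ⁅ℤ⁆ TensorAlgebra ℤ H :=
  FreeLieAlgebra.lift ℤ (fun a => TensorAlgebra.ι ℤ a)

lemma additivityIdeal_le_ker (H : Type w) [AddCommGroup H] :
    additivityIdeal H ≤ (preToTensor H).ker := by
  refine LieSubmodule.lieSpan_le.2 ?_
  rintro _ ⟨a, b, rfl⟩
  refine LieHom.mem_ker.2 ?_
  rw [map_sub, map_sub, preToTensor, FreeLieAlgebra.lift_of_apply, FreeLieAlgebra.lift_of_apply,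
    FreeLieAlgebra.lift_of_apply, map_add]
  abel

/-- The canonical map `L(H) → T(H)` to the tensor ring, which is the identity on `H` and takes
brackets to commutators. -/
def toTensor : FreeLieRing H →+ TensorAlgebra ℤ H :=
  (Submodule.liftQ (additivityIdeal H).toSubmodule (preToTensor H).toLinearMap
    (additivityIdeal_le_ker H)).toAddMonoidHom

lemma toTensor_of (a : H) : toTensor (FreeLieRing.of a) = TensorAlgebra.ι ℤ a := by
  change preToTensor H (FreeLieAlgebra.of ℤ a) = _
  exact FreeLieAlgebra.lift_of_apply ..

lemma toTensor_bracket (x y : FreeLieRing H) :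
    toTensor ⁅x, y⁆ = toTensor x * toTensor y - toTensor y * toTensor x := by
  obtain ⟨x, rfl⟩ := LieSubmodule.Quotient.surjective_mk' (additivityIdeal H) x
  obtain ⟨y, rfl⟩ := LieSubmodule.Quotient.surjective_mk' (additivityIdeal H) y
  exact (preToTensor H).map_lie x y

/-- The linear functional `α₁ ⊗ … ⊗ αₙ` on the tensor ring `T(H)`, taking `h₁ ⊗ … ⊗ hₙ` to
`α₁(h₁) ⋯ αₙ(hₙ)` and vanishing on `H^{⊗ k}` for `k ≠ n`. -/
def contraction {n : ℕ} (α : Fin n → H →+ ℤ) : TensorAlgebra ℤ H →ₗ[ℤ] ℤ :=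
  (PiTensorProduct.lift ((MultilinearMap.mkPiAlgebra ℤ (Fin n) ℤ).compLinearMap
      fun i => (α i).toIntLinearMap)) ∘ₗ
    (DirectSum.component ℤ ℕ (fun k => PiTensorProduct ℤ fun _ : Fin k => H) n) ∘ₗ
    (TensorAlgebra.equivDirectSum (R := ℤ) (M := H)).toLinearMap

lemma contraction_tprod {n : ℕ} (α : Fin n → H →+ ℤ) (h : Fin n → H) :
    contraction α (TensorAlgebra.tprod ℤ H n h) = ∏ i, α i (h i) := by
  change PiTensorProduct.lift _ (DirectSum.component ℤ ℕ _ n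
    (TensorAlgebra.toDirectSum (TensorAlgebra.tprod ℤ H n h))) = _
  rw [TensorAlgebra.toDirectSum_tensorPower_tprod, ← DirectSum.lof_eq_of ℤ, DirectSum.component.lof_self]
  simp

end FreeLie

/-! ## The lower central series -/

section LowerCentral

open scoped commutatorElement

/-- The lower central series in the numbering `G₁ = G`, `Gₙ₊₁ = [G, Gₙ]` for `n ≥ 1`. -/
abbrev lcs (G : Type u) [Group G] (n : ℕ) : Subgroup G :=
  (⊤ : Subgroup G).lowerCentralSeries (n - 1)

lemma lcs_one (G : Type u) [Group G] : lcs G 1 = ⊤ := rfl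

lemma lcs_succ (G : Type u) [Group G] (n : ℕ) (hn : 1 ≤ n) : lcs G (n + 1) = ⁅(⊤ : Subgroup G), lcs G n⁆ := by
  obtain ⟨m, rfl⟩ : ∃ m, n = m + 1 := ⟨n - 1, by omega⟩
  exact Subgroup.commutator_comm _ _

lemma lcs_le_comap {G : Type u} {K : Type v} [Group G] [Group K] (f : G →* K) (n : ℕ) :
    lcs G n ≤ (lcs K n).comap f := by
  rw [← Subgroup.map_le_iff_le_comap, Subgroup.map_lowerCentralSeries]
  exact Subgroup.lowerCentralSeries_mono _ le_top

/-- `f : G → K` is an `n`-equivalence if it induces an isomorphism `G/Gₙ ≅ K/Kₙ`. -/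
def IsNEquivalence {G : Type u} {K : Type v} [Group G] [Group K] (n : ℕ) (f : G →* K) : Prop :=
  Function.Bijective (QuotientGroup.map (lcs G n) (lcs K n) f (lcs_le_comap f n))

/-- The quotient `Gₙ/Gₙ₊₁`, written additively. -/
abbrev GradedQuotient (G : Type u) [Group G] (n : ℕ) : Type u :=
  Additive (lcs G n ⧸ (lcs G (n + 1)).subgroupOf (lcs G n))

/-- The iterated commutator `[g₁, [g₂, …, [gₙ₋₁, gₙ]…]]`. -/
def iterCommutator {G : Type u} [Group G] : List G → G
  | [] => 1
  | [a] => a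
  | a :: b :: t => ⁅a, iterCommutator (b :: t)⁆

lemma iterCommutator_mem {G : Type u} [Group G] : ∀ l : List G, iterCommutator l ∈ lcs G l.length
  | [] => Subgroup.mem_top _
  | [_] => Subgroup.mem_top _
  | a :: b :: t => by
    have h := iterCommutator_mem (b :: t)
    rw [List.length_cons, lcs_succ _ _ (by simp)]
    exact Subgroup.commutator_mem_commutator (Subgroup.mem_top a) h

/-- The class in `Gₙ/Gₙ₊₁` of an iterated commutator of `n` elements of `G`. -/
def commutatorClass {G : Type u} [Group G] {n : ℕ} (g : Fin n → G) : GradedQuotient G n :=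
  Additive.ofMul (QuotientGroup.mk ⟨iterCommutator (List.ofFn g), by
    simpa using iterCommutator_mem (List.ofFn g)⟩)

end LowerCentral

/-! ## The maps of the exact sequence -/

section Statement

/-- The simplicial classifying space of a group: its cohomology is the group cohomology
with trivial coefficients `ℤ`. -/
abbrev BG (G : Type u) [Group G] : SSet.{u} := nerve (SingleObj G)

variable {X : Type u} [TopologicalSpace X]

/-- The element of `π₁(X, x)` given by a loop. -/
abbrev loopElt {x : X} (γ : Path x x) : FundamentalGroup X x :=
  FundamentalGroup.fromPath (Path.Homotopic.Quotient.mk γ)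

/-- A map `θ : H₂(X) → Lₙ(H₁(X))` encodes the Massey products of length `n` if for all
`α₁, …, αₙ ∈ H¹(X)`, all elements `β` of `⟨α₁, …, αₙ⟩` and all `c ∈ H₂(X)` the value `β(c)` equals
`(α₁ ⊗ … ⊗ αₙ)(θ(c))`, where `Lₙ(H₁(X))` is mapped to `H₁(X)^{⊗ n}` and `αᵢ` is viewed as a
functional on `H₁(X)`. -/
def EncodesMassey (n : ℕ)
    (θ : Homology (Sing X) 2 →+ freeLieDegree (Homology (Sing X) 1) n) : Prop :=
  ∀ (α : Fin n → Cohomology (Sing X) 1), ∀ β ∈ massey α, ∀ c : Homology (Sing X) 2,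
    kronecker 2 β c = contraction (fun i => kronecker 1 (α i)) (toTensor (θ c).1)

/-- A map `Lₙ(H₁(X)) → πₙ/πₙ₊₁` is induced by the Lie bracket if it takes the iterated bracket of
the classes of `n` loops to the class of the iterated commutator of these loops. -/
def IsInducedByBracket (x : X) (n : ℕ)
    (ψ : freeLieDegree (Homology (Sing X) 1) n →+ GradedQuotient (FundamentalGroup X x) n) :
    Prop :=
  ∀ γ : Fin n → Path x x,
    ψ (bracketElt fun i => loopClass (γ i)) = commutatorClass fun i => loopElt (γ i)

end Statement

end

end UniversalMassey

/-!
The proof works with a simplicial set `S` whose edges are labelled by a group `K`, in such a way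
that `K` becomes the fundamental group of `S` (`IsLabel`). Both the nerve of `π` and the singular
simplicial set of `X` are labelled by `π` (`isLabel_classifying`, `isLabel_singular`), so that all
assertions about Massey products are proved once, for labelled simplicial sets.

Let `p : F → K` be an `n`-equivalence, and let `s : K → F` be a section of `p` modulo `Kₙ`. The
failure of `s` to be multiplicative is a cocycle with values in `Fₙ/Fₙ₊₁`, and evaluation of this
obstruction class gives a homomorphism `H₂(S) → Fₙ/Fₙ₊₁` (`defectHom`). The sequence
`H₂(S) → Fₙ/Fₙ₊₁ → Kₙ/Kₙ₊₁` is exact (`mem_range_defectHom`): modulo the image of the obstruction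
class the extension `F/Fₙ₊₁` of `K/Kₙ` pulls back to a split extension of `K`, because a cochain of
degree two that vanishes on all cycles is a coboundary (`exists_coboundaryOf_eq`, the part of the
universal coefficient theorem that uses that `H₁` is free).

The relation with Massey products is due to Dwyer. A defining system is the same as a cochain with
values in unitriangular matrices that is multiplicative up to the entry in the upper right corner,
where the cocycle of the Massey product appears. Since `F` is free, such a cochain comes, up to a
coboundary, from a representation of `F` by unitriangular matrices (`exists_representation`), and
the Massey product is the corner entry of this representation, evaluated on the obstruction class.
On an iterated commutator the corner entry is the tensor product of the functionals on the first
superdiagonal, applied to the corresponding iterated bracket (`cornerHom_degreeMap`). This gives the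
formula for the values of Massey products (`kronecker_massey`), where `θ` is the obstruction class
transported along the isomorphism `Lₙ(H₁) ≅ Fₙ/Fₙ₊₁`.

That isomorphism is the theorem of Magnus and Witt (`IsAbelianization.degreeMap_bijective`).
Surjectivity holds for every group. Injectivity holds because the corner entries of the
representations of `F` compute all tensor products of functionals, which separate the elements of
the tensor ring, and because the free Lie ring embeds in the tensor ring
(`eq_zero_of_lieToAssoc_eq_zero`). The embedding is proved by Lazard elimination: a generator `x` is
replaced by the generators `ad(x)ᵏ(y)`, and the free associative ring on these is a module over the
free associative ring on the original generators, on which `x` acts as a derivation.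

If all shorter Massey products contain zero, the obstruction classes vanish one after the other by
the formula above, and `p` is an `n`-equivalence (`isNEquivalence_of_weaklyVanishing`). Cyclicity
holds because the entries of one representation of size `n + 2` provide defining systems for both
products of length `n`, and the remaining terms of the defining equation for length `n + 1` bound
the difference of the two cup products (`cupProduct_massey`). For a space, the Hurewicz theorem in
degree one (`isAbelianization_hurewicz`) identifies `H₁(X)` with the abelianization of `π`.
-/

namespace UniversalMassey

/-! ### The free Lie ring embeds in the free associative ring -/

section Witt

attribute [local instance 100] LieRing.ofAssociativeRing
attribute [local instance 100] LieAlgebra.ofAssociativeAlgebra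
attribute [local instance 2000] FreeLieAlgebra.instLieAlgebra

variable (R : Type v) [CommRing R] {X : Type w}

/-- The bracket monomials of weight `n` in the free Lie ring on `X`, where the generator `x` has
weight `wt x`. -/
inductive IsLieMonomial (wt : X → ℕ) : ℕ → FreeLieAlgebra R X → Prop
  | of (x : X) : IsLieMonomial wt (wt x) (FreeLieAlgebra.of R x)
  | lie {m n : ℕ} {u v : FreeLieAlgebra R X} : IsLieMonomial wt m u → IsLieMonomial wt n v →
      IsLieMonomial wt (m + n) ⁅u, v⁆

/-- The part of weight `n` of the free Lie ring on the weighted set `X`. -/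
noncomputable def lieWeight (wt : X → ℕ) (n : ℕ) : Submodule R (FreeLieAlgebra R X) :=
  Submodule.span R {u | IsLieMonomial R wt n u}

lemma lie_mem_lieWeight {wt : X → ℕ} {m n : ℕ} {u v : FreeLieAlgebra R X}
    (hu : u ∈ lieWeight R wt m) (hv : v ∈ lieWeight R wt n) : ⁅u, v⁆ ∈ lieWeight R wt (m + n) := by
  induction hu using Submodule.span_induction with
  | mem u hu =>
    induction hv using Submodule.span_induction with
    | mem v hv => exact Submodule.subset_span (hu.lie hv)
    | zero => rw [lie_zero]; exact zero_mem _
    | add a b _ _ ha hb => rw [lie_add]; exact add_mem ha hb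
    | smul c a _ ha => rw [lie_smul]; exact Submodule.smul_mem _ c ha
  | zero => rw [zero_lie]; exact zero_mem _
  | add a b _ _ ha hb => rw [add_lie]; exact add_mem ha hb
  | smul c a _ ha => rw [smul_lie]; exact Submodule.smul_mem _ c ha

lemma IsLieMonomial.le_weight {wt : X → ℕ} {r : ℕ} (hr : ∀ x, r ≤ wt x) {n : ℕ}
    {u : FreeLieAlgebra R X} (h : IsLieMonomial R wt n u) : r ≤ n := by
  induction h with
  | of x => exact hr x
  | lie _ _ h _ => omega

/-- The homomorphism from the free Lie ring to the free associative ring. -/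
noncomputable def lieToAssoc (X : Type w) : FreeLieAlgebra R X →ₗ⁅R⁆ FreeAlgebra R X :=
  FreeLieAlgebra.lift R (FreeAlgebra.ι R)

lemma lieToAssoc_of (x : X) : lieToAssoc R X (FreeLieAlgebra.of R x) = FreeAlgebra.ι R x :=
  FreeLieAlgebra.lift_of_apply ..

section Elimination

variable (x : X)

/-- The generating set obtained by eliminating `x`: the pair `(k, y)` stands for
`ad(x)ᵏ(y)`. -/
abbrev Elim (x : X) : Type w := ℕ × {y : X // y ≠ x}

/-- The weight of `ad(x)ᵏ(y)`. -/
def elimWeight (wt : X → ℕ) : Elim x → ℕ := fun y => wt y.2.1 + y.1 * wt x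

/-- The Lie homomorphism taking the generator `(k, y)` to `ad(x)ᵏ(y)`. -/
noncomputable def elimHom : FreeLieAlgebra R (Elim x) →ₗ⁅R⁆ FreeLieAlgebra R X :=
  FreeLieAlgebra.lift R fun y =>
    (fun u => ⁅FreeLieAlgebra.of R x, u⁆)^[y.1] (FreeLieAlgebra.of R y.2.1)

lemma elimHom_of (k : ℕ) (y : {y : X // y ≠ x}) :
    elimHom R x (FreeLieAlgebra.of R (k, y)) =
      (fun u => ⁅FreeLieAlgebra.of R x, u⁆)^[k] (FreeLieAlgebra.of R y.1) :=
  FreeLieAlgebra.lift_of_apply ..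

lemma elimHom_of_zero (y : {y : X // y ≠ x}) :
    elimHom R x (FreeLieAlgebra.of R (0, y)) = FreeLieAlgebra.of R y.1 :=
  elimHom_of R x 0 y

lemma elimHom_of_succ (k : ℕ) (y : {y : X // y ≠ x}) :
    elimHom R x (FreeLieAlgebra.of R (k + 1, y)) =
      ⁅FreeLieAlgebra.of R x, elimHom R x (FreeLieAlgebra.of R (k, y))⁆ := by
  rw [elimHom_of, elimHom_of, Function.iterate_succ_apply']

/-- The image of `elimHom x` is stable under `ad(x)`. -/
lemma exists_elimHom_eq_lie (wt : X → ℕ) {m : ℕ} {v : FreeLieAlgebra R (Elim x)}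
    (hv : v ∈ lieWeight R (elimWeight x wt) m) :
    ∃ v' ∈ lieWeight R (elimWeight x wt) (wt x + m),
      elimHom R x v' = ⁅FreeLieAlgebra.of R x, elimHom R x v⁆ := by
  induction hv using Submodule.span_induction with
  | mem v hv =>
    induction hv with
    | of y =>
      obtain ⟨k, y⟩ := y
      refine ⟨FreeLieAlgebra.of R (k + 1, y), Submodule.subset_span ?_,
        elimHom_of_succ R x k y⟩
      have h := IsLieMonomial.of (R := R) (wt := elimWeight x wt) (k + 1, y)
      have e : elimWeight x wt (k + 1, y) = wt x + elimWeight x wt (k, y) := by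
        simp only [elimWeight]; ring
      rwa [e] at h
    | @lie a b u v hu hv ihu ihv =>
      obtain ⟨u', hu', eu⟩ := ihu
      obtain ⟨v', hv', ev⟩ := ihv
      refine ⟨⁅u', v⁆ + ⁅u, v'⁆, add_mem ?_ ?_, ?_⟩
      · rw [← add_assoc]
        exact lie_mem_lieWeight R hu' (Submodule.subset_span hv)
      · rw [add_left_comm]
        exact lie_mem_lieWeight R (Submodule.subset_span hu) hv'
      · rw [map_add, LieHom.map_lie, LieHom.map_lie, LieHom.map_lie, eu, ev]
        exact (leibniz_lie _ _ _).symm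
  | zero => exact ⟨0, zero_mem _, by simp⟩
  | add a b _ _ ha hb =>
    obtain ⟨a', ha', ea⟩ := ha
    obtain ⟨b', hb', eb⟩ := hb
    exact ⟨a' + b', add_mem ha' hb', by simp [ea, eb]⟩
  | smul c a _ ha =>
    obtain ⟨a', ha', ea⟩ := ha
    exact ⟨c • a', Submodule.smul_mem _ c ha', by simp [ea]⟩

/-- The free Lie ring on `X` is the sum of `R x` and the image of `elimHom x`. -/
lemma exists_eq_smul_add_elimHom (wt : X → ℕ) {m : ℕ} {u : FreeLieAlgebra R X}
    (hu : u ∈ lieWeight R wt m) :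
    ∃ (c : R), ∃ v ∈ lieWeight R (elimWeight x wt) m, (c = 0 ∨ m = wt x) ∧
      u = c • FreeLieAlgebra.of R x + elimHom R x v := by
  induction hu using Submodule.span_induction with
  | mem u hu =>
    induction hu with
    | of y =>
      by_cases h : y = x
      · exact ⟨1, 0, zero_mem _, Or.inr (by rw [h]), by simp [h]⟩
      · refine ⟨0, FreeLieAlgebra.of R (0, ⟨y, h⟩), Submodule.subset_span ?_, Or.inl rfl, ?_⟩
        · have := IsLieMonomial.of (R := R) (wt := elimWeight x wt) (0, ⟨y, h⟩)
          simpa [elimWeight] using this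
        · rw [elimHom_of_zero, zero_smul, zero_add]
    | @lie a b u v hu hv ihu ihv =>
      obtain ⟨c, u', hu', hc, eu⟩ := ihu
      obtain ⟨d, v', hv', hd, ev⟩ := ihv
      obtain ⟨u'', hu'', eu''⟩ := exists_elimHom_eq_lie R x wt hu'
      obtain ⟨v'', hv'', ev''⟩ := exists_elimHom_eq_lie R x wt hv'
      refine ⟨0, c • v'' - d • u'' + ⁅u', v'⁆, add_mem (sub_mem ?_ ?_) ?_, Or.inl rfl, ?_⟩
      · rcases hc with rfl | rfl
        · rw [zero_smul]; exact zero_mem _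
        · exact Submodule.smul_mem _ c hv''
      · rcases hd with rfl | rfl
        · rw [zero_smul]; exact zero_mem _
        · rw [add_comm a]; exact Submodule.smul_mem _ d hu''
      · exact lie_mem_lieWeight R hu' hv'
      · rw [eu, ev, map_add, map_sub, map_smul, map_smul, LieHom.map_lie, eu'', ev'']
        simp only [add_lie, lie_add, smul_lie, lie_smul, lie_self, smul_zero, zero_add, zero_smul]
        rw [← lie_skew (FreeLieAlgebra.of R x) (elimHom R x u'), smul_neg]
        abel
  | zero => exact ⟨0, 0, zero_mem _, Or.inl rfl, by simp⟩
  | add a b _ _ ha hb =>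
    obtain ⟨c, a', ha', hc, ea⟩ := ha
    obtain ⟨d, b', hb', hd, eb⟩ := hb
    refine ⟨c + d, a' + b', add_mem ha' hb', ?_, ?_⟩
    · rcases hc with rfl | h
      · rcases hd with rfl | h
        · exact Or.inl (add_zero 0)
        · exact Or.inr h
      · exact Or.inr h
    rw [ea, eb, map_add, add_smul]; abel
  | smul d a _ ha =>
    obtain ⟨c, a', ha', hc, ea⟩ := ha
    refine ⟨d * c, d • a', Submodule.smul_mem _ d ha', ?_, ?_⟩
    · rcases hc with rfl | h
      · exact Or.inl (mul_zero d)
      · exact Or.inr h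
    · rw [ea, map_smul, smul_add, smul_smul]

/-- The derivation of the free associative ring on `Elim x` that takes `(k, y)` to `(k + 1, y)`,
as the second component of a homomorphism to the dual numbers. -/
noncomputable def elimDual : FreeAlgebra R (Elim x) →ₐ[R]
    TrivSqZeroExt (FreeAlgebra R (Elim x)) (FreeAlgebra R (Elim x)) :=
  FreeAlgebra.lift R fun y =>
    TrivSqZeroExt.inl (FreeAlgebra.ι R y) + TrivSqZeroExt.inr (FreeAlgebra.ι R (y.1 + 1, y.2))

lemma fst_elimDual (p : FreeAlgebra R (Elim x)) : (elimDual R x p).fst = p := by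
  have h : (TrivSqZeroExt.fstHom R (FreeAlgebra R (Elim x)) (FreeAlgebra R (Elim x))).comp
      (elimDual R x) = AlgHom.id R _ := by
    ext y
    simp [elimDual]
  exact DFunLike.congr_fun h p

/-- The derivation `(k, y) ↦ (k + 1, y)`, which is how `x` acts on the free associative ring on
`Elim x`. -/
noncomputable def elimDer : Module.End R (FreeAlgebra R (Elim x)) :=
  (TrivSqZeroExt.sndHom (FreeAlgebra R (Elim x)) (FreeAlgebra R (Elim x))).restrictScalars R ∘ₗ
    (elimDual R x).toLinearMap

lemma elimDer_apply (p : FreeAlgebra R (Elim x)) : elimDer R x p = (elimDual R x p).snd := rfl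

lemma elimDer_ι (y : Elim x) :
    elimDer R x (FreeAlgebra.ι R y) = FreeAlgebra.ι R (y.1 + 1, y.2) := by
  simp [elimDer_apply, elimDual]

lemma elimDer_one : elimDer R x 1 = 0 := by simp [elimDer_apply]

lemma elimDer_mul (p q : FreeAlgebra R (Elim x)) :
    elimDer R x (p * q) = p * elimDer R x q + elimDer R x p * q := by
  simp [elimDer_apply, fst_elimDual]

open Classical in
/-- The action of the free associative ring on `X` on the free associative ring on `Elim x`: the
generator `x` acts by the derivation `elimDer x` and the other generators `y` act by left
multiplication by `(0, y)`. -/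
noncomputable def elimAction : FreeAlgebra R X →ₐ[R] Module.End R (FreeAlgebra R (Elim x)) :=
  FreeAlgebra.lift R fun y =>
    if h : y = x then elimDer R x else LinearMap.mulLeft R (FreeAlgebra.ι R (0, ⟨y, h⟩))

lemma elimAction_self : elimAction R x (FreeAlgebra.ι R x) = elimDer R x := by
  simp [elimAction]

/-- The image of `v` under `elimHom x` acts by left multiplication by `v`. -/
lemma elimAction_elimHom (v : FreeLieAlgebra R (Elim x)) :
    elimAction R x (lieToAssoc R X (elimHom R x v)) = LinearMap.mulLeft R (lieToAssoc R _ v) := by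
  have h : ((elimAction R x).toLieHom.comp
      (lieToAssoc R X)).comp (elimHom R x) =
      ((Algebra.lmul R (FreeAlgebra R (Elim x))).toLieHom).comp
        (lieToAssoc R (Elim x)) := by
    apply FreeLieAlgebra.hom_ext
    rintro ⟨k, y⟩
    change elimAction R x (lieToAssoc R X (elimHom R x _)) = LinearMap.mulLeft R (lieToAssoc R (Elim x) _)
    induction k with
    | zero =>
      rw [elimHom_of_zero, lieToAssoc_of, lieToAssoc_of]
      simp [elimAction, y.2]
    | succ k ih =>
      rw [elimHom_of_succ, LieHom.map_lie, lieToAssoc_of, LieRing.of_associative_ring_bracket,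
        map_sub, map_mul, map_mul, ih, elimAction_self, lieToAssoc_of, lieToAssoc_of]
      ext q
      change elimDer R x (_ * q) - _ * elimDer R x q = _ * q
      rw [elimDer_mul, elimDer_ι, add_sub_cancel_left]
  exact DFunLike.congr_fun h v

end Elimination

/-- The kernel of the map to the free associative ring has no elements of weight `N`, by
elimination of the generators one at a time in the order of increasing weight. Here `r` is the
least weight, `m` bounds the number of generators of weight `r`, and `d` bounds the number of
weights from `r` to `N`. -/
lemma eq_zero_of_lieToAssoc_eq_zero_aux (N : ℕ) : ∀ (d m r : ℕ), 1 ≤ r → N + 1 ≤ r + d →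
    ∀ {X : Type w} (wt : X → ℕ), (∀ x, r ≤ wt x) → {x | wt x ≤ N}.Finite →
      {x | wt x = r}.ncard ≤ m → ∀ u ∈ lieWeight R wt N, lieToAssoc R X u = 0 → u = 0 := by
  intro d
  induction d with
  | zero =>
    intro m r hr hd X wt hwt _ _ u hu _
    have : {u | IsLieMonomial R wt N u} = ∅ := by
      ext u
      simp only [Set.mem_ofPred_eq, Set.mem_empty_iff_false, iff_false]
      intro h
      have := h.le_weight R hwt
      omega
    rw [lieWeight, this, Submodule.span_empty] at hu
    exact hu
  | succ d ihd =>
    intro m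
    induction m with
    | zero =>
      intro r hr hd X wt hwt hfin hcard u hu h0
      by_cases hrN : N < r
      · exact ihd 0 r hr (by omega) wt hwt hfin hcard u hu h0
      have hfr : {x | wt x = r}.Finite := hfin.subset fun x (hx : wt x = r) => by
        change wt x ≤ N; omega
      have he := (Set.ncard_eq_zero hfr).1 (Nat.le_zero.1 hcard)
      refine ihd _ (r + 1) (by omega) (by omega) wt (fun x => ?_) hfin le_rfl u hu h0
      have h1 := hwt x
      have h2 : x ∉ {x | wt x = r} := by rw [he]; exact Set.notMem_empty x
      exact lt_of_le_of_ne h1 fun h => h2 h.symm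
    | succ m ihm =>
      intro r hr hd X wt hwt hfin hcard u hu h0
      by_cases hrN : N < r
      · exact ihd _ r hr (by omega) wt hwt hfin hcard u hu h0
      by_cases hx : ∃ x, wt x = r
      swap
      · refine ihm r hr hd wt hwt hfin ?_ u hu h0
        have : {x | wt x = r} = ∅ := by ext x; simpa using fun h => hx ⟨x, h⟩
        simp [this]
      obtain ⟨x, hx⟩ := hx
      have hfr : {x | wt x = r}.Finite := hfin.subset fun x (hx : wt x = r) => by
        change wt x ≤ N; omega
      obtain ⟨c, v, hv, -, rfl⟩ := exists_eq_smul_add_elimHom R x wt hu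
      -- Acting on `1`, the generator `x` gives `0` and the image of `v` gives `v`.
      have hv0 : lieToAssoc R _ v = 0 := by
        have h1 := congrArg (fun p => elimAction R x p 1) h0
        simp only [map_add, map_smul, lieToAssoc_of, elimAction_elimHom] at h1
        rw [LinearMap.add_apply, LinearMap.smul_apply, elimAction_self, elimDer_one] at h1
        simpa using h1
      have hfin' : {y | elimWeight x wt y ≤ N}.Finite := by
        refine ((Set.finite_Iic N).prod (hfin.preimage (f := Subtype.val)
          (Subtype.val_injective (p := fun y => y ≠ x)).injOn)).subset ?_
        rintro ⟨k, y⟩ hy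
        change wt y.1 + k * wt x ≤ N at hy
        have : k * 1 ≤ k * wt x := Nat.mul_le_mul_left k (by omega)
        exact ⟨show k ≤ N by omega, show wt y.1 ≤ N by omega⟩
      -- The elements of `Elim x` of weight `r` are the pairs `(0, y)`: there is one fewer than before.
      have hcard' : {y | elimWeight x wt y = r}.ncard ≤ m := by
        have hinj : Set.InjOn (fun y : Elim x => y.2.1) {y | elimWeight x wt y = r} := by
          rintro ⟨k, y⟩ hy ⟨l, z⟩ hz e
          change wt y.1 + k * wt x = r at hy
          change wt z.1 + l * wt x = r at hz
          have e : y.1 = z.1 := e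
          have e' : y = z := Subtype.ext e
          subst e'
          have : k = l := Nat.eq_of_mul_eq_mul_right (m := wt x) (by omega) (by omega)
          rw [this]
        rw [← hinj.ncard_image]
        have hsub : (fun y : Elim x => y.2.1) '' {y | elimWeight x wt y = r} ⊆
            {y | wt y = r} \ {x} := by
          rintro _ ⟨⟨k, y⟩, hy, rfl⟩
          change wt y.1 + k * wt x = r at hy
          have := hwt y.1
          exact ⟨show wt y.1 = r by omega, y.2⟩
        refine (Set.ncard_le_ncard hsub hfr.sdiff).trans ?_
        rw [Set.ncard_sdiff_singleton_of_mem (show x ∈ {y | wt y = r} from hx)]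
        omega
      have hv' := ihm r hr hd (elimWeight x wt)
        (fun y => (hwt y.2.1).trans (Nat.le_add_right _ _)) hfin' hcard' v hv hv0
      subst hv'
      have hc : c = 0 := by
        have h2 : c • FreeAlgebra.ι R x = 0 := by simpa [lieToAssoc_of] using h0
        have h3 := congrArg (FreeAlgebra.lift R fun _ : X => (1 : R)) h2
        simpa using h3
      simp [hc]

/-- **Witt's theorem**: the free Lie ring embeds in the free associative ring, stated for
homogeneous elements. -/
lemma eq_zero_of_lieToAssoc_eq_zero {N : ℕ} {u : FreeLieAlgebra R X}
    (hu : u ∈ lieWeight R (fun _ => 1) N) (h0 : lieToAssoc R X u = 0) : u = 0 := by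
  classical
  -- Only the finitely many generators that occur in `u` are kept in weight at most `N`.
  obtain ⟨J, hJ⟩ : ∃ J : Finset X, ∀ J', J ⊆ J' →
      u ∈ lieWeight R (fun x => if x ∈ J' then 1 else N + 1) N := by
    clear h0
    have key : ∀ {n : ℕ} {u : FreeLieAlgebra R X}, IsLieMonomial R (fun _ => 1) n u → n ≤ N →
        ∃ J : Finset X, ∀ J', J ⊆ J' →
          IsLieMonomial R (fun x => if x ∈ J' then 1 else N + 1) n u := by
      intro n u h
      induction h with
      | of x =>
        intro _
        refine ⟨{x}, fun J' hJ' => ?_⟩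
        have := IsLieMonomial.of (R := R) (wt := fun x => if x ∈ J' then 1 else N + 1) x
        rwa [if_pos (Finset.singleton_subset_iff.1 hJ')] at this
      | lie _ _ h1 h2 =>
        intro hN
        obtain ⟨J1, h1⟩ := h1 (by omega)
        obtain ⟨J2, h2⟩ := h2 (by omega)
        exact ⟨J1 ∪ J2, fun J' hJ' => (h1 J' (Finset.union_subset_left hJ')).lie
          (h2 J' (Finset.union_subset_right hJ'))⟩
    induction hu using Submodule.span_induction with
    | mem u hu =>
      obtain ⟨J, hJ⟩ := key hu le_rfl
      exact ⟨J, fun J' hJ' => Submodule.subset_span (hJ J' hJ')⟩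
    | zero => exact ⟨∅, fun _ _ => zero_mem _⟩
    | add a b _ _ ha hb =>
      obtain ⟨J1, h1⟩ := ha
      obtain ⟨J2, h2⟩ := hb
      exact ⟨J1 ∪ J2, fun J' hJ' => add_mem (h1 J' (Finset.union_subset_left hJ'))
          (h2 J' (Finset.union_subset_right hJ'))⟩
    | smul c a _ ha =>
      obtain ⟨J, hJ⟩ := ha
      exact ⟨J, fun J' hJ' => Submodule.smul_mem _ c (hJ J' hJ')⟩
  refine eq_zero_of_lieToAssoc_eq_zero_aux R N N _ 1 le_rfl (by omega) _ (fun x => ?_)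
    (J.finite_toSet.subset fun x hx => ?_) le_rfl u (hJ J subset_rfl) h0
  · split_ifs <;> omega
  · by_contra h
    have : (if x ∈ J then 1 else N + 1) ≤ N := hx
    rw [if_neg (show x ∉ J from h)] at this
    omega

end Witt

/-! ### Coordinates in the tensor ring of a free abelian group -/

section TensorCoordinates

variable {H : Type u} [AddCommGroup H] {ι : Type w}

/-- The subgroup of the tensor ring generated by the words `t i₁ ⊗ … ⊗ t iₙ` of length `n`. -/
def tensorWords (t : ι → H) (n : ℕ) : Submodule ℤ (TensorAlgebra ℤ H) :=
  Submodule.span ℤ (Set.range fun I : Fin n → ι => TensorAlgebra.tprod ℤ H n fun k => t (I k))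

lemma list_prod_mem_tensorWords (t : ι → H) (l : List ι) :
    (l.map fun i => TensorAlgebra.ι ℤ (t i)).prod ∈ tensorWords t l.length := by
  refine Submodule.subset_span ⟨l.get, ?_⟩
  dsimp only
  rw [TensorAlgebra.tprod_apply]
  congr 1
  conv_rhs => rw [← List.ofFn_get l, List.map_ofFn]
  rfl

lemma mul_mem_tensorWords (t : ι → H) {m n : ℕ} {y z : TensorAlgebra ℤ H}
    (hy : y ∈ tensorWords t m) (hz : z ∈ tensorWords t n) : y * z ∈ tensorWords t (m + n) := by
  induction hy using Submodule.span_induction with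
  | mem y hy =>
    induction hz using Submodule.span_induction with
    | mem z hz =>
      obtain ⟨I, rfl⟩ := hy
      obtain ⟨J, rfl⟩ := hz
      have h := list_prod_mem_tensorWords t (List.ofFn I ++ List.ofFn J)
      rw [List.map_append, List.prod_append, List.map_ofFn, List.map_ofFn, List.length_append,
        List.length_ofFn, List.length_ofFn] at h
      dsimp only
      rw [TensorAlgebra.tprod_apply, TensorAlgebra.tprod_apply]
      exact h
    | zero => rw [mul_zero]; exact zero_mem _
    | add a b _ _ ha hb => rw [mul_add]; exact add_mem ha hb
    | smul c a _ ha => rw [mul_smul_comm]; exact Submodule.smul_mem _ c ha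
  | zero => rw [zero_mul]; exact zero_mem _
  | add a b _ _ ha hb => rw [add_mul]; exact add_mem ha hb
  | smul c a _ ha => rw [smul_mul_assoc]; exact Submodule.smul_mem _ c ha

/-- An element of `H^{⊗ n}` is recovered from its values under the functionals
`ξ i₁ ⊗ … ⊗ ξ iₙ`, where `ξ` is dual to the generating family `t`. -/
lemma eq_finsum_contraction {t : ι → H} {ξ : ι → H →+ ℤ} (h1 : ∀ i, ξ i (t i) = 1)
    (h0 : ∀ i j, i ≠ j → ξ i (t j) = 0) {n : ℕ} {z : TensorAlgebra ℤ H}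
    (hz : z ∈ tensorWords t n) :
    {I : Fin n → ι | contraction (fun k => ξ (I k)) z ≠ 0}.Finite ∧
      z = ∑ᶠ I : Fin n → ι, contraction (fun k => ξ (I k)) z •
        TensorAlgebra.tprod ℤ H n fun k => t (I k) := by
  classical
  obtain ⟨f, rfl⟩ := Finsupp.mem_span_range_iff_exists_finsupp.1 hz
  have key : ∀ I : Fin n → ι, contraction (fun k => ξ (I k))
      (f.sum fun I c => c • TensorAlgebra.tprod ℤ H n fun k => t (I k)) = f I := by
    intro I
    rw [Finsupp.sum, map_sum, Finset.sum_eq_single I]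
    · rw [map_smul, contraction_tprod, Finset.prod_eq_one fun k _ => h1 _, smul_eq_mul, mul_one]
    · intro J _ hJ
      obtain ⟨k, hk⟩ := Function.ne_iff.1 hJ
      rw [map_smul, contraction_tprod, Finset.prod_eq_zero (Finset.mem_univ k)
        (h0 _ _ fun e => hk e.symm), smul_zero]
    · intro hI
      rw [Finsupp.notMem_support_iff.1 hI, zero_smul, map_zero]
  simp only [key]
  refine ⟨f.hasFiniteSupport, ?_⟩
  rw [finsum_eq_sum_of_support_subset _ (s := f.support)]
  · rfl
  · intro I hI
    rw [Finset.mem_coe, Finsupp.mem_support_iff]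
    rintro e
    exact hI (by dsimp only; rw [e, zero_smul])

attribute [local instance 100] LieRing.ofAssociativeRing
attribute [local instance 100] LieAlgebra.ofAssociativeAlgebra
attribute [local instance 2000] FreeLieAlgebra.instLieAlgebra

/-- The homomorphism from the free Lie ring on the set `ι` to the free Lie ring on the abelian
group `H` given by a family of elements of `H`. -/
noncomputable def familyToLie (t : ι → H) : FreeLieAlgebra ℤ ι →ₗ⁅ℤ⁆ FreeLieRing H :=
  FreeLieAlgebra.lift ℤ fun i => FreeLieRing.of (t i)

lemma familyToLie_of (t : ι → H) (i : ι) :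
    familyToLie t (FreeLieAlgebra.of ℤ i) = FreeLieRing.of (t i) :=
  FreeLieAlgebra.lift_of_apply ..

lemma exists_familyToLie_eq_of {t : ι → H} (ht : AddSubgroup.closure (Set.range t) = ⊤) (h : H) :
    ∃ u ∈ lieWeight ℤ (fun _ : ι => 1) 1, familyToLie t u = FreeLieRing.of h := by
  have hh : h ∈ AddSubgroup.closure (Set.range t) := by rw [ht]; trivial
  induction hh using AddSubgroup.closure_induction with
  | mem h hh =>
    obtain ⟨i, rfl⟩ := hh
    exact ⟨_, Submodule.subset_span (.of i), familyToLie_of t i⟩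
  | zero => exact ⟨0, zero_mem _, by rw [map_zero, map_zero]⟩
  | add a b _ _ ha hb =>
    obtain ⟨a', ha', ea⟩ := ha
    obtain ⟨b', hb', eb⟩ := hb
    exact ⟨a' + b', add_mem ha' hb', by rw [map_add, map_add, ea, eb]⟩
  | neg a _ ha =>
    obtain ⟨a', ha', ea⟩ := ha
    exact ⟨-a', neg_mem ha', by rw [map_neg, map_neg, ea]⟩

lemma exists_familyToLie_eq_iterBracket {t : ι → H}
    (ht : AddSubgroup.closure (Set.range t) = ⊤) : ∀ l : List H,
    ∃ u ∈ lieWeight ℤ (fun _ : ι => 1) l.length, familyToLie t u = iterBracket l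
  | [] => ⟨0, zero_mem _, map_zero _⟩
  | [a] => exists_familyToLie_eq_of ht a
  | a :: b :: l => by
    obtain ⟨u, hu, eu⟩ := exists_familyToLie_eq_of ht a
    obtain ⟨v, hv, ev⟩ := exists_familyToLie_eq_iterBracket ht (b :: l)
    refine ⟨⁅u, v⁆, ?_, ?_⟩
    · rw [List.length_cons, add_comm]
      exact lie_mem_lieWeight ℤ hu hv
    · rw [LieHom.map_lie, eu, ev]; rfl

lemma exists_familyToLie_eq {t : ι → H} (ht : AddSubgroup.closure (Set.range t) = ⊤) {n : ℕ}
    {z : FreeLieRing H} (hz : z ∈ freeLieDegree H n) :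
    ∃ u ∈ lieWeight ℤ (fun _ : ι => 1) n, familyToLie t u = z := by
  induction hz using AddSubgroup.closure_induction with
  | mem z hz =>
    obtain ⟨h, rfl⟩ := hz
    have := exists_familyToLie_eq_iterBracket ht (List.ofFn h)
    rwa [List.length_ofFn] at this
  | zero => exact ⟨0, zero_mem _, map_zero _⟩
  | add a b _ _ ha hb =>
    obtain ⟨a', ha', ea⟩ := ha
    obtain ⟨b', hb', eb⟩ := hb
    exact ⟨a' + b', add_mem ha' hb', by rw [map_add, ea, eb]⟩
  | neg a _ ha =>
    obtain ⟨a', ha', ea⟩ := ha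
    exact ⟨-a', neg_mem ha', by rw [map_neg, ea]⟩

lemma toTensor_familyToLie_mem (t : ι → H) {n : ℕ} {u : FreeLieAlgebra ℤ ι}
    (hu : u ∈ lieWeight ℤ (fun _ : ι => 1) n) : toTensor (familyToLie t u) ∈ tensorWords t n := by
  induction hu using Submodule.span_induction with
  | mem u hu =>
    induction hu with
    | of i =>
      rw [familyToLie_of, toTensor_of]
      simpa using list_prod_mem_tensorWords t [i]
    | @lie a b u v _ _ hu hv =>
      rw [LieHom.map_lie, toTensor_bracket]
      refine sub_mem (mul_mem_tensorWords t hu hv) ?_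
      rw [add_comm]
      exact mul_mem_tensorWords t hv hu
  | zero => rw [map_zero, map_zero]; exact zero_mem _
  | add a b _ _ ha hb => rw [map_add, map_add]; exact add_mem ha hb
  | smul c a _ ha =>
    have e := map_intCast_smul (toTensor.comp (familyToLie t).toLinearMap.toAddMonoidHom) ℤ ℤ c a
    exact e ▸ zsmul_mem ha c

lemma toTensor_mem_tensorWords {t : ι → H} (ht : AddSubgroup.closure (Set.range t) = ⊤) {n : ℕ}
    (z : freeLieDegree H n) : toTensor z.1 ∈ tensorWords t n := by
  obtain ⟨u, hu, e⟩ := exists_familyToLie_eq ht z.2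
  rw [← e]
  exact toTensor_familyToLie_mem t hu

lemma equivFreeAlgebra_toTensor_familyToLie (t : Module.Basis ι ℤ H) {n : ℕ}
    {u : FreeLieAlgebra ℤ ι} (hu : u ∈ lieWeight ℤ (fun _ : ι => 1) n) :
    TensorAlgebra.equivFreeAlgebra t (toTensor (familyToLie t u)) = lieToAssoc ℤ ι u := by
  induction hu using Submodule.span_induction with
  | mem u hu =>
    induction hu with
    | of i =>
      rw [familyToLie_of, toTensor_of, lieToAssoc_of, TensorAlgebra.equivFreeAlgebra_ι_apply]
    | @lie a b u v _ _ hu hv =>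
      rw [LieHom.map_lie, toTensor_bracket, map_sub, map_mul, map_mul, hu, hv, LieHom.map_lie]
      rfl
  | zero => simp only [map_zero]
  | add a b _ _ ha hb => simp only [map_add, ha, hb]
  | smul c a _ ha =>
    have e := map_intCast_smul (toTensor.comp (familyToLie t).toLinearMap.toAddMonoidHom) ℤ ℤ c a
    refine (congrArg _ e).trans ((map_zsmul _ c _).trans ?_)
    rw [map_smul, ← ha]
    rfl

/-- The free Lie ring on a free abelian group embeds in the tensor ring. -/
lemma toTensor_injOn (t : Module.Basis ι ℤ H) {n : ℕ} {z : FreeLieRing H}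
    (hz : z ∈ freeLieDegree H n) (h0 : toTensor z = 0) : z = 0 := by
  have ht : AddSubgroup.closure (Set.range t) = ⊤ := by
    rw [← Submodule.span_int_eq_addSubgroupClosure, t.span_eq]; rfl
  obtain ⟨u, hu, rfl⟩ := exists_familyToLie_eq ht hz
  have h := equivFreeAlgebra_toTensor_familyToLie t hu
  rw [h0, map_zero] at h
  rw [eq_zero_of_lieToAssoc_eq_zero ℤ hu h.symm, map_zero]

end TensorCoordinates


/-! ### The graded Lie ring of a group -/

section GradedLie

open scoped commutatorElement DirectSum

variable {G : Type u} [Group G]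

lemma lcs_antitone {m n : ℕ} (h : m ≤ n) : lcs G n ≤ lcs G m :=
  Subgroup.lowerCentralSeries_antitone _ (by omega)

lemma mem_lcs_one (g : G) : g ∈ lcs G 1 := Subgroup.mem_top g

lemma commutator_lcs_le (m n : ℕ) : ⁅lcs G (m + 1), lcs G (n + 1)⁆ ≤ lcs G (m + n + 2) := by
  induction m generalizing n with
  | zero => rw [lcs_one, ← lcs_succ _ _ (by omega)]; exact lcs_antitone (by omega)
  | succ m ih =>
    -- The three subgroups lemma in the quotient by the right hand side.
    set N := lcs G (m + 1 + n + 2)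
    have hbot : ∀ {K : Subgroup G}, K ≤ N → K.map (QuotientGroup.mk' N) = ⊥ := fun hK => by
      rwa [Subgroup.map_eq_bot_iff, QuotientGroup.ker_mk']
    have key := Subgroup.commutator_commutator_eq_bot_of_rotate
      (H₁ := (⊤ : Subgroup G).map (QuotientGroup.mk' N))
      (H₂ := (lcs G (m + 1)).map (QuotientGroup.mk' N))
      (H₃ := (lcs G (n + 1)).map (QuotientGroup.mk' N)) ?_ ?_
    · rwa [← Subgroup.map_commutator, ← Subgroup.map_commutator, Subgroup.map_eq_bot_iff,
        QuotientGroup.ker_mk', ← lcs_succ G (m + 1) (by omega)] at key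
    · rw [← Subgroup.map_commutator, ← Subgroup.map_commutator]
      refine hbot ((Subgroup.commutator_mono (ih n) le_rfl).trans ?_)
      rw [Subgroup.commutator_comm, ← lcs_succ _ _ (by omega)]
      exact lcs_antitone (by omega)
    · rw [← Subgroup.map_commutator, ← Subgroup.map_commutator]
      refine hbot ?_
      rw [Subgroup.commutator_comm (lcs G (n + 1)), ← lcs_succ _ _ (by omega),
        Subgroup.commutator_comm]
      exact (ih (n + 1)).trans (lcs_antitone (by omega))

/-- A commutator of elements of `Gᵢ` and `Gⱼ` lies in `Gᵢ₊ⱼ`; the index `0` counts as `1`, since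
`G₀ = G₁`. -/
lemma commutator_mem_lcs {i j n : ℕ} {g h : G} (hg : g ∈ lcs G i) (hh : h ∈ lcs G j)
    (hn : n ≤ max i 1 + max j 1) : ⁅g, h⁆ ∈ lcs G n := by
  have hg' : g ∈ lcs G (i - 1 + 1) := by
    cases i with
    | zero => exact hg
    | succ i => exact hg
  have hh' : h ∈ lcs G (j - 1 + 1) := by
    cases j with
    | zero => exact hh
    | succ j => exact hh
  exact lcs_antitone (by omega) (commutator_lcs_le _ _ (Subgroup.commutator_mem_commutator hg' hh'))

/-- The class in `Gₙ/Gₙ₊₁` of an element of `Gₙ`. -/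
def gradedClass (n : ℕ) (g : G) (hg : g ∈ lcs G n) : GradedQuotient G n :=
  Additive.ofMul (QuotientGroup.mk ⟨g, hg⟩)

lemma gradedClass_surjective {n : ℕ} (a : GradedQuotient G n) : ∃ g hg, gradedClass n g hg = a := by
  obtain ⟨⟨g, hg⟩, rfl⟩ := QuotientGroup.mk_surjective (Additive.toMul a)
  exact ⟨g, hg, rfl⟩

lemma gradedClass_mul {n : ℕ} {g h : G} (hg : g ∈ lcs G n) (hh : h ∈ lcs G n) :
    gradedClass n (g * h) (mul_mem hg hh) = gradedClass n g hg + gradedClass n h hh := rfl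

lemma gradedClass_inv {n : ℕ} {g : G} (hg : g ∈ lcs G n) :
    gradedClass n g⁻¹ (inv_mem hg) = -gradedClass n g hg := rfl

lemma gradedClass_eq_zero {n : ℕ} {g : G} (hg : g ∈ lcs G n) :
    gradedClass n g hg = 0 ↔ g ∈ lcs G (n + 1) :=
  (QuotientGroup.eq_one_iff (N := (lcs G (n + 1)).subgroupOf (lcs G n)) ⟨g, hg⟩)

lemma gradedClass_congr {n : ℕ} {g h : G} (e : g = h) (hg : g ∈ lcs G n) :
    gradedClass n g hg = gradedClass n h (e ▸ hg) := by subst e; rfl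

lemma gradedClass_eq {n : ℕ} {g h : G} (hg : g ∈ lcs G n) (hh : h ∈ lcs G n) :
    gradedClass n g hg = gradedClass n h hh ↔ g * h⁻¹ ∈ lcs G (n + 1) := by
  rw [← sub_eq_zero, sub_eq_add_neg, ← gradedClass_inv, ← gradedClass_mul, gradedClass_eq_zero]

instance (n : ℕ) : AddCommGroup (GradedQuotient G n) :=
  { (inferInstance : AddGroup (GradedQuotient G n)) with
    add_comm := fun a b => by
      obtain ⟨g, hg, rfl⟩ := gradedClass_surjective a
      obtain ⟨h, hh, rfl⟩ := gradedClass_surjective b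
      rw [← gradedClass_mul, ← gradedClass_mul, gradedClass_eq]
      have e : g * h * (h * g)⁻¹ = ⁅g, h⁆ := by simp [commutatorElement_def, mul_assoc]
      rw [e]
      exact commutator_mem_lcs hg hh (by omega) }

lemma gradedClass_commutator_mul_left {i j n : ℕ} {g g' h : G} (hg : g ∈ lcs G i)
    (hg' : g' ∈ lcs G i) (hh : h ∈ lcs G j) (hn : n ≤ i + j) :
    gradedClass n ⁅g * g', h⁆ (commutator_mem_lcs (mul_mem hg hg') hh (by omega)) =
      gradedClass n ⁅g, h⁆ (commutator_mem_lcs hg hh (by omega)) +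
        gradedClass n ⁅g', h⁆ (commutator_mem_lcs hg' hh (by omega)) := by
  have e : ⁅g * g', h⁆ = ⁅g, ⁅g', h⁆⁆ * (⁅g', h⁆ * ⁅g, h⁆) := by
    simp only [commutatorElement_def]; group
  have h1 : ⁅g', h⁆ ∈ lcs G (i + j) := commutator_mem_lcs hg' hh (by omega)
  have h2 : ⁅g, ⁅g', h⁆⁆ ∈ lcs G (n + 1) := commutator_mem_lcs hg h1 (by omega)
  have h3 : ⁅g, ⁅g', h⁆⁆ ∈ lcs G n := lcs_antitone (by omega) h2
  rw [gradedClass_congr e, gradedClass_mul h3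
    (mul_mem (commutator_mem_lcs hg' hh (by omega)) (commutator_mem_lcs hg hh (by omega))),
    gradedClass_mul (commutator_mem_lcs hg' hh (by omega)) (commutator_mem_lcs hg hh (by omega)),
    (gradedClass_eq_zero h3).2 h2, zero_add, add_comm]

lemma gradedClass_commutator_swap {n : ℕ} {g h : G} (hgh : ⁅g, h⁆ ∈ lcs G n) :
    gradedClass n ⁅h, g⁆ (by rw [← commutatorElement_inv]; exact inv_mem hgh) =
      -gradedClass n ⁅g, h⁆ hgh := by
  rw [← gradedClass_inv]
  exact gradedClass_congr (commutatorElement_inv g h).symm _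

lemma gradedClass_commutator_mul_right {i j n : ℕ} {g h h' : G} (hg : g ∈ lcs G i)
    (hh : h ∈ lcs G j) (hh' : h' ∈ lcs G j) (hn : n ≤ i + j) :
    gradedClass n ⁅g, h * h'⁆ (commutator_mem_lcs hg (mul_mem hh hh') (by omega)) =
      gradedClass n ⁅g, h⁆ (commutator_mem_lcs hg hh (by omega)) +
        gradedClass n ⁅g, h'⁆ (commutator_mem_lcs hg hh' (by omega)) := by
  have e := gradedClass_commutator_mul_left hh hh' hg (n := n) (by omega)
  rw [gradedClass_commutator_swap (commutator_mem_lcs (mul_mem hh hh') hg (by omega)), e,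
    gradedClass_commutator_swap (commutator_mem_lcs hh hg (by omega)),
    gradedClass_commutator_swap (commutator_mem_lcs hh' hg (by omega))]
  abel

lemma gradedClass_commutator_congr {i j n : ℕ} {g g' h h' : G} (hg : g ∈ lcs G i)
    (hg' : g' ∈ lcs G i) (hh : h ∈ lcs G j) (hh' : h' ∈ lcs G j)
    (eg : gradedClass i g hg = gradedClass i g' hg')
    (eh : gradedClass j h hh = gradedClass j h' hh') (hn : n ≤ i + j) :
    gradedClass n ⁅g, h⁆ (commutator_mem_lcs hg hh (by omega)) =
      gradedClass n ⁅g', h'⁆ (commutator_mem_lcs hg' hh' (by omega)) := by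
  rw [gradedClass_eq] at eg eh
  have e1 : ⁅g * g'⁻¹ * g', h * h'⁻¹ * h'⁆ = ⁅g, h⁆ := by simp
  have m1 : g * g'⁻¹ ∈ lcs G i := lcs_antitone (by omega) eg
  have m2 : h * h'⁻¹ ∈ lcs G j := lcs_antitone (by omega) eh
  rw [gradedClass_congr e1.symm,
    gradedClass_commutator_mul_left m1 hg' (mul_mem m2 hh') (by omega),
    gradedClass_commutator_mul_right hg' m2 hh' (by omega),
    (gradedClass_eq_zero _).2 (commutator_mem_lcs eg (mul_mem m2 hh') (by omega)),
    (gradedClass_eq_zero _).2 (commutator_mem_lcs hg' eh (by omega)), zero_add, zero_add]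

/-- The commutator pairing `Gᵢ/Gᵢ₊₁ × Gⱼ/Gⱼ₊₁ → Gᵢ₊ⱼ/Gᵢ₊ⱼ₊₁`, defined through representatives. -/
noncomputable def gradedBracket {i j : ℕ} (a : GradedQuotient G i) (b : GradedQuotient G j) :
    GradedQuotient G (i + j) :=
  gradedClass (i + j) ⁅(gradedClass_surjective a).choose, (gradedClass_surjective b).choose⁆
    (commutator_mem_lcs (gradedClass_surjective a).choose_spec.choose
      (gradedClass_surjective b).choose_spec.choose (by omega))

lemma gradedBracket_gradedClass {i j : ℕ} {g h : G} (hg : g ∈ lcs G i) (hh : h ∈ lcs G j) :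
    gradedBracket (gradedClass i g hg) (gradedClass j h hh) =
      gradedClass (i + j) ⁅g, h⁆ (commutator_mem_lcs hg hh (by omega)) :=
  gradedClass_commutator_congr _ _ _ _
    (gradedClass_surjective (gradedClass i g hg)).choose_spec.choose_spec
    (gradedClass_surjective (gradedClass j h hh)).choose_spec.choose_spec le_rfl

lemma gradedBracket_add_left {i j : ℕ} (a a' : GradedQuotient G i) (b : GradedQuotient G j) :
    gradedBracket (a + a') b = gradedBracket a b + gradedBracket a' b := by
  obtain ⟨g, hg, rfl⟩ := gradedClass_surjective a
  obtain ⟨g', hg', rfl⟩ := gradedClass_surjective a'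
  obtain ⟨h, hh, rfl⟩ := gradedClass_surjective b
  rw [← gradedClass_mul, gradedBracket_gradedClass, gradedBracket_gradedClass,
    gradedBracket_gradedClass, gradedClass_commutator_mul_left hg hg' hh le_rfl]

lemma gradedBracket_add_right {i j : ℕ} (a : GradedQuotient G i) (b b' : GradedQuotient G j) :
    gradedBracket a (b + b') = gradedBracket a b + gradedBracket a b' := by
  obtain ⟨g, hg, rfl⟩ := gradedClass_surjective a
  obtain ⟨h, hh, rfl⟩ := gradedClass_surjective b
  obtain ⟨h', hh', rfl⟩ := gradedClass_surjective b'
  rw [← gradedClass_mul, gradedBracket_gradedClass, gradedBracket_gradedClass,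
    gradedBracket_gradedClass, gradedClass_commutator_mul_right hg hh hh' le_rfl]

noncomputable instance : DirectSum.GNonUnitalNonAssocSemiring (GradedQuotient G) where
  mul := gradedBracket
  mul_zero {i j} a := by
    have h := gradedBracket_add_right a (0 : GradedQuotient G j) 0
    rw [add_zero] at h
    exact left_eq_add.1 h
  zero_mul {i j} b := by
    have h := gradedBracket_add_left (0 : GradedQuotient G i) 0 b
    rw [add_zero] at h
    exact left_eq_add.1 h
  mul_add := gradedBracket_add_right
  add_mul := gradedBracket_add_left

variable (G) in
/-- The graded Lie ring `⨁ Gₙ/Gₙ₊₁` of a group, with the bracket induced by commutators. -/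
def GradedLie : Type u := ⨁ n, GradedQuotient G n

noncomputable instance : AddCommGroup (GradedLie G) :=
  inferInstanceAs (AddCommGroup (⨁ n, GradedQuotient G n))

/-- The homogeneous element of the graded Lie ring given by an element of `Gₙ`. -/
noncomputable def homogeneous (n : ℕ) (g : G) (hg : g ∈ lcs G n) : GradedLie G :=
  DirectSum.of (GradedQuotient G) n (gradedClass n g hg)

lemma homogeneous_congr {m n : ℕ} {g h : G} (hmn : m = n) (e : g = h) (hg : g ∈ lcs G m) :
    homogeneous m g hg = homogeneous n h (hmn ▸ e ▸ hg) := by subst hmn; subst e; rfl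

lemma homogeneous_mul {n : ℕ} {g h : G} (hg : g ∈ lcs G n) (hh : h ∈ lcs G n) :
    homogeneous n (g * h) (mul_mem hg hh) = homogeneous n g hg + homogeneous n h hh := by
  rw [homogeneous, gradedClass_mul, map_add]; rfl

lemma homogeneous_eq_zero {n : ℕ} {g : G} (hg : g ∈ lcs G n) (h : g ∈ lcs G (n + 1)) :
    homogeneous n g hg = 0 := by
  rw [homogeneous, (gradedClass_eq_zero hg).2 h, map_zero]; rfl

lemma gradedLie_induction {p : GradedLie G → Prop} (h0 : p 0)
    (h : ∀ n g hg, p (homogeneous n g hg)) (hadd : ∀ a b, p a → p b → p (a + b)) (a : GradedLie G) :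
    p a := by
  refine DirectSum.induction_on a h0 (fun n a => ?_) hadd
  obtain ⟨g, hg, rfl⟩ := gradedClass_surjective a
  exact h n g hg

/-- The bracket of the graded Lie ring, as the product of a non-associative ring. -/
noncomputable instance : NonUnitalNonAssocSemiring (GradedLie G) :=
  inferInstanceAs (NonUnitalNonAssocSemiring (⨁ n, GradedQuotient G n))

lemma homogeneous_mul_homogeneous {i j : ℕ} {g h : G} (hg : g ∈ lcs G i) (hh : h ∈ lcs G j) :
    homogeneous i g hg * homogeneous j h hh =
      homogeneous (i + j) ⁅g, h⁆ (commutator_mem_lcs hg hh (by omega)) := by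
  refine (DirectSum.of_mul_of (A := GradedQuotient G) _ _).trans ?_
  exact congrArg _ (gradedBracket_gradedClass hg hh)

lemma gradedLie_mul_comm (a b : GradedLie G) : a * b + b * a = 0 := by
  induction a using gradedLie_induction with
  | h0 => simp
  | hadd a a' ha ha' =>
    rw [add_mul, mul_add, add_add_add_comm, ha, ha', add_zero]
  | h i g hg =>
    induction b using gradedLie_induction with
    | h0 => simp
    | hadd b b' hb hb' =>
      rw [add_mul, mul_add, add_add_add_comm, hb, hb', add_zero]
    | h j h hh =>
      rw [homogeneous_mul_homogeneous, homogeneous_mul_homogeneous,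
        homogeneous_congr (add_comm j i) rfl, ← homogeneous_mul]
      refine homogeneous_eq_zero _ ?_
      rw [← commutatorElement_inv g h, mul_inv_cancel]
      exact one_mem _

lemma gradedLie_mul_self (a : GradedLie G) : a * a = 0 := by
  induction a using gradedLie_induction with
  | h0 => simp
  | hadd a b ha hb =>
    rw [add_mul, mul_add, mul_add, ha, hb, zero_add, add_zero, gradedLie_mul_comm]
  | h i g hg =>
    rw [homogeneous_mul_homogeneous]
    exact homogeneous_eq_zero _ (by simp)

/-- The Jacobi identity, from an identity of Hall–Witt type for triple commutators. -/
lemma gradedLie_jacobi (a b c : GradedLie G) : a * (b * c) = a * b * c + b * (a * c) := by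
  induction a using gradedLie_induction with
  | h0 => simp
  | hadd a a' ha ha' => simp only [add_mul, mul_add, ha, ha']; abel
  | h i x hx =>
  induction b using gradedLie_induction with
  | h0 => simp
  | hadd b b' hb hb' => simp only [add_mul, mul_add, hb, hb']; abel
  | h j y hy =>
  induction c using gradedLie_induction with
  | h0 => simp
  | hadd c c' hc hc' => simp only [mul_add, hc, hc']; abel
  | h k z hz =>
  simp only [homogeneous_mul_homogeneous]
  rw [homogeneous_congr (show i + (j + k) = i + j + k by omega) rfl,
    homogeneous_congr (show j + (i + k) = i + j + k by omega) rfl]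
  set n := i + j + k with hn
  have ha : ⁅x, y⁆ ∈ lcs G (max i 1 + max j 1) := commutator_mem_lcs hx hy le_rfl
  have hb : ⁅x, z⁆ ∈ lcs G (max i 1 + max k 1) := commutator_mem_lcs hx hz le_rfl
  have hc : ⁅y, z⁆ ∈ lcs G (max j 1 + max k 1) := commutator_mem_lcs hy hz le_rfl
  have hyb : ⁅y, ⁅x, z⁆⁆ ∈ lcs G n := commutator_mem_lcs hy hb (by omega)
  have haz : ⁅⁅x, y⁆, z⁆ ∈ lcs G n := commutator_mem_lcs ha hz (by omega)
  have h3 : ⁅⁅x, y⁆, ⁅x, z⁆⁆ ∈ lcs G (n + 1) := commutator_mem_lcs ha hb (by omega)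
  have h4 : ⁅⁅x, z⁆, ⁅⁅x, y⁆, z⁆⁆ ∈ lcs G (n + 1) := commutator_mem_lcs hb haz (by omega)
  have hle : lcs G (n + 1) ≤ lcs G n := lcs_antitone (by omega)
  have hw := mul_mem (hle h3) (mul_mem (hle h4) haz)
  set w := ⁅⁅x, y⁆, ⁅x, z⁆⁆ * (⁅⁅x, z⁆, ⁅⁅x, y⁆, z⁆⁆ * ⁅⁅x, y⁆, z⁆) with hw_def
  have h5 : ⁅⁅y, z⁆, w⁆ ∈ lcs G (n + 1) := commutator_mem_lcs hc hw (by omega)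
  have h2 : ⁅⁅x, z⁆, ⁅y, z⁆⁆ ∈ lcs G (n + 1) := commutator_mem_lcs hb hc (by omega)
  have h1 : ⁅⁅x, y⁆, ⁅y, ⁅x, z⁆ * z⁆⁆ ∈ lcs G (n + 1) := by
    have : ⁅x, z⁆ * z ∈ lcs G k := mul_mem (lcs_antitone (by omega) hb) hz
    exact commutator_mem_lcs ha (commutator_mem_lcs hy this le_rfl) (by omega)
  -- All factors except `⁅y, ⁅x, z⁆⁆` and the factor `⁅⁅x, y⁆, z⁆` of `w` lie in `Gₙ₊₁`.
  have e : ⁅x, ⁅y, z⁆⁆ = ⁅⁅x, y⁆, ⁅y, ⁅x, z⁆ * z⁆⁆ *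
      (⁅y, ⁅x, z⁆⁆ * (⁅⁅x, z⁆, ⁅y, z⁆⁆ * (⁅⁅y, z⁆, w⁆ * w))) := by
    simp only [hw_def, commutatorElement_def]; group
  rw [homogeneous_congr rfl e, homogeneous_mul (hle h1)
      (mul_mem hyb (mul_mem (hle h2) (mul_mem (hle h5) hw))),
    homogeneous_mul hyb (mul_mem (hle h2) (mul_mem (hle h5) hw)),
    homogeneous_mul (hle h2) (mul_mem (hle h5) hw), homogeneous_mul (hle h5) hw,
    homogeneous_mul (hle h3) (mul_mem (hle h4) haz), homogeneous_mul (hle h4) haz,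
    homogeneous_eq_zero _ h1, homogeneous_eq_zero _ h2, homogeneous_eq_zero _ h3,
    homogeneous_eq_zero _ h4, homogeneous_eq_zero _ h5]
  simp only [zero_add]
  exact add_comm _ _

noncomputable instance : LieRing (GradedLie G) where
  bracket a b := a * b
  add_lie := add_mul
  lie_add := mul_add
  lie_self := gradedLie_mul_self
  leibniz_lie := gradedLie_jacobi

lemma lie_homogeneous {i j : ℕ} {g h : G} (hg : g ∈ lcs G i) (hh : h ∈ lcs G j) :
    ⁅homogeneous i g hg, homogeneous j h hh⁆ =
      homogeneous (i + j) ⁅g, h⁆ (commutator_mem_lcs hg hh (by omega)) :=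
  homogeneous_mul_homogeneous hg hh

end GradedLie


section GradedMap

open scoped commutatorElement DirectSum

attribute [local instance 2000] FreeLieAlgebra.instLieAlgebra

variable {G : Type u} [Group G] {H : Type w} [AddCommGroup H] (e : H →+ GradedQuotient G 1)

variable (G) in
/-- The inclusion of the part of degree one. -/
noncomputable def degreeOne : GradedQuotient G 1 →+ GradedLie G :=
  DirectSum.of (GradedQuotient G) 1

/-- The Lie homomorphism from the free Lie ring on the set `H` to the graded Lie ring of `G`
that extends `e` in degree one. -/
noncomputable def preGradedMap : FreeLieAlgebra ℤ H →ₗ⁅ℤ⁆ GradedLie G :=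
  FreeLieAlgebra.lift ℤ fun h => degreeOne G (e h)

lemma additivityIdeal_le_ker_preGradedMap : additivityIdeal H ≤ (preGradedMap e).ker := by
  refine LieSubmodule.lieSpan_le.2 ?_
  rintro _ ⟨a, b, rfl⟩
  refine LieHom.mem_ker.2 ?_
  rw [map_sub, map_sub, preGradedMap, FreeLieAlgebra.lift_of_apply, FreeLieAlgebra.lift_of_apply,
    FreeLieAlgebra.lift_of_apply, map_add, map_add, sub_sub]
  exact sub_self _

/-- The Lie homomorphism from the free Lie ring on `H` to the graded Lie ring of `G` that extends
`e : H → G/G₂`. -/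
noncomputable def gradedMap : FreeLieRing H →+ GradedLie G :=
  (Submodule.liftQ (additivityIdeal H).toSubmodule (preGradedMap e).toLinearMap
    (additivityIdeal_le_ker_preGradedMap e)).toAddMonoidHom

lemma gradedMap_of (h : H) :
    gradedMap e (FreeLieRing.of h) = degreeOne G (e h) := by
  change preGradedMap e (FreeLieAlgebra.of ℤ h) = _
  exact FreeLieAlgebra.lift_of_apply ..

lemma gradedMap_lie (x y : FreeLieRing H) : gradedMap e ⁅x, y⁆ = ⁅gradedMap e x, gradedMap e y⁆ := by
  obtain ⟨x, rfl⟩ := LieSubmodule.Quotient.surjective_mk' (additivityIdeal H) x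
  obtain ⟨y, rfl⟩ := LieSubmodule.Quotient.surjective_mk' (additivityIdeal H) y
  exact (preGradedMap e).map_lie x y

variable {e}

lemma gradedMap_iterBracket (a : H × G) (l : List (H × G))
    (hl : ∀ b ∈ a :: l, e b.1 = gradedClass 1 b.2 (mem_lcs_one _)) :
    gradedMap e (iterBracket ((a :: l).map Prod.fst)) =
      homogeneous _ (iterCommutator ((a :: l).map Prod.snd)) (iterCommutator_mem _) := by
  induction l generalizing a with
  | nil =>
    refine (gradedMap_of e a.1).trans ?_
    rw [hl a (by simp)]
    rfl
  | cons b l ih =>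
    change gradedMap e ⁅FreeLieRing.of a.1, iterBracket ((b :: l).map Prod.fst)⁆ = _
    rw [gradedMap_lie, ih b fun c hc => hl c (List.mem_cons_of_mem a hc), gradedMap_of,
      hl a (by simp)]
    refine (lie_homogeneous (mem_lcs_one a.2) (iterCommutator_mem _)).trans ?_
    refine homogeneous_congr ?_ rfl _
    simp; omega

variable (e) in
/-- The degree `n` part `Lₙ(H) → Gₙ/Gₙ₊₁` of the Lie homomorphism extending `e`. -/
noncomputable def degreeMap (n : ℕ) : freeLieDegree H n →+ GradedQuotient G n :=
  ((DFinsupp.evalAddMonoidHom n : (⨁ n, GradedQuotient G n) →+ GradedQuotient G n).comp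
    (gradedMap e)).comp (freeLieDegree H n).subtype

lemma degreeMap_bracketElt {n : ℕ} (hn : 1 ≤ n) {h : Fin n → H} {g : Fin n → G}
    (hg : ∀ i, e (h i) = gradedClass 1 (g i) (mem_lcs_one _)) :
    degreeMap e n (bracketElt h) = commutatorClass g := by
  have hl : ∀ b ∈ List.ofFn fun i => (h i, g i), e b.1 = gradedClass 1 b.2 (mem_lcs_one _) := by
    intro b hb
    obtain ⟨i, rfl⟩ := List.mem_ofFn.1 hb
    exact hg i
  have h1 : (List.ofFn fun i => (h i, g i)).map Prod.fst = List.ofFn h := by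
    rw [List.map_ofFn]; rfl
  have h2 : (List.ofFn fun i => (h i, g i)).map Prod.snd = List.ofFn g := by
    rw [List.map_ofFn]; rfl
  obtain ⟨a, l, e0⟩ : ∃ a l, (List.ofFn fun i => (h i, g i)) = a :: l :=
    List.exists_cons_of_ne_nil fun e0 => by
      have := congrArg List.length e0
      simp at this; omega
  rw [e0] at hl h1 h2
  have key := gradedMap_iterBracket a l hl
  rw [h1] at key
  have key2 : gradedMap e (iterBracket (List.ofFn h)) =
      DirectSum.of (GradedQuotient G) n (commutatorClass g) := by
    rw [key]
    exact homogeneous_congr (by rw [h2, List.length_ofFn]) (by rw [h2]) _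
  change DFinsupp.evalAddMonoidHom n (gradedMap e (iterBracket (List.ofFn h))) = _
  rw [key2]
  exact DirectSum.of_eq_same _ _

lemma iterCommutator_cons (g : G) {l : List G} (hl : l ≠ []) :
    iterCommutator (g :: l) = ⁅g, iterCommutator l⁆ := by
  cases l with
  | nil => exact absurd rfl hl
  | cons a l => rfl

/-- The group `Gₙ/Gₙ₊₁` is generated by the classes of iterated commutators. -/
lemma closure_range_commutatorClass {n : ℕ} (hn : 1 ≤ n) :
    AddSubgroup.closure (Set.range (commutatorClass : (Fin n → G) → GradedQuotient G n)) = ⊤ := by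
  induction n, hn using Nat.le_induction with
  | base =>
    rw [eq_top_iff]
    intro a _
    obtain ⟨g, hg, rfl⟩ := gradedClass_surjective a
    exact AddSubgroup.subset_closure ⟨fun _ => g, rfl⟩
  | succ n hn ih =>
    rw [eq_top_iff]
    intro a _
    obtain ⟨x, hx, rfl⟩ := gradedClass_surjective a
    have hx' := hx
    rw [lcs_succ G n hn] at hx'
    suffices H : ∃ hx, gradedClass (n + 1) x hx ∈ AddSubgroup.closure (Set.range commutatorClass) from
      H.2
    -- The class of `⁅g, h⁆` is additive in the class of `h`.
    have hbr : ∀ (g : G) (a : GradedQuotient G n) (h : G) (hh : h ∈ lcs G n),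
        gradedClass n h hh = a →
        gradedClass (n + 1) ⁅g, h⁆ (commutator_mem_lcs (mem_lcs_one g) hh (by omega)) ∈
          AddSubgroup.closure (Set.range commutatorClass) := by
      intro g a
      have ha : a ∈ AddSubgroup.closure (Set.range (commutatorClass : (Fin n → G) → _)) := by
        rw [ih]; trivial
      induction ha using AddSubgroup.closure_induction with
      | mem a ha =>
        rintro h hh rfl
        obtain ⟨g', e⟩ := ha
        have hc : iterCommutator (List.ofFn g') ∈ lcs G n := by
          simpa using iterCommutator_mem (List.ofFn g')
        rw [gradedClass_commutator_congr (mem_lcs_one g) (mem_lcs_one g) hh hc rfl e.symm (by omega)]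
        refine AddSubgroup.subset_closure ⟨Fin.cons g g', gradedClass_congr ?_ _⟩
        rw [List.ofFn_cons, iterCommutator_cons]
        intro e0
        have := congrArg List.length e0
        simp at this; omega
      | zero =>
        intro h hh e
        rw [gradedClass_eq_zero] at e
        rw [(gradedClass_eq_zero _).2 (commutator_mem_lcs (mem_lcs_one g) e (by omega))]
        exact zero_mem _
      | add a b _ _ iha ihb =>
        intro h hh e
        obtain ⟨c, hc, rfl⟩ := gradedClass_surjective a
        obtain ⟨d, hd, rfl⟩ := gradedClass_surjective b
        rw [← gradedClass_mul] at e
        rw [gradedClass_commutator_congr (mem_lcs_one g) (mem_lcs_one g) hh _ rfl e (by omega),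
          gradedClass_commutator_mul_right (mem_lcs_one g) hc hd (by omega)]
        exact add_mem (iha c hc rfl) (ihb d hd rfl)
      | neg a _ iha =>
        intro h hh e
        have e1 := iha h⁻¹ (inv_mem hh) (by rw [gradedClass_inv hh, e, neg_neg])
        have e2 := gradedClass_commutator_mul_right (mem_lcs_one g) hh (inv_mem hh)
          (n := n + 1) (by omega)
        rw [gradedClass_congr (show ⁅g, h * h⁻¹⁆ = 1 by simp),
          (gradedClass_eq_zero _).2 (one_mem _)] at e2
        rw [eq_neg_of_add_eq_zero_left e2.symm]
        exact neg_mem e1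
    refine Subgroup.closure_induction (p := fun x _ => ∃ hx, gradedClass (n + 1) x hx ∈
      AddSubgroup.closure (Set.range commutatorClass)) ?_ ?_ ?_ ?_ hx'
    · rintro _ ⟨g, -, h, hh, rfl⟩
      exact ⟨_, hbr g _ h hh rfl⟩
    · exact ⟨one_mem _, zero_mem _⟩
    · rintro a b _ _ ⟨ha, ha'⟩ ⟨hb, hb'⟩
      exact ⟨mul_mem ha hb, add_mem ha' hb'⟩
    · rintro a _ ⟨ha, ha'⟩
      exact ⟨inv_mem ha, neg_mem ha'⟩

lemma degreeMap_surjective {n : ℕ} (hn : 1 ≤ n) (he : Function.Surjective e) :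
    Function.Surjective (degreeMap e n) := by
  rw [← AddMonoidHom.range_eq_top, eq_top_iff, ← closure_range_commutatorClass hn,
    AddSubgroup.closure_le]
  rintro _ ⟨g, rfl⟩
  choose h hh using fun i => he (gradedClass 1 (g i) (mem_lcs_one _))
  exact ⟨bracketElt h, degreeMap_bracketElt hn hh⟩

/-- Two homomorphisms on `Lₙ(H)` are equal if they agree on brackets of elements of `H`. -/
lemma freeLieDegree_hom_ext {n : ℕ} {A : Type*} [AddGroup A] {f g : freeLieDegree H n →+ A}
    (h : ∀ x : Fin n → H, f (bracketElt x) = g (bracketElt x)) : f = g := by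
  ext ⟨z, hz⟩
  induction hz using AddSubgroup.closure_induction with
  | mem z hz => obtain ⟨x, rfl⟩ := hz; exact h x
  | zero => exact (map_zero f).trans (map_zero g).symm
  | add a b ha hb iha ihb =>
    exact (map_add f ⟨a, ha⟩ ⟨b, hb⟩).trans
      ((congrArg₂ (· + ·) iha ihb).trans (map_add g ⟨a, ha⟩ ⟨b, hb⟩).symm)
  | neg a ha iha =>
    exact (map_neg f ⟨a, ha⟩).trans ((congrArg Neg.neg iha).trans (map_neg g ⟨a, ha⟩).symm)

end GradedMap

/-! ### Equivalences modulo the lower central series -/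

section Equivalences

open scoped commutatorElement

variable {F : Type v} {K : Type u} [Group F] [Group K] {p : F →* K} {n : ℕ}

lemma isNEquivalence_iff : IsNEquivalence n p ↔
    (∀ f, p f ∈ lcs K n → f ∈ lcs F n) ∧ ∀ g, ∃ f, (p f)⁻¹ * g ∈ lcs K n := by
  refine and_congr ?_ ?_
  · rw [← MonoidHom.ker_eq_bot_iff, eq_bot_iff]
    constructor
    · intro h f hf
      exact (QuotientGroup.eq_one_iff f).1 (h (x := (f : F ⧸ lcs F n))
        ((QuotientGroup.eq_one_iff (p f)).2 hf))
    · intro h x hx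
      obtain ⟨f, rfl⟩ := QuotientGroup.mk_surjective x
      exact (QuotientGroup.eq_one_iff f).2 (h f ((QuotientGroup.eq_one_iff (p f)).1 hx))
  · constructor
    · intro h g
      obtain ⟨x, hx⟩ := h (g : K ⧸ lcs K n)
      obtain ⟨f, rfl⟩ := QuotientGroup.mk_surjective x
      exact ⟨f, QuotientGroup.eq.1 hx⟩
    · intro h x
      obtain ⟨g, rfl⟩ := QuotientGroup.mk_surjective x
      obtain ⟨f, hf⟩ := h g
      exact ⟨(f : F ⧸ lcs F n), QuotientGroup.eq.2 hf⟩

lemma map_mem_lcs (p : F →* K) {f : F} (hf : f ∈ lcs F n) : p f ∈ lcs K n := lcs_le_comap p n hf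

/-- The homomorphism `Fₙ/Fₙ₊₁ → Kₙ/Kₙ₊₁` induced by `p : F → K`. -/
def gradedQuotientMap (p : F →* K) (n : ℕ) : GradedQuotient F n →+ GradedQuotient K n :=
  MonoidHom.toAdditive (QuotientGroup.map _ _
    ((p.comp (lcs F n).subtype).codRestrict (lcs K n) fun f => map_mem_lcs p f.2)
    fun f hf => show p f.1 ∈ lcs K (n + 1) from map_mem_lcs p hf)

lemma gradedQuotientMap_gradedClass {f : F} (hf : f ∈ lcs F n) :
    gradedQuotientMap p n (gradedClass n f hf) = gradedClass n (p f) (map_mem_lcs p hf) := rfl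

lemma map_iterCommutator (p : F →* K) : ∀ l : List F,
    p (iterCommutator l) = iterCommutator (l.map p)
  | [] => map_one p
  | [_] => rfl
  | a :: b :: l => by
    change p ⁅a, iterCommutator (b :: l)⁆ = _
    rw [map_commutatorElement, map_iterCommutator p (b :: l)]
    rfl

lemma gradedQuotientMap_commutatorClass (g : Fin n → F) :
    gradedQuotientMap p n (commutatorClass g) = commutatorClass fun i => p (g i) :=
  gradedClass_congr ((map_iterCommutator p _).trans (by rw [List.map_ofFn]; rfl)) _

lemma isNEquivalence_succ (h : IsNEquivalence n p)
    (hgr : Function.Bijective (gradedQuotientMap p n)) : IsNEquivalence (n + 1) p := by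
  rw [isNEquivalence_iff] at h ⊢
  refine ⟨fun f hf => ?_, fun g => ?_⟩
  · have hf' : f ∈ lcs F n := h.1 f (lcs_antitone (by omega) hf)
    rw [← gradedClass_eq_zero hf']
    refine hgr.1 ?_
    rw [gradedQuotientMap_gradedClass, map_zero, gradedClass_eq_zero]
    exact hf
  · obtain ⟨f, hf⟩ := h.2 g
    obtain ⟨a, ha⟩ := hgr.2 (gradedClass n _ hf)
    obtain ⟨f', hf', rfl⟩ := gradedClass_surjective a
    rw [gradedQuotientMap_gradedClass, eq_comm, gradedClass_eq] at ha
    refine ⟨f * f', ?_⟩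
    have hN : (lcs K (n + 1)).Normal := inferInstance
    have := hN.conj_mem _ ha (p f')⁻¹
    convert this using 1
    simp [mul_assoc]

/-- A set-theoretic section modulo `Kₙ` of an `n`-equivalence `p : F → K`. It is multiplicative
modulo `Fₙ`. -/
structure IsSectionMod (n : ℕ) (p : F →* K) (s : K → F) : Prop where
  apply_section : ∀ g, (p (s g) : K ⧸ lcs K n) = g
  defect_mem : ∀ g h, s g * s h * (s (g * h))⁻¹ ∈ lcs F n
  section_apply : ∀ f, (s (p f) : F ⧸ lcs F n) = f

lemma exists_isSectionMod (h : IsNEquivalence n p) : ∃ s, IsSectionMod n p s := by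
  have h' := isNEquivalence_iff.1 h
  choose s hs using h'.2
  have hs' : ∀ g, (p (s g) : K ⧸ lcs K n) = g := fun g => QuotientGroup.eq.2 (hs g)
  refine ⟨s, hs', fun g h => h'.1 _ ?_, fun f => ?_⟩
  · rw [← QuotientGroup.eq_one_iff, map_mul, map_mul, map_inv, QuotientGroup.mk_mul,
      QuotientGroup.mk_mul, QuotientGroup.mk_inv, hs', hs', hs', QuotientGroup.mk_mul,
      mul_inv_cancel]
  · rw [QuotientGroup.eq]
    refine h'.1 _ ?_
    rw [map_mul, map_inv]
    exact hs (p f)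

/-- A homomorphism that kills `Gₙ` is constant on cosets of `Gₙ`. -/
lemma map_eq_of_mk_eq {E : Type*} [Group E] (φ : F →* E) (hφ : ∀ f ∈ lcs F n, φ f = 1) {f f' : F}
    (h : (f : F ⧸ lcs F n) = f') : φ f = φ f' := by
  have := hφ _ (QuotientGroup.eq.1 h)
  rwa [map_mul, map_inv, inv_mul_eq_one] at this

lemma IsSectionMod.map_mul {s : K → F} (hs : IsSectionMod n p s) {E : Type*} [Group E]
    (φ : F →* E) (hφ : ∀ f ∈ lcs F n, φ f = 1) (g h : K) :
    φ (s (g * h)) = φ (s g) * φ (s h) := by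
  have := hφ _ (hs.defect_mem g h)
  rwa [_root_.map_mul, _root_.map_mul, map_inv, mul_inv_eq_one, eq_comm] at this

/-- A homomorphism to a commutative group kills `Gₙ` for `n ≥ 2`. -/
lemma map_eq_one_of_comm {A : Type*} [CommGroup A] (hn : 2 ≤ n) (φ : F →* A) :
    ∀ f ∈ lcs F n, φ f = 1 := by
  intro f hf
  have h : f ∈ lcs F 2 := lcs_antitone hn hf
  exact (Abelianization.commutator_subset_ker φ) h

end Equivalences


/-! ### Chains and cycles of a simplicial set -/

section Chains

variable (S : SSet.{u})

/-- Integral `n`-chains: finite formal sums of `n`-simplices. -/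
abbrev Chain (n : ℕ) : Type u := Simplex S n →₀ ℤ

variable {S}

/-- The homomorphism `Cₙ(S; ℤ) → A` that extends an `A`-valued cochain linearly. -/
noncomputable def evalChain {n : ℕ} {A : Type*} [AddCommGroup A] (a : Simplex S n → A) :
    Chain S n →+ A :=
  Finsupp.liftAddHom fun σ => (zmultiplesHom A (a σ))

lemma evalChain_single {n : ℕ} {A : Type*} [AddCommGroup A] (a : Simplex S n → A)
    (σ : Simplex S n) (m : ℤ) : evalChain a (Finsupp.single σ m) = m • a σ := by
  simp [evalChain]

lemma evalChain_comp {n : ℕ} {A B : Type*} [AddCommGroup A] [AddCommGroup B] (a : Simplex S n → A)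
    (f : A →+ B) (z : Chain S n) : evalChain (fun σ => f (a σ)) z = f (evalChain a z) := by
  have : evalChain (fun σ => f (a σ)) = f.comp (evalChain a) := by
    ext σ
    simp [evalChain_single]
  exact DFunLike.congr_fun this z

variable (S) in
/-- The boundary homomorphism on chains. -/
noncomputable def boundary (n : ℕ) : Chain S (n + 1) →+ Chain S n :=
  evalChain fun σ => ∑ i : Fin (n + 2), (-1) ^ (i : ℕ) • Finsupp.single (S.δ i σ) 1

/-- The coboundary of a cochain with values in an abelian group. -/
def coboundaryOf {n : ℕ} {A : Type*} [AddCommGroup A] (a : Simplex S n → A) :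
    Simplex S (n + 1) → A :=
  fun σ => ∑ i : Fin (n + 2), (-1 : ℤ) ^ (i : ℕ) • a (S.δ i σ)

lemma evalChain_boundary {n : ℕ} {A : Type*} [AddCommGroup A] (a : Simplex S n → A)
    (z : Chain S (n + 1)) : evalChain a (boundary S n z) = evalChain (coboundaryOf a) z := by
  have : (evalChain a).comp (boundary S n) = evalChain (coboundaryOf a) := by
    ext σ
    simp [evalChain_single, boundary, coboundaryOf, map_sum]
  exact DFunLike.congr_fun this z

/-- A chain as a morphism to the chain complex. -/
noncomputable def chainHom {n : ℕ} :
    Chain S n →+ (intCoeff.{u} ⟶ (S.chainComplex intCoeff.{u}).X n) :=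
  evalChain fun σ => S.ιChainComplex σ

lemma chainHom_single {n : ℕ} (σ : Simplex S n) (m : ℤ) :
    chainHom (Finsupp.single σ m) = m • S.ιChainComplex (R := intCoeff.{u}) σ :=
  evalChain_single _ σ m

lemma chainHom_d {n : ℕ} (z : Chain S (n + 1)) :
    chainHom z ≫ (S.chainComplex intCoeff.{u}).d (n + 1) n = chainHom (boundary S n z) := by
  induction z using Finsupp.induction_linear with
  | zero => simp
  | add a b ha hb => rw [map_add, map_add, map_add, Preadditive.add_comp, ha, hb]
  | single σ m =>
    rw [chainHom_single, Preadditive.zsmul_comp, SSet.ιChainComplex_d, boundary, evalChain_single,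
      map_zsmul, map_sum]
    congr 1
    refine Finset.sum_congr rfl fun i _ => ?_
    rw [map_zsmul, chainHom_single, one_smul]

lemma chainHom_cochainHom {n : ℕ} (z : Chain S n) (a : Cochain S n) :
    chainHom z ≫ cochainHom a = evalChain a z • 𝟙 intCoeff.{u} := by
  induction z using Finsupp.induction_linear with
  | zero => simp
  | add z w hz hw => rw [map_add, map_add, Preadditive.add_comp, hz, hw, add_smul]
  | single σ m =>
    rw [chainHom_single, Preadditive.zsmul_comp, ι_cochainHom, evalChain_single, smul_smul]
    rfl

/-- The coordinates of an element of the chain complex. -/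
noncomputable def chainCoord (n : ℕ) :
    (S.chainComplex intCoeff.{u}).X n ⟶ ModuleCat.of ℤ (Chain S n) :=
  Limits.Cofan.IsColimit.desc (S.isColimitChainComplexXCofan intCoeff.{u} n) fun σ =>
    ModuleCat.ofHom ((Finsupp.lsingle σ : ℤ →ₗ[ℤ] Chain S n) ∘ₗ ULift.moduleEquiv.toLinearMap)

lemma ι_chainCoord {n : ℕ} (σ : Simplex S n) :
    S.ιChainComplex σ ≫ chainCoord n = ModuleCat.ofHom
      ((Finsupp.lsingle σ : ℤ →ₗ[ℤ] Chain S n) ∘ₗ ULift.moduleEquiv.toLinearMap) :=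
  Limits.Cofan.IsColimit.fac (S.isColimitChainComplexXCofan intCoeff.{u} n) _ σ

/-- The element of the chain complex with given coordinates. -/
noncomputable def chainElt (n : ℕ) :
    ModuleCat.of ℤ (Chain S n) ⟶ (S.chainComplex intCoeff.{u}).X n :=
  ModuleCat.ofHom (X := Chain S n) (Y := (S.chainComplex intCoeff.{u}).X n)
    { toFun := fun z => chainHom z (ULift.up 1 : ULift.{u} ℤ)
      map_add' := fun z w => by rw [map_add]; rfl
      map_smul' := fun m z => by
        rw [map_zsmul, RingHom.id_apply]
        exact (map_zsmul (AddMonoidHom.mk' (fun f : intCoeff.{u} ⟶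
          (S.chainComplex intCoeff.{u}).X n => f (ULift.up 1 : ULift.{u} ℤ)) fun _ _ => rfl)
          m (chainHom z)).trans (int_smul_eq_zsmul _ m _).symm }

lemma chainElt_apply {n : ℕ} (z : Chain S n) :
    chainElt n z = chainHom z (ULift.up 1 : ULift.{u} ℤ) := rfl

lemma intCoeff_hom_ext {M : ModuleCat.{u} ℤ} {f g : intCoeff.{u} ⟶ M}
    (h : f (ULift.up 1 : ULift.{u} ℤ) = g (ULift.up 1 : ULift.{u} ℤ)) : f = g := by
  ext ⟨m⟩
  have e : (ULift.up m : ULift.{u} ℤ) = m • (ULift.up 1 : ULift.{u} ℤ) := by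
    ext; simp
  have e1 := map_zsmul f.hom m (ULift.up 1 : ULift.{u} ℤ)
  have e2 := map_zsmul g.hom m (ULift.up 1 : ULift.{u} ℤ)
  rw [← e] at e1 e2
  exact e1.trans ((congrArg (m • ·) h).trans e2.symm)

lemma chainCoord_chainElt (n : ℕ) :
    chainCoord n ≫ chainElt n = 𝟙 ((S.chainComplex intCoeff.{u}).X n) := by
  apply SSet.chainComplex_hom_ext
  intro σ
  rw [← Category.assoc, ι_chainCoord, Category.comp_id]
  refine intCoeff_hom_ext ?_
  change chainElt n (Finsupp.single σ 1) = _
  rw [chainElt_apply, chainHom_single, one_smul]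

lemma chainElt_surjective {n : ℕ} (y : (S.chainComplex intCoeff.{u}).X n) :
    ∃ z, chainHom z (ULift.up 1 : ULift.{u} ℤ) = y :=
  ⟨chainCoord n y, congrArg (fun f => f y) (chainCoord_chainElt (S := S) n)⟩

lemma chainElt_chainCoord (n : ℕ) : chainElt n ≫ chainCoord n = 𝟙 (ModuleCat.of ℤ (Chain S n)) := by
  refine ModuleCat.hom_ext (LinearMap.ext fun (z : Chain S n) => ?_)
  change chainCoord n (chainElt n z) = z
  rw [chainElt_apply]
  induction z using Finsupp.induction_linear with
  | zero => rw [map_zero]; exact map_zero (chainCoord (S := S) n).hom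
  | add a b ha hb =>
    rw [map_add]
    refine (map_add (chainCoord (S := S) n).hom _ _).trans ?_
    exact congrArg₂ (· + ·) ha hb
  | single σ m =>
    rw [chainHom_single]
    refine (map_zsmul (chainCoord (S := S) n).hom m _).trans ?_
    have := congrArg (fun f => f (ULift.up 1 : ULift.{u} ℤ)) (ι_chainCoord (S := S) σ)
    refine (congrArg (m • ·) this).trans ?_
    change m • Finsupp.single σ (1 : ℤ) = _
    rw [Finsupp.smul_single, smul_eq_mul, mul_one]

lemma chainHom_injective {n : ℕ} : Function.Injective (chainHom (S := S) (n := n)) := by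
  intro z w h
  have h1 : chainElt n z = chainElt n w := by rw [chainElt_apply, chainElt_apply, h]
  have h2 := congrArg (chainCoord n) h1
  have h3 := fun z => congrArg (fun f => f z) (chainElt_chainCoord (S := S) n)
  exact (h3 z).symm.trans (h2.trans (h3 w))

/-- The homology class of a cycle. -/
noncomputable def cycleClass (n : ℕ) : (boundary S n).ker →+ Homology S (n + 1) :=
  AddMonoidHom.mk'
    (fun z => ((S.chainComplex intCoeff.{u}).liftCycles (chainHom z.1) n (by simp)
      (by rw [chainHom_d, z.2, map_zero]) ≫ (S.chainComplex intCoeff.{u}).homologyπ (n + 1))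
      (ULift.up 1 : ULift.{u} ℤ))
    (fun z w => by
      have e : (S.chainComplex intCoeff.{u}).liftCycles (chainHom (z + w).1) n (by simp)
          (by rw [chainHom_d, (z + w).2, map_zero]) =
          (S.chainComplex intCoeff.{u}).liftCycles (chainHom z.1) n (by simp)
            (by rw [chainHom_d, z.2, map_zero]) +
          (S.chainComplex intCoeff.{u}).liftCycles (chainHom w.1) n (by simp)
            (by rw [chainHom_d, w.2, map_zero]) := by
        rw [← cancel_mono ((S.chainComplex intCoeff.{u}).iCycles (n + 1)), Preadditive.add_comp]
        simp
      rw [e, Preadditive.add_comp]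
      rfl)

lemma simplexClass_eq_cycleClass {n : ℕ} (σ : Simplex S (n + 1))
    (h : S.ιChainComplex (R := intCoeff.{u}) σ ≫ (S.chainComplex intCoeff.{u}).d (n + 1) n = 0)
    (h' : boundary S n (Finsupp.single σ 1) = 0) :
    simplexClass σ h = cycleClass n ⟨Finsupp.single σ 1, h'⟩ := by
  have e : chainHom (Finsupp.single σ 1) = S.ιChainComplex (R := intCoeff.{u}) σ := by
    rw [chainHom_single, one_smul]
  change _ = ((S.chainComplex intCoeff.{u}).liftCycles (chainHom (Finsupp.single σ 1)) n (by simp)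
    (by rw [chainHom_d, h', map_zero]) ≫ (S.chainComplex intCoeff.{u}).homologyπ (n + 1))
      (ULift.up 1 : ULift.{u} ℤ)
  simp only [e]
  rfl

lemma cycleClass_surjective (n : ℕ) : Function.Surjective (cycleClass (S := S) n) := by
  intro c
  obtain ⟨y, hy⟩ := (ModuleCat.epi_iff_surjective _).1
    (inferInstance : Epi ((S.chainComplex intCoeff.{u}).homologyπ (n + 1))) c
  obtain ⟨z, hz⟩ := chainElt_surjective ((S.chainComplex intCoeff.{u}).iCycles (n + 1) y)
  have hz0 : boundary S n z = 0 := by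
    apply chainHom_injective
    rw [map_zero, ← chainHom_d]
    refine intCoeff_hom_ext ?_
    change (S.chainComplex intCoeff.{u}).d (n + 1) n (chainHom z (ULift.up 1 : ULift.{u} ℤ)) = 0
    rw [hz]
    exact congrArg (fun f => f y) ((S.chainComplex intCoeff.{u}).iCycles_d (n + 1) n)
  refine ⟨⟨z, hz0⟩, ?_⟩
  rw [← hy]
  change (S.chainComplex intCoeff.{u}).homologyπ (n + 1) _ = _
  congr 1
  apply (ModuleCat.mono_iff_injective ((S.chainComplex intCoeff.{u}).iCycles (n + 1))).1 inferInstance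
  rw [← hz]
  exact congrArg (fun f => f (ULift.up 1 : ULift.{u} ℤ))
    ((S.chainComplex intCoeff.{u}).liftCycles_i (chainHom z) n _ _)

lemma cycleClass_eq_zero_iff {n : ℕ} (z : (boundary S n).ker) :
    cycleClass n z = 0 ↔ ∃ w, boundary S (n + 1) w = z.1 := by
  set K := S.chainComplex intCoeff.{u}
  have hz : chainHom z.1 ≫ K.d (n + 1) n = 0 := by rw [chainHom_d, z.2, map_zero]
  constructor
  · intro h
    have hex : (ShortComplex.mk (K.toCycles (n + 2) (n + 1)) (K.homologyπ (n + 1)) (by simp)).Exact :=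
      ShortComplex.exact_of_g_is_cokernel _ (K.homologyIsCokernel (n + 2) (n + 1) (by simp))
    obtain ⟨x, hx⟩ := (ShortComplex.moduleCat_exact_iff _).1 hex
      (K.liftCycles (chainHom z.1) n (by simp) hz (ULift.up 1 : ULift.{u} ℤ)) h
    obtain ⟨w, hw⟩ := chainElt_surjective x
    refine ⟨w, chainHom_injective ?_⟩
    rw [← chainHom_d]
    refine intCoeff_hom_ext ?_
    change K.d (n + 2) (n + 1) (chainHom w (ULift.up 1 : ULift.{u} ℤ)) = _
    rw [hw, ← K.toCycles_i (n + 2) (n + 1)]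
    change K.iCycles (n + 1) (K.toCycles (n + 2) (n + 1) x) = _
    refine (congrArg (K.iCycles (n + 1)) hx).trans ?_
    exact congrArg (fun f => f (ULift.up 1 : ULift.{u} ℤ)) (K.liftCycles_i (chainHom z.1) n _ hz)
  · rintro ⟨w, hw⟩
    have e : K.liftCycles (chainHom z.1) n (by simp) hz =
        chainHom w ≫ K.toCycles (n + 2) (n + 1) := by
      rw [← cancel_mono (K.iCycles (n + 1))]
      simp only [HomologicalComplex.liftCycles_i, Category.assoc, HomologicalComplex.toCycles_i]
      rw [← hw]
      exact (chainHom_d w).symm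
    change (K.liftCycles (chainHom z.1) n (by simp) hz ≫ K.homologyπ (n + 1))
      (ULift.up 1 : ULift.{u} ℤ) = 0
    rw [e, Category.assoc, HomologicalComplex.toCycles_comp_homologyπ, Limits.comp_zero]
    rfl

lemma kronecker_cycleClass {n : ℕ} (a : cocycles S (n + 1)) (z : (boundary S n).ker) :
    kronecker (n + 1) (cohomologyClass (n + 1) a) (cycleClass n z) = evalChain a.1 z.1 := by
  have hz : chainHom z.1 ≫ (S.chainComplex intCoeff.{u}).d (n + 1) n = 0 := by
    rw [chainHom_d, z.2, map_zero]
  have e : ((S.chainComplex intCoeff.{u}).liftCycles (chainHom z.1) n (by simp) hz ≫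
    (S.chainComplex intCoeff.{u}).homologyπ (n + 1)) ≫ evalCocycle a = evalChain a.1 z.1 • 𝟙 _ := by
    simp [evalCocycle, chainHom_cochainHom]
  have e' := congrArg (fun f : intCoeff.{u} ⟶ intCoeff.{u} =>
    (f (ULift.up 1 : ULift.{u} ℤ) : ULift.{u} ℤ).down) e
  refine Eq.trans e' ?_
  change (evalChain a.1 z.1 • (ULift.up 1 : ULift.{u} ℤ)).down = _
  simp

/-- The homomorphism on homology given by a cocycle with values in an abelian group. -/
noncomputable def homologyEval {n : ℕ} {A : Type*} [AddCommGroup A] (a : Simplex S (n + 1) → A)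
    (ha : coboundaryOf a = 0) : Homology S (n + 1) →+ A :=
  (QuotientAddGroup.lift (cycleClass n).ker ((evalChain a).comp (boundary S n).ker.subtype)
    fun z hz => by
      obtain ⟨w, hw⟩ := (cycleClass_eq_zero_iff z).1 hz
      change evalChain a z.1 = 0
      rw [← hw, evalChain_boundary, ha]
      have : evalChain (0 : Simplex S (n + 2) → A) = 0 := by ext σ; simp [evalChain_single]
      rw [this]; rfl).comp
    (QuotientAddGroup.quotientKerEquivOfSurjective (cycleClass n)
      (cycleClass_surjective n)).symm.toAddMonoidHom

lemma homologyEval_cycleClass {n : ℕ} {A : Type*} [AddCommGroup A] (a : Simplex S (n + 1) → A)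
    (ha : coboundaryOf a = 0) (z : (boundary S n).ker) :
    homologyEval a ha (cycleClass n z) = evalChain a z.1 := by
  have : (QuotientAddGroup.quotientKerEquivOfSurjective (cycleClass (S := S) n)
      (cycleClass_surjective n)).symm (cycleClass n z) = (z : (boundary S n).ker ⧸ (cycleClass (S := S) n).ker) :=
    (AddEquiv.symm_apply_eq _).2 rfl
  rw [homologyEval, AddMonoidHom.comp_apply]
  exact (DFunLike.congr_arg _ this).trans rfl

end Chains


/-! ### Simplicial sets labelled by their fundamental group -/

section Label

lemma face_one_face_two {S : SSet.{u}} (σ : Simplex S 2) : S.δ 1 (S.δ 2 σ) = S.δ 1 (S.δ 1 σ) :=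
  congrArg (fun f => f σ) (SimplicialObject.δ_comp_δ S (i := (1 : Fin 2)) (j := 1) le_rfl)

lemma face_zero_face_two {S : SSet.{u}} (σ : Simplex S 2) : S.δ 0 (S.δ 2 σ) = S.δ 1 (S.δ 0 σ) :=
  congrArg (fun f => f σ) (SimplicialObject.δ_comp_δ S (i := (0 : Fin 2)) (j := 1) (by decide))

lemma face_zero_face_one {S : SSet.{u}} (σ : Simplex S 2) : S.δ 0 (S.δ 1 σ) = S.δ 0 (S.δ 0 σ) :=
  congrArg (fun f => f σ) (SimplicialObject.δ_comp_δ S (i := (0 : Fin 2)) (j := 0) le_rfl)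

/-- A function on the 1-simplices with values in a group is multiplicative if it takes the long
edge of each triangle to the product of the two short ones. -/
def IsMultiplicative {S : SSet.{u}} {E : Type*} [Group E] (w : Simplex S 1 → E) : Prop :=
  ∀ σ : Simplex S 2, w (S.δ 1 σ) = w (S.δ 2 σ) * w (S.δ 0 σ)

/-- A labelling of the edges of `S` by elements of `K` that exhibits `K` as the fundamental group
of the connected simplicial set `S`: up to a change of frame at the vertices, every multiplicative
function factors through it, and every element of `K` is the label of a loop at some fixed
vertex. -/
structure IsLabel (S : SSet.{u}) {K : Type u} [Group K] (l : Simplex S 1 → K) : Prop where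
  mul : IsMultiplicative l
  factor_aux : ∀ (E : Type u) [Group E] (w : Simplex S 1 → E), IsMultiplicative w →
    ∃ (f : K →* E) (c : Simplex S 0 → E), ∀ σ, w σ = c (S.δ 1 σ) * f (l σ) * (c (S.δ 0 σ))⁻¹
  exists_loop : ∃ v : Simplex S 0, ∀ k, ∃ σ, l σ = k ∧ S.δ 1 σ = v ∧ S.δ 0 σ = v

variable {S : SSet.{u}} {K : Type u} [Group K] {l : Simplex S 1 → K}

/-- The universal property of a labelling, for groups in any universe. -/
lemma IsLabel.factor (hl : IsLabel S l) {E : Type*} [Group E] {w : Simplex S 1 → E}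
    (hw : IsMultiplicative w) :
    ∃ (f : K →* E) (c : Simplex S 0 → E), ∀ σ, w σ = c (S.δ 1 σ) * f (l σ) * (c (S.δ 0 σ))⁻¹ := by
  -- It suffices to factor the universal multiplicative function.
  let rels : Set (FreeGroup (Simplex S 1)) := Set.range fun σ : Simplex S 2 =>
    FreeGroup.of (S.δ 2 σ) * FreeGroup.of (S.δ 0 σ) * (FreeGroup.of (S.δ 1 σ))⁻¹
  obtain ⟨f, c, h⟩ := hl.factor_aux (PresentedGroup rels) (fun σ => PresentedGroup.of σ) (by
    intro σ
    have : PresentedGroup.mk rels (FreeGroup.of (S.δ 2 σ) * FreeGroup.of (S.δ 0 σ) *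
        (FreeGroup.of (S.δ 1 σ))⁻¹) = 1 := PresentedGroup.one_of_mem ⟨σ, rfl⟩
    rw [map_mul, map_mul, map_inv, mul_inv_eq_one] at this
    exact this.symm)
  have hrel : ∀ r ∈ rels, FreeGroup.lift w r = 1 := by
    rintro _ ⟨σ, rfl⟩
    simp only [map_mul, map_inv, FreeGroup.lift_apply_of]
    rw [hw σ, mul_inv_cancel]
  refine ⟨(PresentedGroup.toGroup hrel).comp f, fun v => PresentedGroup.toGroup hrel (c v),
    fun σ => ?_⟩
  have e := congrArg (PresentedGroup.toGroup hrel) (h σ)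
  rw [PresentedGroup.toGroup.of] at e
  rw [e]
  simp only [map_mul, map_inv, MonoidHom.comp_apply]

lemma coboundaryOf_one {A : Type*} [AddCommGroup A] (a : Simplex S 1 → A) (σ : Simplex S 2) :
    coboundaryOf a σ = a (S.δ 0 σ) - a (S.δ 1 σ) + a (S.δ 2 σ) := by
  simp [coboundaryOf, Fin.sum_univ_three, sub_eq_add_neg]

lemma boundary_single_two (σ : Simplex S 2) : boundary S 1 (Finsupp.single σ 1) =
    Finsupp.single (S.δ 0 σ) 1 - Finsupp.single (S.δ 1 σ) 1 + Finsupp.single (S.δ 2 σ) 1 := by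
  simp [boundary, evalChain_single, Fin.sum_univ_three, sub_eq_add_neg]

variable {F : Type v} [Group F] {p : F →* K} {n : ℕ} {s : K → F}

/-- A cochain of degree two that vanishes on all cycles is a coboundary, since the first homology
group is free. Freeness enters through the free group: modulo boundaries every edge is equal to a
chain that is additive along triangles. -/
lemma exists_coboundaryOf_eq (hl : IsLabel S l) {ι : Type w} (b : FreeGroupBasis ι F)
    (hs : IsSectionMod n p s) (hn : 2 ≤ n) {Q : Type*} [AddCommGroup Q] (z : Simplex S 2 → Q)
    (hz : ∀ c, boundary S 1 c = 0 → evalChain z c = 0) : ∃ e, coboundaryOf e = z := by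
  -- The classes of the edges modulo boundaries are multiplicative, hence given by some `f`.
  let E := Chain S 1 ⧸ (boundary S 1).range
  obtain ⟨f, c, h⟩ := hl.factor (E := Multiplicative E)
    (w := fun σ => Multiplicative.ofAdd (QuotientAddGroup.mk (Finsupp.single σ 1))) (by
      intro σ
      rw [← ofAdd_add, ← QuotientAddGroup.mk_add]
      refine congrArg Multiplicative.ofAdd (QuotientAddGroup.eq.2 ⟨Finsupp.single σ 1, ?_⟩)
      rw [boundary_single_two]; abel)
  -- Freeness allows `f ∘ p` to be lifted to chains; the lift descends to `K`.
  let φ : F →* Multiplicative (Chain S 1) := b.lift fun i =>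
    Multiplicative.ofAdd (Quotient.out (Multiplicative.toAdd (f (p (b i)))))
  have hφ : ∀ x, (QuotientAddGroup.mk (Multiplicative.toAdd (φ x)) : E) =
      Multiplicative.toAdd (f (p x)) := by
    have : (AddMonoidHom.toMultiplicative (QuotientAddGroup.mk' (boundary S 1).range)).comp φ =
        f.comp p := by
      refine b.ext_hom _ _ fun i => ?_
      have e : φ (b i) = Multiplicative.ofAdd
        (Quotient.out (Multiplicative.toAdd (f (p (b i))))) := by simp [φ]
      rw [MonoidHom.comp_apply, e]
      exact congrArg Multiplicative.ofAdd (QuotientAddGroup.out_eq' _)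
    intro x
    exact congrArg Multiplicative.toAdd (DFunLike.congr_fun this x)
  have hg : ∀ k, (QuotientAddGroup.mk (Multiplicative.toAdd (φ (s k))) : E) =
      Multiplicative.toAdd (f k) := by
    intro k
    rw [hφ, map_eq_of_mk_eq f (map_eq_one_of_comm hn f) (hs.apply_section k)]
  let v : Simplex S 1 → Chain S 1 := fun σ =>
    Quotient.out (Multiplicative.toAdd (c (S.δ 1 σ))) + Multiplicative.toAdd (φ (s (l σ))) -
      Quotient.out (Multiplicative.toAdd (c (S.δ 0 σ)))
  have hv : ∀ σ, ∃ r, boundary S 1 r = Finsupp.single σ 1 - v σ := by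
    intro σ
    refine AddMonoidHom.mem_range.1 ((QuotientAddGroup.eq_zero_iff _).1 ?_)
    change (QuotientAddGroup.mk _ - (QuotientAddGroup.mk _ + QuotientAddGroup.mk _ -
      QuotientAddGroup.mk _) : E) = 0
    rw [hg, QuotientAddGroup.out_eq', QuotientAddGroup.out_eq', sub_eq_zero]
    refine (congrArg Multiplicative.toAdd (h σ)).trans ?_
    rw [toAdd_mul, toAdd_mul, toAdd_inv, sub_eq_add_neg]
  have hvm : ∀ σ : Simplex S 2, v (S.δ 0 σ) - v (S.δ 1 σ) + v (S.δ 2 σ) = 0 := by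
    intro σ
    simp only [v]
    rw [face_one_face_two, face_zero_face_two, face_zero_face_one, hl.mul σ,
      hs.map_mul φ (map_eq_one_of_comm hn φ), toAdd_mul]
    abel
  -- The boundary of `r₀ - r₁ + r₂` is that of the triangle, because `v₀ - v₁ + v₂ = 0`.
  choose r hr using hv
  refine ⟨fun σ => evalChain z (r σ), funext fun σ => ?_⟩
  rw [coboundaryOf_one, ← map_sub, ← map_add, ← sub_eq_zero]
  have e : z σ = evalChain z (Finsupp.single σ 1) := by rw [evalChain_single, one_smul]
  rw [e, ← map_sub]
  apply hz
  rw [map_sub, map_add, map_sub, hr, hr, hr, boundary_single_two]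
  refine Eq.trans ?_ (neg_eq_zero.2 (hvm σ))
  abel

end Label

/-! ### The obstruction class and the exact sequence -/

section Obstruction

open scoped commutatorElement

variable {S : SSet.{u}} {K : Type u} [Group K] {l : Simplex S 1 → K}
  {F : Type v} [Group F] {p : F →* K} {n : ℕ} {s : K → F}

lemma gradedClass_conj {G : Type*} [Group G] {n : ℕ} {g : G} (hg : g ∈ lcs G n) (h : G) :
    gradedClass n (h * g * h⁻¹) ((inferInstance : (lcs G n).Normal).conj_mem g hg h) =
      gradedClass n g hg := by
  rw [gradedClass_eq]
  exact commutator_mem_lcs (mem_lcs_one h) hg (by omega)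

/-- The obstruction cochain: the failure of a section `s` to be multiplicative along the
triangles of `S`. -/
def defectCochain (hl : IsLabel S l) (hs : IsSectionMod n p s) (σ : Simplex S 2) :
    GradedQuotient F n :=
  gradedClass n (s (l (S.δ 2 σ)) * s (l (S.δ 0 σ)) * (s (l (S.δ 1 σ)))⁻¹) (by
    rw [hl.mul σ]; exact hs.defect_mem _ _)

lemma coboundaryOf_defectCochain (hl : IsLabel S l) (hs : IsSectionMod n p s) :
    coboundaryOf (defectCochain hl hs) = 0 := by
  funext σ
  have e02 : S.δ 2 (S.δ 1 σ) = S.δ 1 (S.δ 3 σ) := congrArg (fun f => f σ)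
    (SimplicialObject.δ_comp_δ S (i := (1 : Fin 3)) (j := 2) (by decide)).symm
  have e12 : S.δ 2 (S.δ 0 σ) = S.δ 0 (S.δ 3 σ) := congrArg (fun f => f σ)
    (SimplicialObject.δ_comp_δ S (i := (0 : Fin 3)) (j := 2) (by decide)).symm
  have e01 : S.δ 2 (S.δ 2 σ) = S.δ 2 (S.δ 3 σ) := congrArg (fun f => f σ)
    (SimplicialObject.δ_comp_δ S (i := (2 : Fin 3)) (j := 2) le_rfl).symm
  have e23 : S.δ 0 (S.δ 1 σ) = S.δ 0 (S.δ 0 σ) := congrArg (fun f => f σ)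
    (SimplicialObject.δ_comp_δ S (i := (0 : Fin 3)) (j := 0) le_rfl)
  have e13 : S.δ 0 (S.δ 2 σ) = S.δ 1 (S.δ 0 σ) := congrArg (fun f => f σ)
    (SimplicialObject.δ_comp_δ S (i := (0 : Fin 3)) (j := 1) (by decide))
  have e03 : S.δ 1 (S.δ 2 σ) = S.δ 1 (S.δ 1 σ) := congrArg (fun f => f σ)
    (SimplicialObject.δ_comp_δ S (i := (1 : Fin 3)) (j := 1) le_rfl)
  have hd : coboundaryOf (defectCochain hl hs) σ = defectCochain hl hs (S.δ 0 σ) +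
      defectCochain hl hs (S.δ 2 σ) - (defectCochain hl hs (S.δ 3 σ) +
        defectCochain hl hs (S.δ 1 σ)) := by
    refine (Fin.sum_univ_four _).trans ?_
    have h2 : ((2 : Fin 4) : ℕ) = 2 := rfl
    have h3 : ((3 : Fin 4) : ℕ) = 3 := rfl
    simp only [h2, h3, Fin.val_zero, Fin.val_one, pow_succ, pow_zero, mul_neg, mul_one,
      neg_neg, one_smul, neg_smul]
    abel
  rw [hd, Pi.zero_apply, sub_eq_zero]
  simp only [defectCochain]
  rw [← gradedClass_conj _ (s (l (S.δ 2 (S.δ 3 σ)))), ← gradedClass_mul, ← gradedClass_mul]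
  refine gradedClass_congr ?_ _
  rw [e02, e12, e01, e23, e13, e03]
  simp only [mul_assoc, inv_mul_cancel_left]

/-- The homomorphism `H₂(S) → Fₙ/Fₙ₊₁` given by the obstruction class. -/
noncomputable def defectHom (hl : IsLabel S l) (hs : IsSectionMod n p s) :
    Homology S 2 →+ GradedQuotient F n :=
  homologyEval (n := 1) (defectCochain hl hs) (coboundaryOf_defectCochain hl hs)

/-- The obstruction class becomes trivial in `Kₙ/Kₙ₊₁`. -/
lemma gradedQuotientMap_defectHom (hl : IsLabel S l) (hs : IsSectionMod n p s)
    (c : Homology S 2) : gradedQuotientMap p n (defectHom hl hs c) = 0 := by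
  obtain ⟨z, rfl⟩ := cycleClass_surjective 1 c
  rw [defectHom, homologyEval_cycleClass, ← evalChain_comp]
  have hmem : ∀ k, p (s k) * k⁻¹ ∈ lcs K n := by
    intro k
    rw [← QuotientGroup.eq_one_iff, QuotientGroup.mk_mul, hs.apply_section, ← QuotientGroup.mk_mul,
      mul_inv_cancel, QuotientGroup.mk_one]
  have e : (fun σ => gradedQuotientMap p n (defectCochain hl hs σ)) =
      coboundaryOf fun σ => gradedClass n (p (s (l σ)) * (l σ)⁻¹) (hmem _) := by
    funext σ
    rw [coboundaryOf_one, defectCochain, gradedQuotientMap_gradedClass,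
      ← gradedClass_conj (hmem (l (S.δ 0 σ))) (l (S.δ 2 σ)),
      show ∀ a b c : GradedQuotient K n, a - b + c = c + a + -b from fun a b c => by abel,
      ← gradedClass_inv, ← gradedClass_mul, ← gradedClass_mul]
    refine gradedClass_congr ?_ _
    rw [hl.mul σ]
    simp [mul_assoc]
  rw [e, ← evalChain_boundary, z.2, map_zero]

/-- Homomorphisms that agree up to central elements agree on `Gₙ` for `n ≥ 2`. -/
lemma eq_of_mul_inv_mem_center {E : Type*} [Group E] (hn : 2 ≤ n) (f g : F →* E)
    (h : ∀ x, f x * (g x)⁻¹ ∈ Subgroup.center E) : ∀ x ∈ lcs F n, f x = g x := by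
  let φ : F →* Subgroup.center E := MonoidHom.mk' (fun x => ⟨f x * (g x)⁻¹, h x⟩) fun x y => by
    ext
    change f (x * y) * (g (x * y))⁻¹ = f x * (g x)⁻¹ * (f y * (g y)⁻¹)
    have := Subgroup.mem_center_iff.1 (h y) (g x)⁻¹
    rw [mul_assoc (f x), this, map_mul, map_mul, mul_inv_rev]
    simp only [mul_assoc]
  let _ : CommGroup (Subgroup.center E) :=
    { (inferInstance : Group (Subgroup.center E)) with
      mul_comm := fun a b => Subtype.ext (Subgroup.mem_center_iff.1 b.2 a) }
  intro x hx
  have := congrArg Subtype.val (map_eq_one_of_comm hn φ x hx)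
  exact mul_inv_eq_one.1 this

/-- Exactness of `H₂(S) → Fₙ/Fₙ₊₁ → Kₙ/Kₙ₊₁`. Modulo the image of the obstruction class the
extension `F/Fₙ₊₁` of `F/Fₙ ≅ K/Kₙ` pulls back to a split extension of `K`, because of
`exists_coboundaryOf_eq`. -/
lemma mem_range_defectHom (hl : IsLabel S l) {ι : Type w} (b : FreeGroupBasis ι F)
    (hs : IsSectionMod n p s) (hn : 2 ≤ n) {a : GradedQuotient F n}
    (ha : gradedQuotientMap p n a = 0) : ∃ c, defectHom hl hs c = a := by
  let R := (defectHom hl hs).range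
  obtain ⟨e, he⟩ := exists_coboundaryOf_eq hl b hs hn
    (fun σ => (QuotientAddGroup.mk (defectCochain hl hs σ) : GradedQuotient F n ⧸ R)) (by
      intro z hz
      refine (evalChain_comp (defectCochain hl hs) (QuotientAddGroup.mk' R) z).trans ?_
      refine (QuotientAddGroup.eq_zero_iff _).2 ⟨cycleClass 1 ⟨z, hz⟩, ?_⟩
      rw [defectHom, homologyEval_cycleClass])
  have hr : ∀ σ, ∃ (r : F) (hr : r ∈ lcs F n),
      (QuotientAddGroup.mk (gradedClass n r hr) : GradedQuotient F n ⧸ R) = e σ := by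
    intro σ
    obtain ⟨q, hq⟩ := QuotientAddGroup.mk_surjective (e σ)
    obtain ⟨r, hr, rfl⟩ := gradedClass_surjective q
    exact ⟨r, hr, hq⟩
  choose r hr hre using hr
  -- The group `F / M` is the quotient of `F / Fₙ₊₁` by the image of the obstruction class.
  let M : Subgroup F :=
    { carrier := {f | ∃ hf : f ∈ lcs F n, gradedClass n f hf ∈ R}
      mul_mem' := fun ⟨hx, hx'⟩ ⟨hy, hy'⟩ => ⟨mul_mem hx hy, add_mem hx' hy'⟩
      one_mem' := ⟨one_mem _, zero_mem _⟩
      inv_mem' := fun ⟨hx, hx'⟩ => ⟨inv_mem hx, neg_mem hx'⟩ }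
  have hM : ∀ {f} (hf : f ∈ lcs F n), f ∈ M ↔ gradedClass n f hf ∈ R :=
    fun hf => ⟨fun h => h.2, fun h => ⟨hf, h⟩⟩
  have hlM : lcs F (n + 1) ≤ M := fun f hf =>
    ⟨lcs_antitone (by omega) hf, by rw [(gradedClass_eq_zero _).2 hf]; exact zero_mem _⟩
  have hMn : M.Normal := ⟨fun f ⟨hf, hf'⟩ g =>
    ⟨(inferInstance : (lcs F n).Normal).conj_mem f hf g, by rwa [gradedClass_conj]⟩⟩
  have hcen : ∀ f ∈ lcs F n, (f : F ⧸ M) ∈ Subgroup.center (F ⧸ M) := by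
    intro f hf
    rw [Subgroup.mem_center_iff]
    intro x
    obtain ⟨x, rfl⟩ := QuotientGroup.mk_surjective x
    rw [← QuotientGroup.mk_mul, ← QuotientGroup.mk_mul, QuotientGroup.eq]
    refine hlM ?_
    have := commutator_mem_lcs (n := n + 1) (inv_mem hf) (mem_lcs_one x⁻¹) (by omega)
    simpa [commutatorElement_def, mul_assoc] using this
  -- Corrected by `r`, the section `s` becomes multiplicative modulo `M`.
  have hw : IsMultiplicative (S := S) fun σ => (((r σ)⁻¹ * s (l σ) : F) : F ⧸ M) := by
    intro σ
    -- The two sides differ by `r₂⁻¹ r₀⁻¹ o r₁`, up to conjugation of `r₀`, where `o` is the defect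
    -- of `s` along `σ`. Modulo `R` the class of `o` is the coboundary of the classes of `r`.
    have hd : s (l (S.δ 2 σ)) * s (l (S.δ 0 σ)) * (s (l (S.δ 1 σ)))⁻¹ ∈ lcs F n := by
      rw [hl.mul σ]; exact hs.defect_mem _ _
    have h1 := congrFun he σ
    rw [coboundaryOf_one, ← hre, ← hre, ← hre] at h1
    have h2 : (r (S.δ 2 σ))⁻¹ * (s (l (S.δ 2 σ)) * (r (S.δ 0 σ))⁻¹ * (s (l (S.δ 2 σ)))⁻¹) *
        (s (l (S.δ 2 σ)) * s (l (S.δ 0 σ)) * (s (l (S.δ 1 σ)))⁻¹) * r (S.δ 1 σ) ∈ M := by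
      have hc := (inferInstance : (lcs F n).Normal).conj_mem _ (inv_mem (hr (S.δ 0 σ)))
        (s (l (S.δ 2 σ)))
      rw [hM (mul_mem (mul_mem (mul_mem (inv_mem (hr _)) hc) hd) (hr _)),
        gradedClass_mul (mul_mem (mul_mem (inv_mem (hr _)) hc) hd) (hr _),
        gradedClass_mul (mul_mem (inv_mem (hr _)) hc) hd, gradedClass_mul (inv_mem (hr _)) hc,
        gradedClass_conj (inv_mem (hr _)), gradedClass_inv (hr _), gradedClass_inv (hr _)]
      have h3 : (QuotientAddGroup.mk (-gradedClass n _ (hr (S.δ 2 σ)) +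
          -gradedClass n _ (hr (S.δ 0 σ)) + gradedClass n _ hd + gradedClass n _ (hr (S.δ 1 σ))) :
          GradedQuotient F n ⧸ R) = 0 := by
        rw [QuotientAddGroup.mk_add, QuotientAddGroup.mk_add, QuotientAddGroup.mk_add,
          QuotientAddGroup.mk_neg, QuotientAddGroup.mk_neg]
        have h4 : (QuotientAddGroup.mk (gradedClass n _ hd) : GradedQuotient F n ⧸ R) = _ := h1.symm
        rw [h4]
        abel
      exact (QuotientAddGroup.eq_zero_iff _).1 h3
    rw [← QuotientGroup.mk_mul, eq_comm, ← mul_inv_eq_one, ← QuotientGroup.mk_inv,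
      ← QuotientGroup.mk_mul, QuotientGroup.eq_one_iff]
    convert h2 using 1
    simp [mul_assoc]
  obtain ⟨f, c, hf⟩ := hl.factor hw
  obtain ⟨v, hv⟩ := hl.exists_loop
  -- After conjugation `f` is the splitting that `w` describes.
  let f' : K →* F ⧸ M := (MulAut.conj (c v)).toMonoidHom.comp f
  have hf' : ∀ k, ∃ t ∈ lcs F n, f' k = ((t * s k : F) : F ⧸ M) := by
    intro k
    obtain ⟨σ, rfl, h1, h0⟩ := hv k
    refine ⟨(r σ)⁻¹, inv_mem (hr σ), ?_⟩
    rw [hf σ, h1, h0]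
    rfl
  -- Both homomorphisms lift the projection of `F` to `F / Fₙ`, so they agree on `Fₙ`.
  have key := eq_of_mul_inv_mem_center hn (f'.comp p) (QuotientGroup.mk' M) (by
    intro x
    obtain ⟨t, ht, e⟩ := hf' (p x)
    have h1 : s (p x) * x⁻¹ ∈ lcs F n := by
      rw [← QuotientGroup.eq_one_iff, QuotientGroup.mk_mul, hs.section_apply,
        ← QuotientGroup.mk_mul, mul_inv_cancel, QuotientGroup.mk_one]
    have h2 := hcen _ (mul_mem ht h1)
    rwa [← mul_assoc, QuotientGroup.mk_mul, ← e, QuotientGroup.mk_inv] at h2)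
  obtain ⟨x, hx, rfl⟩ := gradedClass_surjective a
  rw [gradedQuotientMap_gradedClass, gradedClass_eq_zero] at ha
  have h1 : f' (p x) ∈ lcs (F ⧸ M) (n + 1) := map_mem_lcs f' ha
  have h2 : lcs (F ⧸ M) (n + 1) = ⊥ := by
    have := Subgroup.map_lowerCentralSeries ⊤ (QuotientGroup.mk' M) n
    rw [Subgroup.map_top_of_surjective _ (QuotientGroup.mk'_surjective M)] at this
    refine this.symm.trans ?_
    rw [Subgroup.map_eq_bot_iff, QuotientGroup.ker_mk']
    exact hlM
  rw [h2, Subgroup.mem_bot] at h1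
  have h3 := key x hx
  rw [MonoidHom.comp_apply, h1] at h3
  exact ((hM hx).1 ((QuotientGroup.eq_one_iff x).1 h3.symm))

end Obstruction


/-! ### Unitriangular matrices -/

section Unitriangular

open scoped commutatorElement

/-- The square integral matrices of size `k + 1` that vanish below the `m`-th superdiagonal. -/
def band (k m : ℕ) : AddSubgroup (Matrix (Fin (k + 1)) (Fin (k + 1)) ℤ) where
  carrier := {A | ∀ i j, j.val < i.val + m → A i j = 0}
  zero_mem' _ _ _ := rfl
  add_mem' ha hb i j h := by rw [Matrix.add_apply, ha i j h, hb i j h, add_zero]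
  neg_mem' ha i j h := by rw [Matrix.neg_apply, ha i j h, neg_zero]

variable {k : ℕ}

lemma mul_mem_band {m m' : ℕ} {A B : Matrix (Fin (k + 1)) (Fin (k + 1)) ℤ} (hA : A ∈ band k m)
    (hB : B ∈ band k m') : A * B ∈ band k (m + m') := by
  intro i j h
  rw [Matrix.mul_apply]
  refine Finset.sum_eq_zero fun l _ => ?_
  by_cases hl : l.val < i.val + m
  · rw [hA i l hl, zero_mul]
  · rw [hB l j (by omega), mul_zero]

lemma band_antitone {m m' : ℕ} (h : m ≤ m') : band k m' ≤ band k m :=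
  fun _ hA i j hij => hA i j (by omega)

lemma one_mem_band : (1 : Matrix (Fin (k + 1)) (Fin (k + 1)) ℤ) ∈ band k 0 := by
  intro i j h
  exact Matrix.one_apply_ne fun e => by subst e; omega

lemma eq_zero_of_mem_band {m : ℕ} (hm : k < m) {A : Matrix (Fin (k + 1)) (Fin (k + 1)) ℤ}
    (hA : A ∈ band k m) : A = 0 := by
  ext i j
  exact hA i j (by omega)

/-- The group of invertible matrices that agree with the identity matrix below the `m`-th
superdiagonal. -/
def unitriFiltration (k m : ℕ) : Subgroup (Matrix (Fin (k + 1)) (Fin (k + 1)) ℤ)ˣ where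
  carrier := {u | u.1 - 1 ∈ band k m ∧ u⁻¹.1 - 1 ∈ band k m}
  one_mem' := by simp [zero_mem]
  mul_mem' := by
    have key : ∀ {A B : Matrix (Fin (k + 1)) (Fin (k + 1)) ℤ}, A - 1 ∈ band k m →
        B - 1 ∈ band k m → A * B - 1 ∈ band k m := by
      intro A B hA hB
      have e : A * B - 1 = (A - 1) * (B - 1) + (A - 1) + (B - 1) := by noncomm_ring
      rw [e]
      exact add_mem (add_mem (band_antitone (by omega) (mul_mem_band hA hB)) hA) hB
    rintro u v ⟨hu, hu'⟩ ⟨hv, hv'⟩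
    exact ⟨key hu hv, by rw [mul_inv_rev]; exact key hv' hu'⟩
  inv_mem' := by
    rintro u ⟨hu, hu'⟩
    exact ⟨hu', by rwa [inv_inv]⟩

/-- The group of unitriangular integral matrices of size `k + 1`. -/
abbrev Unitri (k : ℕ) : Type := unitriFiltration k 1

/-- The underlying matrix of a unitriangular matrix. -/
abbrev Unitri.mat (u : Unitri k) : Matrix (Fin (k + 1)) (Fin (k + 1)) ℤ := u.1.1

lemma mat_mul (u v : Unitri k) : (u * v).mat = u.mat * v.mat := rfl

lemma mat_one : (1 : Unitri k).mat = 1 := rfl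

lemma mat_mul_inv (u : Unitri k) : u.mat * u⁻¹.mat = 1 := by
  rw [← mat_mul, mul_inv_cancel, mat_one]

lemma mat_inv_mul (u : Unitri k) : u⁻¹.mat * u.mat = 1 := by
  rw [← mat_mul, inv_mul_cancel, mat_one]

lemma mat_injective {u v : Unitri k} (h : u.mat = v.mat) : u = v :=
  Subtype.ext (Units.ext h)

lemma mat_mem_band (u : Unitri k) : u.mat ∈ band k 0 := by
  have := add_mem (band_antitone (Nat.zero_le _) u.2.1) one_mem_band
  rwa [sub_add_cancel] at this

lemma mat_apply_eq_zero (u : Unitri k) {i j : Fin (k + 1)} (h : j < i) : u.mat i j = 0 :=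
  mat_mem_band u i j (by simpa using h)

lemma mat_apply_self (u : Unitri k) (i : Fin (k + 1)) : u.mat i i = 1 := by
  have := u.2.1 i i (by omega)
  rwa [Matrix.sub_apply, Matrix.one_apply_eq, sub_eq_zero] at this

/-- The matrix `1 - A`, where `A` is strictly upper triangular. -/
def unitriOf (A : Matrix (Fin (k + 1)) (Fin (k + 1)) ℤ) (hA : A ∈ band k 1) : Unitri k := by
  have hpow : ∀ m, A ^ m ∈ band k m := by
    intro m
    induction m with
    | zero => rw [pow_zero]; exact one_mem_band
    | succ m ih => rw [pow_succ]; exact mul_mem_band ih hA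
  have h0 : A ^ (k + 1) = 0 := eq_zero_of_mem_band (by omega) (hpow _)
  have e1 : (1 - A) * ∑ i ∈ Finset.range (k + 1), A ^ i = 1 := by
    rw [mul_neg_geom_sum, h0, sub_zero]
  have e2 : (∑ i ∈ Finset.range (k + 1), A ^ i) * (1 - A) = 1 := by
    rw [geom_sum_mul_neg, h0, sub_zero]
  refine ⟨⟨1 - A, ∑ i ∈ Finset.range (k + 1), A ^ i, e1, e2⟩, ?_, ?_⟩
  · change 1 - A - 1 ∈ band k 1
    rw [sub_sub_cancel_left]
    exact neg_mem hA
  · change ∑ i ∈ Finset.range (k + 1), A ^ i - 1 ∈ band k 1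
    have e3 : ∑ i ∈ Finset.range (k + 1), A ^ i - 1 = A * ∑ i ∈ Finset.range (k + 1), A ^ i := by
      rw [sub_mul, one_mul] at e1
      rw [← e1]; abel
    rw [e3]
    exact mul_mem_band hA (sum_mem fun i _ => band_antitone (Nat.zero_le i) (hpow i))

lemma mat_unitriOf (A : Matrix (Fin (k + 1)) (Fin (k + 1)) ℤ) (hA : A ∈ band k 1) :
    (unitriOf A hA).mat = 1 - A := rfl

/-- The group of unitriangular matrices that agree with the identity matrix below the `m`-th
superdiagonal. -/
def unitriSubgroup (k m : ℕ) : Subgroup (Unitri k) :=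
  (unitriFiltration k m).subgroupOf (unitriFiltration k 1)

lemma mem_unitriSubgroup_iff {m : ℕ} {u : Unitri k} :
    u ∈ unitriSubgroup k m ↔ u.mat - 1 ∈ band k m := by
  refine ⟨fun h => h.1, fun h => ⟨h, ?_⟩⟩
  have e : u⁻¹.mat - 1 = -(u⁻¹.mat * (u.mat - 1)) := by
    rw [mul_sub, mat_inv_mul, mul_one]; abel
  change u⁻¹.mat - 1 ∈ band k m
  rw [e]
  have := mul_mem_band (mat_mem_band u⁻¹) h
  rw [zero_add] at this
  exact neg_mem this

lemma mem_unitriSubgroup_one (u : Unitri k) : u ∈ unitriSubgroup k 1 :=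
  mem_unitriSubgroup_iff.2 u.2.1

lemma mat_commutator_sub_one (u v : Unitri k) : ⁅u, v⁆.mat - 1 =
    ((u.mat - 1) * (v.mat - 1) - (v.mat - 1) * (u.mat - 1)) * (u⁻¹ * v⁻¹).mat := by
  have e : ⁅u, v⁆.mat = u.mat * v.mat * (u⁻¹ * v⁻¹).mat := by
    rw [← mat_mul, ← mat_mul, commutatorElement_def, mul_assoc (u * v)]
  have e1 : (1 : Matrix (Fin (k + 1)) (Fin (k + 1)) ℤ) = v.mat * u.mat * (u⁻¹ * v⁻¹).mat := by
    rw [← mat_mul, ← mat_mul, ← mat_one]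
    congr 1
    group
  conv_lhs => rw [e, e1]
  rw [← sub_mul]
  congr 1
  noncomm_ring

lemma commutator_mem_unitriSubgroup {m : ℕ} (u : Unitri k) {v : Unitri k}
    (hv : v ∈ unitriSubgroup k m) : ⁅u, v⁆ ∈ unitriSubgroup k (m + 1) := by
  rw [mem_unitriSubgroup_iff] at hv ⊢
  rw [mat_commutator_sub_one]
  have h1 := mul_mem_band u.2.1 hv
  have h2 := mul_mem_band hv u.2.1
  rw [add_comm 1 m] at h1
  have := mul_mem_band (sub_mem h1 h2) (mat_mem_band (u⁻¹ * v⁻¹))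
  rwa [add_zero] at this

instance (m : ℕ) : (unitriSubgroup k m).Normal := by
  refine ⟨fun v hv u => ?_⟩
  rw [mem_unitriSubgroup_iff] at hv ⊢
  have e : (u * v * u⁻¹).mat - 1 = u.mat * (v.mat - 1) * u⁻¹.mat := by
    rw [mul_sub, sub_mul, mul_one, mat_mul_inv]; rfl
  rw [e]
  have := mul_mem_band (mul_mem_band (mat_mem_band u) hv) (mat_mem_band u⁻¹)
  rwa [zero_add, add_zero] at this

lemma map_mem_unitriSubgroup {F : Type*} [Group F] (φ : F →* Unitri k) {m : ℕ} (hm : 1 ≤ m)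
    {x : F} (hx : x ∈ lcs F m) : φ x ∈ unitriSubgroup k m := by
  have : lcs (Unitri k) m ≤ unitriSubgroup k m := by
    induction m, hm using Nat.le_induction generalizing x with
    | base => exact fun u _ => mem_unitriSubgroup_one u
    | succ m hm ih =>
      rw [lcs_succ _ _ hm, Subgroup.commutator_le]
      exact fun u _ v hv => commutator_mem_unitriSubgroup u (ih (lcs_antitone (by omega) hx) hv)
  exact this (map_mem_lcs φ hx)

lemma eq_one_of_mem_unitriSubgroup {m : ℕ} (hm : k < m) {u : Unitri k}
    (hu : u ∈ unitriSubgroup k m) : u = 1 :=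
  mat_injective (sub_eq_zero.1 (eq_zero_of_mem_band hm (mem_unitriSubgroup_iff.1 hu)))

lemma commute_of_mem_unitriSubgroup (u : Unitri k) {v : Unitri k} (hv : v ∈ unitriSubgroup k k) :
    Commute u v :=
  commutatorElement_eq_one_iff_commute.1
    (eq_one_of_mem_unitriSubgroup (Nat.lt_succ_self k) (commutator_mem_unitriSubgroup u hv))

/-- The entry in the upper right corner. -/
def corner (u : Unitri k) : ℤ := u.mat 0 (Fin.last k)

lemma corner_mul_of_mem (hk : 1 ≤ k) (u : Unitri k) {v : Unitri k} (hv : v ∈ unitriSubgroup k k) :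
    corner (u * v) = corner u + corner v := by
  have e : (u * v).mat = (u.mat - 1) * (v.mat - 1) + u.mat + v.mat - 1 := by
    rw [mat_mul]; noncomm_ring
  have h0 : (u.mat - 1) * (v.mat - 1) = 0 :=
    eq_zero_of_mem_band (by omega) (mul_mem_band u.2.1 (mem_unitriSubgroup_iff.1 hv))
  rw [corner, e, h0, zero_add, Matrix.sub_apply, Matrix.add_apply,
    Matrix.one_apply_ne (by rw [Ne, Fin.ext_iff]; simp; omega), sub_zero]
  rfl

lemma corner_one (hk : 1 ≤ k) : corner (1 : Unitri k) = 0 :=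
  Matrix.one_apply_ne (by rw [Ne, Fin.ext_iff]; simp; omega)

/-- The entries of a product of unitriangular matrices. -/
lemma mat_mul_apply (u v : Unitri k) {i j : Fin (k + 1)} (hij : i < j) : (u * v).mat i j =
    u.mat i j + v.mat i j + ∑ l ∈ Finset.Ioo i j, u.mat i l * v.mat l j := by
  rw [mat_mul, Matrix.mul_apply, ← Finset.sum_subset (Finset.subset_univ (Finset.Icc i j)),
    ← Finset.Ioc_insert_left hij.le, Finset.sum_insert (by simp), ← Finset.Ioo_insert_right hij,
    Finset.sum_insert (by simp), mat_apply_self, mat_apply_self]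
  · ring
  · intro l _ hl
    rw [Finset.mem_Icc, not_and_or, not_le, not_le] at hl
    rcases hl with hl | hl
    · rw [mat_apply_eq_zero u hl, zero_mul]
    · rw [mat_apply_eq_zero v hl, mul_zero]

/-- The entry `(i, i + 1)` is multiplicative. -/
def superdiag (i : Fin k) : Unitri k →* Multiplicative ℤ where
  toFun u := Multiplicative.ofAdd (u.mat i.castSucc i.succ)
  map_one' := congrArg Multiplicative.ofAdd
    (Matrix.one_apply_ne (by rw [Ne, Fin.ext_iff]; simp))
  map_mul' u v := by
    rw [← ofAdd_add, mat_mul_apply u v (Fin.castSucc_lt_succ)]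
    have : Finset.Ioo i.castSucc i.succ = ∅ := by
      ext l
      simp only [Finset.mem_Ioo, Fin.lt_def, Fin.val_castSucc, Fin.val_succ, Finset.notMem_empty,
        iff_false]
      omega
    rw [this, Finset.sum_empty, add_zero]

lemma superdiag_apply (i : Fin k) (u : Unitri k) :
    superdiag i u = Multiplicative.ofAdd (u.mat i.castSucc i.succ) := rfl

/-- The functional on `Fₙ/Fₙ₊₁` given by the corner entry of a representation by unitriangular
matrices. -/
def cornerHom {F : Type*} [Group F] {n : ℕ} (hk : 1 ≤ k) (hkn : k ≤ n) (φ : F →* Unitri k) :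
    GradedQuotient F n →+ ℤ :=
  MonoidHom.toAdditiveLeft (QuotientGroup.lift _
    (MonoidHom.mk' (fun x : lcs F n => Multiplicative.ofAdd (corner (φ x))) fun x y => by
      rw [← ofAdd_add, ← corner_mul_of_mem hk]
      · rw [← map_mul]; rfl
      · exact map_mem_unitriSubgroup φ hk (lcs_antitone hkn y.2))
    fun x hx => by
      have h : φ x = 1 := eq_one_of_mem_unitriSubgroup (m := n + 1) (by omega)
        (map_mem_unitriSubgroup φ (by omega) hx)
      change Multiplicative.ofAdd (corner (φ x)) = 1
      rw [h, corner_one hk]; rfl)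

lemma cornerHom_gradedClass {F : Type*} [Group F] {n : ℕ} (hk : 1 ≤ k) (hkn : k ≤ n)
    (φ : F →* Unitri k) {x : F} (hx : x ∈ lcs F n) :
    cornerHom hk hkn φ (gradedClass n x hx) = corner (φ x) := rfl

end Unitriangular


/-! ### Corner entries of iterated commutators -/

section CornerContraction

open scoped commutatorElement

variable {k : ℕ} {H : Type w} [AddCommGroup H]

/-- The matrix with the entries `x` on the first superdiagonal, and zero elsewhere. -/
def superdiagMatrix (x : Fin k → ℤ) : Matrix (Fin (k + 1)) (Fin (k + 1)) ℤ :=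
  Matrix.of fun i j => if h : i.val + 1 = j.val then x ⟨i.val, by omega⟩ else 0

lemma superdiagMatrix_apply {x : Fin k → ℤ} {i j : Fin (k + 1)} (h : i.val + 1 = j.val) :
    superdiagMatrix x i j = x ⟨i.val, by omega⟩ := dif_pos h

lemma superdiagMatrix_apply_ne {x : Fin k → ℤ} {i j : Fin (k + 1)} (h : i.val + 1 ≠ j.val) :
    superdiagMatrix x i j = 0 := dif_neg h

lemma superdiagMatrix_mem_band (x : Fin k → ℤ) : superdiagMatrix x ∈ band k 1 :=
  fun _ _ h => superdiagMatrix_apply_ne (by omega)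

lemma mat_sub_superdiagMatrix_mem_band {u : Unitri k} {x : Fin k → ℤ}
    (hx : ∀ i, x i = Multiplicative.toAdd (superdiag i u)) :
    u.mat - 1 - superdiagMatrix x ∈ band k 2 := by
  intro i j h
  rw [Matrix.sub_apply, sub_eq_zero]
  by_cases hij : i.val + 1 = j.val
  · rw [superdiagMatrix_apply hij, hx, Matrix.sub_apply,
      Matrix.one_apply_ne (by rw [Ne, Fin.ext_iff]; omega), sub_zero]
    have h1 : i = Fin.castSucc (⟨i.val, by omega⟩ : Fin k) := rfl
    have h2 : j = Fin.succ (⟨i.val, by omega⟩ : Fin k) := Fin.ext hij.symm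
    exact congrArg₂ u.mat h1 h2
  · rw [superdiagMatrix_apply_ne hij]
    exact u.2.1 i j (by omega)

/-- The entries of a product of `m` matrices supported on the first superdiagonal. -/
lemma prod_superdiagMatrix_apply {m : ℕ} (x : Fin m → Fin k → ℤ) (i j : Fin (k + 1))
    (hij : i.val + m = j.val) : (List.ofFn fun l => superdiagMatrix (x l)).prod i j =
      ∏ l : Fin m, x l ⟨i.val + l.val, by omega⟩ := by
  induction m generalizing i with
  | zero =>
    obtain rfl : i = j := Fin.ext hij
    simp
  | succ m ih =>
    rw [List.ofFn_succ, List.prod_cons, Matrix.mul_apply, Fin.prod_univ_succ,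
      Finset.sum_eq_single (⟨i.val + 1, by omega⟩ : Fin (k + 1))]
    · rw [superdiagMatrix_apply rfl, ih _ _ (by simp only; omega)]
      congr 1
      refine Finset.prod_congr rfl fun l _ => congrArg _ (Fin.ext ?_)
      simp only [Fin.val_succ]
      omega
    · intro l _ hl
      rw [superdiagMatrix_apply_ne (fun e => hl (Fin.ext e.symm)), zero_mul]
    · exact fun h => absurd (Finset.mem_univ _) h

/-- The homomorphism from the tensor ring to matrices that takes `h` to the matrix with the
superdiagonal `ξ₁(h), …, ξₖ(h)`. -/
noncomputable def superdiagHom (ξ : Fin k → H →+ ℤ) :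
    TensorAlgebra ℤ H →ₐ[ℤ] Matrix (Fin (k + 1)) (Fin (k + 1)) ℤ :=
  TensorAlgebra.lift ℤ (AddMonoidHom.mk' (fun h => superdiagMatrix fun i => ξ i h) fun g h => by
    ext i j
    rw [Matrix.add_apply]
    by_cases hij : i.val + 1 = j.val
    · simp only [superdiagMatrix_apply hij, map_add]
    · simp only [superdiagMatrix_apply_ne hij, add_zero]).toIntLinearMap

lemma superdiagHom_ι (ξ : Fin k → H →+ ℤ) (h : H) :
    superdiagHom ξ (TensorAlgebra.ι ℤ h) = superdiagMatrix fun i => ξ i h :=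
  TensorAlgebra.lift_ι_apply ..

lemma contraction_eq_superdiagHom (ξ : Fin k → H →+ ℤ) {ι : Type*} {t : ι → H}
    {z : TensorAlgebra ℤ H} (hz : z ∈ tensorWords t k) :
    contraction ξ z = superdiagHom ξ z 0 (Fin.last k) := by
  induction hz using Submodule.span_induction with
  | mem z hz =>
    obtain ⟨I, rfl⟩ := hz
    dsimp only
    rw [contraction_tprod, TensorAlgebra.tprod_apply, map_list_prod, List.map_ofFn]
    have e : (superdiagHom ξ ∘ fun i => TensorAlgebra.ι ℤ (t (I i))) =
        fun i => superdiagMatrix fun j => ξ j (t (I i)) := funext fun i => superdiagHom_ι ξ _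
    rw [e, prod_superdiagMatrix_apply _ _ _ (by simp)]
    simp
  | zero => simp
  | add a b _ _ ha hb => rw [map_add, map_add, ha, hb, Matrix.add_apply]
  | smul c a _ ha => rw [map_smul, map_smul, ha, Matrix.smul_apply]

/-- The leading term of a unitriangular representation on an iterated commutator: up to terms
further away from the diagonal it is the iterated bracket of the superdiagonal parts. -/
lemma map_iterCommutator_sub_mem_band {F : Type*} [Group F] {φ : F →* Unitri k}
    {ξ : Fin k → H →+ ℤ} (a : H × F) (l : List (H × F))
    (hl : ∀ b ∈ a :: l, ∀ i, ξ i b.1 = Multiplicative.toAdd (superdiag i (φ b.2))) :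
    (φ (iterCommutator ((a :: l).map Prod.snd))).mat - 1 -
      superdiagHom ξ (toTensor (iterBracket ((a :: l).map Prod.fst))) ∈
        band k ((a :: l).length + 1) := by
  induction l generalizing a with
  | nil =>
    change (φ a.2).mat - 1 - superdiagHom ξ (toTensor (FreeLieRing.of a.1)) ∈ band k 2
    rw [toTensor_of, superdiagHom_ι]
    exact mat_sub_superdiagMatrix_mem_band (hl a (by simp))
  | cons b l ih =>
    have hY := ih b fun c hc => hl c (List.mem_cons_of_mem a hc)
    set v := φ (iterCommutator ((b :: l).map Prod.snd))
    set R := superdiagHom ξ (toTensor (iterBracket ((b :: l).map Prod.fst)))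
    set m := (b :: l).length with hm
    have hV : v.mat - 1 ∈ band k m := by
      refine mem_unitriSubgroup_iff.1 (map_mem_unitriSubgroup φ (by simp [hm]) ?_)
      simpa [hm] using iterCommutator_mem ((b :: l).map Prod.snd)
    have hR : R ∈ band k m := by
      have := sub_mem hV (band_antitone (Nat.le_succ m) hY)
      rwa [sub_sub_cancel] at this
    change (φ ⁅a.2, iterCommutator ((b :: l).map Prod.snd)⁆).mat - 1 - superdiagHom ξ (toTensor
      ⁅FreeLieRing.of a.1, iterBracket ((b :: l).map Prod.fst)⁆) ∈ band k (m + 1 + 1)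
    rw [map_commutatorElement, toTensor_bracket, toTensor_of, map_sub, map_mul, map_mul,
      superdiagHom_ι, mat_commutator_sub_one]
    set u := φ a.2
    set D := superdiagMatrix fun i => ξ i a.1
    have hX : u.mat - 1 - D ∈ band k 2 := mat_sub_superdiagMatrix_mem_band (hl a (by simp))
    have hU : u.mat - 1 ∈ band k 1 := u.2.1
    have e : ((u.mat - 1) * (v.mat - 1) - (v.mat - 1) * (u.mat - 1)) * (u⁻¹ * v⁻¹).mat -
        (D * R - R * D) =
        ((u.mat - 1) * (v.mat - 1) - (v.mat - 1) * (u.mat - 1)) * ((u⁻¹ * v⁻¹).mat - 1) +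
        ((u.mat - 1) * (v.mat - 1 - R) + (u.mat - 1 - D) * R) -
        ((v.mat - 1 - R) * (u.mat - 1) + R * (u.mat - 1 - D)) := by
      noncomm_ring
    rw [e]
    have h1 : (u.mat - 1) * (v.mat - 1) - (v.mat - 1) * (u.mat - 1) ∈ band k (m + 1) :=
      sub_mem (band_antitone (by omega) (mul_mem_band hU hV)) (mul_mem_band hV hU)
    refine sub_mem (add_mem (mul_mem_band h1 (u⁻¹ * v⁻¹).2.1) (add_mem ?_ ?_)) (add_mem ?_ ?_)
    · exact band_antitone (by omega) (mul_mem_band hU hY)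
    · exact band_antitone (by omega) (mul_mem_band hX hR)
    · exact mul_mem_band hY hU
    · exact band_antitone (by omega) (mul_mem_band hR hX)

lemma corner_iterCommutator {n : ℕ} (hn : 1 ≤ n) {F : Type*} [Group F] {φ : F →* Unitri n}
    {ξ : Fin n → H →+ ℤ} {h : Fin n → H} {g : Fin n → F}
    (hξ : ∀ j i, ξ i (h j) = Multiplicative.toAdd (superdiag i (φ (g j)))) :
    corner (φ (iterCommutator (List.ofFn g))) = contraction ξ (toTensor (bracketElt h).1) := by
  have hl : ∀ b ∈ List.ofFn fun i => (h i, g i),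
      ∀ i, ξ i b.1 = Multiplicative.toAdd (superdiag i (φ b.2)) := by
    intro b hb
    obtain ⟨i, rfl⟩ := List.mem_ofFn.1 hb
    exact hξ i
  have h1 : (List.ofFn fun i => (h i, g i)).map Prod.fst = List.ofFn h := by
    rw [List.map_ofFn]; rfl
  have h2 : (List.ofFn fun i => (h i, g i)).map Prod.snd = List.ofFn g := by
    rw [List.map_ofFn]; rfl
  have h3 : (List.ofFn fun i => (h i, g i)).length = n := List.length_ofFn
  obtain ⟨a, l, e0⟩ : ∃ a l, (List.ofFn fun i => (h i, g i)) = a :: l :=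
    List.exists_cons_of_ne_nil fun e0 => by rw [e0] at h3; simp at h3; omega
  rw [e0] at hl h1 h2 h3
  have key := map_iterCommutator_sub_mem_band a l hl
  rw [h1, h2, h3] at key
  have h4 := key 0 (Fin.last n) (by simp)
  rw [Matrix.sub_apply, Matrix.sub_apply,
    Matrix.one_apply_ne (by rw [Ne, Fin.ext_iff]; simp; omega), sub_zero, sub_eq_zero] at h4
  rw [contraction_eq_superdiagHom ξ (toTensor_mem_tensorWords (t := id) (by simp) (bracketElt h))]
  exact h4

/-- The corner entry of a representation by unitriangular matrices, as a functional on `Lₙ(H)`,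
is the tensor product of its superdiagonal entries. -/
lemma cornerHom_degreeMap {n : ℕ} (hn : 1 ≤ n) {F : Type*} [Group F] {e : H →+ GradedQuotient F 1}
    {φ : F →* Unitri n} {ξ : Fin n → H →+ ℤ} (he : ∀ h, ∃ g, e h = gradedClass 1 g (mem_lcs_one g) ∧
      ∀ i, ξ i h = Multiplicative.toAdd (superdiag i (φ g))) (z : freeLieDegree H n) :
    cornerHom hn le_rfl φ (degreeMap e n z) = contraction ξ (toTensor z.1) := by
  have key : (cornerHom hn le_rfl φ).comp (degreeMap e n) =
      ((contraction ξ).toAddMonoidHom.comp toTensor).comp (freeLieDegree H n).subtype := by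
    refine freeLieDegree_hom_ext fun h => ?_
    choose g hg hξ using fun i => he (h i)
    rw [AddMonoidHom.comp_apply, degreeMap_bracketElt hn hg]
    exact corner_iterCommutator hn hξ
  exact DFunLike.congr_fun key z

end CornerContraction

/-! ### Free groups and their abelianizations -/

section Abelianization

variable {F : Type v} [Group F] {H : Type w} [AddCommGroup H] {q : F →* Multiplicative H}

/-- A surjective homomorphism to an abelian group, written additively, whose kernel is the
commutator subgroup. -/
structure IsAbelianization (q : F →* Multiplicative H) : Prop where
  surjective : Function.Surjective q
  mem_lcs : ∀ x, q x = 1 → x ∈ lcs F 2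

lemma IsAbelianization.exists_lift (hq : IsAbelianization q) {A : Type*} [AddCommGroup A]
    (χ : F →* Multiplicative A) :
    ∃ ξ : H →+ A, ∀ x, ξ (Multiplicative.toAdd (q x)) = Multiplicative.toAdd (χ x) := by
  let f := q.liftOfSurjective hq.surjective ⟨χ, fun x hx =>
    map_eq_one_of_comm le_rfl χ x (hq.mem_lcs x hx)⟩
  refine ⟨MonoidHom.toAdditive f, fun x => congrArg Multiplicative.toAdd ?_⟩
  exact q.liftOfRightInverse_comp_apply _ (Function.rightInverse_surjInv hq.surjective) _ x

lemma IsAbelianization.hom_ext (hq : IsAbelianization q) {A : Type*} [AddCommGroup A]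
    {f g : H →+ A} (h : ∀ x, f (Multiplicative.toAdd (q x)) = g (Multiplicative.toAdd (q x))) :
    f = g := by
  ext y
  obtain ⟨x, hx⟩ := hq.surjective (Multiplicative.ofAdd y)
  have := h x
  rwa [hx] at this

/-- The isomorphism of the abelianization with `F₁/F₂`. -/
noncomputable def IsAbelianization.degreeOneMap (hq : IsAbelianization q) :
    H →+ GradedQuotient F 1 :=
  (hq.exists_lift (MonoidHom.mk' (fun x => Multiplicative.ofAdd (gradedClass 1 x (mem_lcs_one x)))
    fun x y => congrArg _ (gradedClass_mul (mem_lcs_one x) (mem_lcs_one y)))).choose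

lemma IsAbelianization.degreeOneMap_apply (hq : IsAbelianization q) (x : F) :
    hq.degreeOneMap (Multiplicative.toAdd (q x)) = gradedClass 1 x (mem_lcs_one x) :=
  (hq.exists_lift (MonoidHom.mk' (fun x => Multiplicative.ofAdd (gradedClass 1 x (mem_lcs_one x)))
    fun x y => congrArg _ (gradedClass_mul (mem_lcs_one x) (mem_lcs_one y)))).choose_spec x

lemma IsAbelianization.degreeOneMap_surjective (hq : IsAbelianization q) :
    Function.Surjective hq.degreeOneMap := by
  intro a
  obtain ⟨x, hx, rfl⟩ := gradedClass_surjective a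
  exact ⟨_, hq.degreeOneMap_apply x⟩

lemma IsAbelianization.exists_degreeOneMap_eq (hq : IsAbelianization q) (h : H) :
    ∃ x, Multiplicative.toAdd (q x) = h ∧ hq.degreeOneMap h = gradedClass 1 x (mem_lcs_one x) := by
  obtain ⟨x, hx⟩ := hq.surjective (Multiplicative.ofAdd h)
  refine ⟨x, by rw [hx]; rfl, ?_⟩
  rw [← hq.degreeOneMap_apply x, hx]
  rfl

variable {ι : Type*} (b : FreeGroupBasis ι F)

include b

/-- The abelianization of a free group is free abelian. -/
lemma IsAbelianization.exists_basis (hq : IsAbelianization q) :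
    ∃ t : Module.Basis ι ℤ H, ∀ i, t i = Multiplicative.toAdd (q (b i)) := by
  obtain ⟨ξ, hξ⟩ := hq.exists_lift (b.lift fun i => Multiplicative.ofAdd (Finsupp.single i (1 : ℤ)))
  let η : (ι →₀ ℤ) →+ H :=
    Finsupp.liftAddHom fun i => zmultiplesHom H (Multiplicative.toAdd (q (b i)))
  have hη : ∀ i, η (Finsupp.single i 1) = Multiplicative.toAdd (q (b i)) := by
    intro i; simp [η]
  have hξb : ∀ i, ξ (Multiplicative.toAdd (q (b i))) = Finsupp.single i 1 := by
    intro i; rw [hξ]; simp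
  have h1 : η.comp ξ = AddMonoidHom.id H := by
    refine hq.hom_ext fun x => ?_
    have : (AddMonoidHom.toMultiplicative (η.comp ξ)).comp q = q := by
      refine b.ext_hom _ _ fun i => ?_
      change Multiplicative.ofAdd (η (ξ (Multiplicative.toAdd (q (b i))))) = q (b i)
      rw [hξb, hη]
      rfl
    exact congrArg Multiplicative.toAdd (DFunLike.congr_fun this x)
  have h2 : ξ.comp η = AddMonoidHom.id _ := by
    ext i : 2
    change ξ (η (Finsupp.single i 1)) = _
    rw [hη, hξb]
    rfl
  let t : Module.Basis ι ℤ H := Module.Basis.ofRepr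
    { ξ.toIntLinearMap with
      invFun := η
      left_inv := fun x => DFunLike.congr_fun h1 x
      right_inv := fun x => DFunLike.congr_fun h2 x }
  refine ⟨t, fun i => ?_⟩
  rw [← hη]
  rfl

/-- A free group has a representation by unitriangular matrices with prescribed superdiagonal
entries. -/
lemma exists_superdiag_comp_eq {k : ℕ} (χ : Fin k → F →* Multiplicative ℤ) :
    ∃ φ : F →* Unitri k, ∀ i x, superdiag i (φ x) = χ i x := by
  let φ : F →* Unitri k := b.lift fun j => unitriOf
    (-superdiagMatrix fun i => Multiplicative.toAdd (χ i (b j)))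
      (neg_mem (superdiagMatrix_mem_band _))
  refine ⟨φ, fun i => DFunLike.congr_fun (f := (superdiag i).comp φ) ?_⟩
  refine b.ext_hom _ _ fun j => ?_
  have e : φ (b j) = unitriOf (-superdiagMatrix fun i => Multiplicative.toAdd (χ i (b j)))
      (neg_mem (superdiagMatrix_mem_band _)) := by simp [φ]
  rw [MonoidHom.comp_apply, e, superdiag_apply, mat_unitriOf,
    sub_neg_eq_add, Matrix.add_apply, superdiagMatrix_apply (by simp),
    Matrix.one_apply_ne (by rw [Ne, Fin.ext_iff]; simp), zero_add]
  rfl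

/-- An element of `Lₙ(H)`, where `H` is free abelian, is determined by its images under tensor
products of functionals. -/
lemma IsAbelianization.eq_zero_of_contraction (hq : IsAbelianization q) {n : ℕ}
    {z : freeLieDegree H n} (hz : ∀ ξ : Fin n → H →+ ℤ, contraction ξ (toTensor z.1) = 0) :
    z = 0 := by
  obtain ⟨t, -⟩ := hq.exists_basis b
  refine Subtype.ext (toTensor_injOn t z.2 ?_)
  have ht : AddSubgroup.closure (Set.range t) = ⊤ := by
    rw [← Submodule.span_int_eq_addSubgroupClosure, t.span_eq]; rfl
  rw [(eq_finsum_contraction (t := t) (ξ := fun i => (t.coord i).toAddMonoidHom) (by simp)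
    (fun i j hij => by simp [hij.symm]) (toTensor_mem_tensorWords ht z)).2]
  simp [hz]

/-- For a free group the homomorphism `Lₙ(H) → Fₙ/Fₙ₊₁` is an isomorphism. -/
lemma IsAbelianization.degreeMap_bijective (hq : IsAbelianization q) {n : ℕ} (hn : 1 ≤ n) :
    Function.Bijective (degreeMap hq.degreeOneMap n) := by
  refine ⟨(injective_iff_map_eq_zero _).2 fun z hz => hq.eq_zero_of_contraction b fun ξ => ?_,
    degreeMap_surjective hn hq.degreeOneMap_surjective⟩
  obtain ⟨φ, hφ⟩ := exists_superdiag_comp_eq b fun i => (AddMonoidHom.toMultiplicative (ξ i)).comp q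
  rw [← cornerHom_degreeMap hn (e := hq.degreeOneMap) (φ := φ), hz, map_zero]
  intro h
  obtain ⟨x, rfl, hx⟩ := hq.exists_degreeOneMap_eq h
  refine ⟨x, hx, fun i => ?_⟩
  rw [hφ]
  rfl

end Abelianization


/-! ### Massey products and unitriangular representations -/

section Cochains

variable {S : SSet.{u}}

lemma coboundary_eq_coboundaryOf {n : ℕ} (a : Cochain S n) : coboundary S n a = coboundaryOf a := by
  funext σ
  simp [coboundary, coboundaryOf]

lemma coboundary_apply_one (a : Cochain S 1) (σ : Simplex S 2) :
    coboundary S 1 a σ = a (S.δ 0 σ) - a (S.δ 1 σ) + a (S.δ 2 σ) := by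
  rw [coboundary_eq_coboundaryOf, coboundaryOf_one]

lemma coboundary_apply_zero (a : Cochain S 0) (σ : Simplex S 1) :
    coboundary S 0 a σ = a (S.δ 0 σ) - a (S.δ 1 σ) := by
  simp [coboundary, Fin.sum_univ_two, sub_eq_add_neg]

lemma cup₁₁_apply (a b : Cochain S 1) (σ : Simplex S 2) :
    cup₁₁ a b σ = a (S.δ 2 σ) * b (S.δ 0 σ) := by
  have h1 := face_last_frontFace (p := 1) (le_refl 2) σ
  have h0 := face_zero_backFace (p := 0) (q := 1) rfl σ
  have e1 : frontFace 2 le_rfl σ = σ := by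
    have : SimplexCategory.subinterval (n := 2) 0 2 (by omega) = 𝟙 _ :=
      hom_ext_val _ _ fun x => by rw [subinterval_val]; rfl
    rw [frontFace, this]
    simp
  have e0 : backFace 0 2 rfl σ = σ := by
    have : SimplexCategory.subinterval (n := 2) 0 2 (by omega) = 𝟙 _ :=
      hom_ext_val _ _ fun x => by rw [subinterval_val]; rfl
    rw [backFace, this]
    simp
  rw [e1] at h1
  rw [e0] at h0
  change a (frontFace 1 _ σ) * b (backFace 1 1 _ σ) = _
  rw [← h1, ← h0]
  rfl

lemma boundary_boundary {n : ℕ} (z : Chain S (n + 2)) : boundary S n (boundary S (n + 1) z) = 0 := by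
  apply chainHom_injective
  rw [← chainHom_d, ← chainHom_d, Category.assoc, HomologicalComplex.d_comp_d, Limits.comp_zero,
    map_zero]

lemma coboundaryOf_coboundaryOf {n : ℕ} {A : Type*} [AddCommGroup A] (a : Simplex S n → A) :
    coboundaryOf (coboundaryOf a) = 0 := by
  funext σ
  have h : evalChain (coboundaryOf (coboundaryOf a)) (Finsupp.single σ 1) = 0 := by
    rw [← evalChain_boundary, ← evalChain_boundary, boundary_boundary, map_zero]
  rwa [evalChain_single, one_smul] at h

lemma coboundary_mem_cocycles {n : ℕ} (a : Cochain S n) : coboundary S n a ∈ cocycles S (n + 1) := by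
  change coboundary S (n + 1) (coboundary S n a) = 0
  rw [coboundary_eq_coboundaryOf, coboundary_eq_coboundaryOf, coboundaryOf_coboundaryOf]

lemma cohomologyClass_eq_iff {n : ℕ} (a b : cocycles S (n + 1)) :
    cohomologyClass (n + 1) a = cohomologyClass (n + 1) b ↔ ∃ c, coboundary S n c = b.1 - a.1 := by
  refine QuotientAddGroup.eq.trans ?_
  rw [neg_add_eq_sub]
  exact Iff.rfl

end Cochains

section LabelClass

variable {S : SSet.{u}} {K : Type u} [Group K] {l : Simplex S 1 → K} {H : Type u} [AddCommGroup H]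
  {q : K →* Multiplicative H}

/-- The class in `H¹(S)` given by a functional on the abelianization of the group of labels. The
sign makes it pair correctly with the labels of loops, which are inverse to the loops. -/
def labelClass (hl : IsLabel S l) (q : K →* Multiplicative H) (ξ : H →+ ℤ) : Cohomology S 1 :=
  cohomologyClass 1 ⟨fun σ => -ξ (Multiplicative.toAdd (q (l σ))), by
    change coboundary S 1 _ = 0
    funext σ
    rw [coboundary_apply_one, hl.mul σ, map_mul, toAdd_mul, map_add, Pi.zero_apply]
    abel⟩

lemma labelClass_injective (hl : IsLabel S l) (hq : IsAbelianization q) :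
    Function.Injective (labelClass hl q) := by
  intro ξ ξ' h
  obtain ⟨c, hc⟩ := (cohomologyClass_eq_iff _ _).1 h
  obtain ⟨v, hv⟩ := hl.exists_loop
  refine hq.hom_ext fun k => ?_
  obtain ⟨σ, rfl, h1, h0⟩ := hv k
  have := congrFun hc σ
  rw [coboundary_apply_zero, h1, h0, sub_self] at this
  simp only [Pi.sub_apply] at this
  omega

lemma labelClass_surjective (hl : IsLabel S l) (hq : IsAbelianization q) :
    Function.Surjective (labelClass hl q) := by
  intro α
  obtain ⟨⟨a, ha⟩, rfl⟩ := QuotientAddGroup.mk_surjective α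
  obtain ⟨f, c, hf⟩ := hl.factor (w := fun σ => Multiplicative.ofAdd (a σ)) (by
    intro σ
    have := congrFun (show coboundary S 1 a = 0 from ha) σ
    rw [coboundary_apply_one, Pi.zero_apply] at this
    rw [← ofAdd_add]
    exact congrArg _ (by linarith))
  obtain ⟨ξ, hξ⟩ := hq.exists_lift f⁻¹
  refine ⟨ξ, (cohomologyClass_eq_iff _ _).2
    ⟨fun v => -Multiplicative.toAdd (c v), funext fun σ => ?_⟩⟩
  have h1 := congrArg Multiplicative.toAdd (hf σ)
  rw [toAdd_mul, toAdd_mul, toAdd_inv, toAdd_ofAdd] at h1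
  rw [coboundary_apply_zero]
  simp only [Pi.sub_apply]
  rw [h1, hξ, MonoidHom.inv_apply, toAdd_inv]
  ring

end LabelClass

section MasseyRepresentation

variable {S : SSet.{u}} {K : Type u} [Group K] {l : Simplex S 1 → K}
  {F : Type v} [Group F] {p : F →* K} {n : ℕ} {s : K → F}

/-- The cochain `∑ a₀ⱼ ∪ aⱼₖ` given by a defining system. -/
abbrev masseyCochain {k : ℕ} (a : Fin (k + 1) → Fin (k + 1) → Cochain S 1) : Cochain S 2 :=
  ∑ j ∈ Finset.Ioo 0 (Fin.last k), cup₁₁ (a 0 j) (a j (Fin.last k))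

/-- The matrix cochain formed by a defining system. -/
def systemMatrix {k : ℕ} (a : Fin (k + 1) → Fin (k + 1) → Cochain S 1) (σ : Simplex S 1) :
    Matrix (Fin (k + 1)) (Fin (k + 1)) ℤ :=
  Matrix.of fun i j => if i < j ∧ ¬(i = 0 ∧ j = Fin.last k) then a i j σ else 0

lemma systemMatrix_mem_band {k : ℕ} (a : Fin (k + 1) → Fin (k + 1) → Cochain S 1)
    (σ : Simplex S 1) : systemMatrix a σ ∈ band k 1 :=
  fun i j h => if_neg fun h' => by have := h'.1; rw [Fin.lt_def] at this; omega

/-- A defining system, as a cochain with values in unitriangular matrices. -/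
def systemUnitri {k : ℕ} (a : Fin (k + 1) → Fin (k + 1) → Cochain S 1) (σ : Simplex S 1) :
    Unitri k :=
  unitriOf (systemMatrix a σ) (systemMatrix_mem_band a σ)

lemma mat_systemUnitri {k : ℕ} (a : Fin (k + 1) → Fin (k + 1) → Cochain S 1) (σ : Simplex S 1)
    {i j : Fin (k + 1)} (hij : i < j) (h : ¬(i = 0 ∧ j = Fin.last k)) :
    (systemUnitri a σ).mat i j = -a i j σ := by
  rw [systemUnitri, mat_unitriOf, Matrix.sub_apply, Matrix.one_apply_ne hij.ne, zero_sub]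
  exact congrArg Neg.neg (if_pos ⟨hij, h⟩)

lemma corner_systemUnitri {k : ℕ} (hk : 1 ≤ k) (a : Fin (k + 1) → Fin (k + 1) → Cochain S 1)
    (σ : Simplex S 1) : corner (systemUnitri a σ) = 0 := by
  rw [corner, systemUnitri, mat_unitriOf, Matrix.sub_apply,
    Matrix.one_apply_ne (by rw [Ne, Fin.ext_iff]; simp; omega), zero_sub, neg_eq_zero]
  exact if_neg fun h => h.2 ⟨rfl, rfl⟩

/-- The defining equations say that the matrix cochain is multiplicative up to the corner entry,
where the cochain of the Massey product appears. -/
lemma mat_systemUnitri_mul {k : ℕ} (hk : 1 ≤ k) {α : Fin k → Cohomology S 1}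
    {a : Fin (k + 1) → Fin (k + 1) → Cochain S 1} (ha : IsDefiningSystem α a) (σ : Simplex S 2) :
    (systemUnitri a (S.δ 1 σ))⁻¹ * (systemUnitri a (S.δ 2 σ) * systemUnitri a (S.δ 0 σ)) ∈
        unitriSubgroup k k ∧
      corner (systemUnitri a (S.δ 2 σ) * systemUnitri a (S.δ 0 σ)) = masseyCochain a σ := by
  set u := systemUnitri a (S.δ 2 σ)
  set v := systemUnitri a (S.δ 0 σ)
  set w := systemUnitri a (S.δ 1 σ)
  have hsum : ∀ i j, i < j → ∑ l ∈ Finset.Ioo i j, u.mat i l * v.mat l j =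
      (∑ l ∈ Finset.Ioo i j, cup₁₁ (a i l) (a l j)) σ := by
    intro i j hij
    rw [Finset.sum_apply]
    refine Finset.sum_congr rfl fun l hl => ?_
    rw [Finset.mem_Ioo] at hl
    rw [cup₁₁_apply, mat_systemUnitri a _ hl.1 fun h => absurd (Fin.le_last j) (by
        rw [← h.2]; exact not_le.2 hl.2),
      mat_systemUnitri a _ hl.2 fun h => absurd (Fin.zero_le i) (by rw [← h.1]; exact not_le.2 hl.1),
      neg_mul_neg]
  have h0 : (0 : Fin (k + 1)) < Fin.last k := by
    rw [Fin.lt_def]; simp; omega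
  constructor
  · have hd : (u * v).mat - w.mat ∈ band k k := by
      intro i j h
      rw [Matrix.sub_apply, sub_eq_zero]
      rcases lt_trichotomy i j with hij | rfl | hij
      · have hc : ¬(i = 0 ∧ j = Fin.last k) := by
          rintro ⟨rfl, rfl⟩
          simp at h
        have := congrFun (ha.2 i j hij hc) σ
        rw [coboundary_apply_one, ← hsum i j hij] at this
        rw [mat_mul_apply u v hij, mat_systemUnitri a _ hij hc, mat_systemUnitri a _ hij hc,
          mat_systemUnitri a _ hij hc, ← this]
        ring
      · rw [mat_apply_self, mat_apply_self]
      · rw [mat_apply_eq_zero _ hij, mat_apply_eq_zero _ hij]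
    rw [mem_unitriSubgroup_iff]
    have e : (w⁻¹ * (u * v)).mat - 1 = w⁻¹.mat * ((u * v).mat - w.mat) := by
      rw [mul_sub, mat_inv_mul, ← mat_mul]
    rw [e]
    have := mul_mem_band (mat_mem_band w⁻¹) hd
    rwa [zero_add] at this
  · rw [corner, mat_mul_apply u v h0, hsum _ _ h0]
    have h1 := corner_systemUnitri hk a (S.δ 2 σ)
    have h2 := corner_systemUnitri hk a (S.δ 0 σ)
    rw [corner] at h1 h2
    rw [h1, h2, zero_add, zero_add]

lemma map_eq_one_of_quotient {k : ℕ} (hk : 1 ≤ k) (hkn : k ≤ n)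
    (f : K →* Unitri k ⧸ unitriSubgroup k k) : ∀ x ∈ lcs K n, f x = 1 := by
  intro x hx
  have h1 : f x ∈ lcs (Unitri k ⧸ unitriSubgroup k k) k := map_mem_lcs f (lcs_antitone hkn hx)
  have h2 : lcs (Unitri k ⧸ unitriSubgroup k k) k = ⊥ := by
    have := Subgroup.map_lowerCentralSeries ⊤ (QuotientGroup.mk' (unitriSubgroup k k)) (k - 1)
    rw [Subgroup.map_top_of_surjective _ (QuotientGroup.mk'_surjective _)] at this
    refine this.symm.trans ?_
    rw [Subgroup.map_eq_bot_iff, QuotientGroup.ker_mk']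
    exact fun y hy => map_mem_unitriSubgroup (MonoidHom.id _) hk hy
  rwa [h2, Subgroup.mem_bot] at h1

/-- Up to a coboundary, every defining system arises from a representation of the free group by
unitriangular matrices, and the Massey product is the corner entry of the obstruction to extending
the representation to `K`. -/
lemma exists_representation (hl : IsLabel S l) {ι : Type w} (b : FreeGroupBasis ι F)
    (hs : IsSectionMod n p s) {k : ℕ} (hk : 2 ≤ k) (hkn : k ≤ n) {α : Fin k → Cohomology S 1}
    {a : Fin (k + 1) → Fin (k + 1) → Cochain S 1} (ha : IsDefiningSystem α a) :
    ∃ (φ : F →* Unitri k) (e : Cochain S 1) (g : Fin k → Cochain S 0),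
      (∀ σ, masseyCochain a σ =
        cornerHom (by omega) hkn φ (defectCochain hl hs σ) + coboundary S 1 e σ) ∧
      ∀ i σ, a i.castSucc i.succ σ =
        -Multiplicative.toAdd (superdiag i (φ (s (l σ)))) + coboundary S 0 (g i) σ := by
  have hk1 : 1 ≤ k := by omega
  let U := unitriSubgroup k k
  obtain ⟨f, c, hf⟩ := hl.factor (w := fun σ => (systemUnitri a σ : Unitri k ⧸ U))
    fun σ => QuotientGroup.eq.2 (mat_systemUnitri_mul hk1 ha σ).1
  let φ : F →* Unitri k := b.lift fun i => Quotient.out (f (p (b i)))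
  have hφ : ∀ x, (φ x : Unitri k ⧸ U) = f (p x) := by
    have : (QuotientGroup.mk' U).comp φ = f.comp p := by
      refine b.ext_hom _ _ fun i => ?_
      have e : φ (b i) = Quotient.out (f (p (b i))) := by simp [φ]
      rw [MonoidHom.comp_apply, e]
      exact QuotientGroup.out_eq' _
    exact fun x => DFunLike.congr_fun this x
  -- As `f` kills `Kₙ`, it takes the same value on `x` and on `p (s x)`.
  have hφs : ∀ x, (φ (s x) : Unitri k ⧸ U) = f x := by
    intro x
    rw [hφ, map_eq_of_mk_eq f (map_eq_one_of_quotient hk1 hkn f) (hs.apply_section x)]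
  let C : Simplex S 0 → Unitri k := fun v => Quotient.out (c v)
  have hC : ∀ v, (C v : Unitri k ⧸ U) = c v := fun v => QuotientGroup.out_eq' _
  let P : Simplex S 1 → Unitri k := fun σ => C (S.δ 1 σ) * φ (s (l σ)) * (C (S.δ 0 σ))⁻¹
  -- The matrix cochain is `P` up to central factors `N`, and `P` fails to be multiplicative by the
  -- values of `φ` on the defect of `s`.
  obtain ⟨N, hN, hPN⟩ : ∃ N : Simplex S 1 → Unitri k, (∀ σ, N σ ∈ U) ∧
      ∀ σ, systemUnitri a σ = P σ * N σ := by
    refine ⟨fun σ => (P σ)⁻¹ * systemUnitri a σ, fun σ => QuotientGroup.eq.1 ?_, fun σ => by simp⟩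
    rw [hf σ, QuotientGroup.mk_mul, QuotientGroup.mk_mul, QuotientGroup.mk_inv, hφs, hC, hC]
  refine ⟨φ, fun σ => corner (N σ),
    fun i v => Multiplicative.toAdd (superdiag i (C v)), fun σ => ?_, fun i σ => ?_⟩
  · have ho : s (l (S.δ 2 σ)) * s (l (S.δ 0 σ)) * (s (l (S.δ 1 σ)))⁻¹ ∈ lcs F n := by
      rw [hl.mul σ]; exact hs.defect_mem _ _
    set o := φ (s (l (S.δ 2 σ)) * s (l (S.δ 0 σ)) * (s (l (S.δ 1 σ)))⁻¹) with ho'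
    have hoU : o ∈ U := map_mem_unitriSubgroup φ hk1 (lcs_antitone hkn ho)
    have hP : P (S.δ 2 σ) * P (S.δ 0 σ) = P (S.δ 1 σ) * o := by
      rw [(commute_of_mem_unitriSubgroup (P (S.δ 1 σ)) hoU).eq]
      have h1 := commute_of_mem_unitriSubgroup (C (S.δ 1 (S.δ 1 σ))) hoU
      simp only [P]
      rw [face_one_face_two, face_zero_face_two, face_zero_face_one, ← mul_assoc o, ← mul_assoc o,
        ← h1.eq, ho', map_mul, map_mul, map_inv]
      group
    have key : systemUnitri a (S.δ 2 σ) * systemUnitri a (S.δ 0 σ) =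
        P (S.δ 1 σ) * (o * N (S.δ 2 σ) * N (S.δ 0 σ)) := by
      rw [hPN, hPN, mul_assoc, ← mul_assoc (N _),
        ← (commute_of_mem_unitriSubgroup (P (S.δ 0 σ)) (hN (S.δ 2 σ))).eq]
      simp only [← mul_assoc]
      rw [hP]
    have h1 : corner (systemUnitri a (S.δ 1 σ)) = 0 := corner_systemUnitri hk1 a _
    rw [hPN, corner_mul_of_mem hk1 _ (hN _)] at h1
    rw [← (mat_systemUnitri_mul hk1 ha σ).2, key,
      corner_mul_of_mem hk1 _ (mul_mem (mul_mem hoU (hN _)) (hN _)),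
      corner_mul_of_mem hk1 _ (hN _), corner_mul_of_mem hk1 _ (hN _), coboundary_apply_one,
      defectCochain, cornerHom_gradedClass]
    linarith
  · have hc : ¬(i.castSucc = 0 ∧ i.succ = Fin.last k) := by
      rintro ⟨h1, h2⟩
      rw [Fin.ext_iff] at h1 h2
      simp at h1 h2
      omega
    have h2 := congrArg (fun u => Multiplicative.toAdd (superdiag i u)) (hPN σ)
    have h3 : Multiplicative.toAdd (superdiag i (N σ)) = 0 := by
      have := mem_unitriSubgroup_iff.1 (hN σ) i.castSucc i.succ (by simp; omega)
      rwa [Matrix.sub_apply, Matrix.one_apply_ne (Fin.castSucc_lt_succ).ne, sub_zero] at this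
    simp only [P, map_mul, map_inv, toAdd_mul, toAdd_inv, h3] at h2
    rw [superdiag_apply, toAdd_ofAdd, mat_systemUnitri a σ (Fin.castSucc_lt_succ) hc] at h2
    rw [coboundary_apply_zero]
    dsimp only
    linarith

/-- The cochains given by the entries of a representation of the free group. -/
def entryCochain {k : ℕ} (φ : F →* Unitri k) (s : K → F) (l : Simplex S 1 → K)
    (i j : Fin (k + 1)) : Cochain S 1 :=
  fun σ => -(φ (s (l σ))).mat i j

lemma coboundary_entryCochain (hl : IsLabel S l) (hs : IsSectionMod n p s) (hn : 1 ≤ n) {k : ℕ}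
    (φ : F →* Unitri k) {i j : Fin (k + 1)} (hij : i < j) (h : j.val < i.val + n) :
    coboundary S 1 (entryCochain φ s l i j) =
      ∑ m ∈ Finset.Ioo i j, cup₁₁ (entryCochain φ s l i m) (entryCochain φ s l m j) := by
  funext σ
  rw [coboundary_apply_one, Finset.sum_apply]
  simp only [cup₁₁_apply, entryCochain, neg_mul_neg]
  have ho := hs.defect_mem (l (S.δ 2 σ)) (l (S.δ 0 σ))
  rw [← hl.mul σ] at ho
  set u := φ (s (l (S.δ 2 σ))) with hu
  set v := φ (s (l (S.δ 0 σ))) with hv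
  set w := φ (s (l (S.δ 1 σ))) with hw
  set o := φ (s (l (S.δ 2 σ)) * s (l (S.δ 0 σ)) * (s (l (S.δ 1 σ)))⁻¹) with ho'
  have e : o * w = u * v := by
    rw [ho', hw, ← map_mul, inv_mul_cancel_right, map_mul]
  have h1 : (u * v).mat i j = w.mat i j := by
    have e1 : (u * v).mat - w.mat = (o.mat - 1) * w.mat := by
      rw [← e, mat_mul, sub_mul, one_mul]
    have h2 := mul_mem_band (mem_unitriSubgroup_iff.1 (map_mem_unitriSubgroup φ hn ho))
      (mat_mem_band w)
    rw [add_zero] at h2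
    have h3 := h2 i j h
    rwa [← e1, Matrix.sub_apply, sub_eq_zero] at h3
  rw [mat_mul_apply u v hij] at h1
  linarith

/-- The cochain of a Massey product is a cocycle. -/
lemma masseyCochain_mem_cocycles (hl : IsLabel S l) {ι : Type w} (b : FreeGroupBasis ι F)
    (hs : IsSectionMod n p s) {k : ℕ} (hk : 2 ≤ k) (hkn : k ≤ n) {α : Fin k → Cohomology S 1}
    {a : Fin (k + 1) → Fin (k + 1) → Cochain S 1} (ha : IsDefiningSystem α a) :
    masseyCochain a ∈ cocycles S 2 := by
  obtain ⟨φ, e, g, h, -⟩ := exists_representation hl b hs hk hkn ha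
  have h' : masseyCochain a =
      (fun σ => cornerHom (by omega) hkn φ (defectCochain hl hs σ)) + coboundary S 1 e :=
    funext h
  rw [h']
  refine add_mem ?_ (coboundary_mem_cocycles _)
  change coboundary S 2 _ = 0
  rw [coboundary_eq_coboundaryOf]
  funext σ
  have h := congrFun (coboundaryOf_defectCochain hl hs) σ
  have e : coboundaryOf (fun σ => cornerHom (by omega) hkn φ (defectCochain hl hs σ)) σ =
      cornerHom (by omega) hkn φ (coboundaryOf (defectCochain hl hs) σ) := by
    simp [coboundaryOf, map_sum]
  rw [e, h, Pi.zero_apply, map_zero]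
  rfl

variable {H : Type u} [AddCommGroup H] {q : K →* Multiplicative H}

lemma cohomologyClass_entryCochain (hl : IsLabel S l) (hs : IsSectionMod n p s) (hn : 2 ≤ n)
    {k : ℕ} {φ : F →* Unitri k} {ξ : Fin k → H →+ ℤ}
    (hφ : ∀ i x, Multiplicative.toAdd (superdiag i (φ x)) = ξ i (Multiplicative.toAdd (q (p x))))
    (i : Fin k) : ∃ h : entryCochain φ s l i.castSucc i.succ ∈ cocycles S 1,
      cohomologyClass 1 ⟨entryCochain φ s l i.castSucc i.succ, h⟩ = labelClass hl q (ξ i) := by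
  have e : entryCochain φ s l i.castSucc i.succ =
      fun σ => -ξ i (Multiplicative.toAdd (q (l σ))) := by
    funext σ
    have h1 := hφ i (s (l σ))
    rw [superdiag_apply, toAdd_ofAdd] at h1
    rw [entryCochain, h1, map_eq_of_mk_eq q (map_eq_one_of_comm hn q) (hs.apply_section (l σ))]
  have h : entryCochain φ s l i.castSucc i.succ ∈ cocycles S 1 := by
    rw [e]
    change coboundary S 1 _ = 0
    funext σ
    rw [coboundary_apply_one, hl.mul σ, map_mul, toAdd_mul, map_add, Pi.zero_apply]
    abel
  exact ⟨h, congrArg (cohomologyClass 1) (Subtype.ext e)⟩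

/-- The entries of a representation form a defining system. -/
lemma isDefiningSystem_entryCochain (hl : IsLabel S l) (hs : IsSectionMod n p s) (hn : 2 ≤ n)
    {k : ℕ} (hkn : k ≤ n) {φ : F →* Unitri k} {ξ : Fin k → H →+ ℤ}
    (hφ : ∀ i x, Multiplicative.toAdd (superdiag i (φ x)) = ξ i (Multiplicative.toAdd (q (p x)))) :
    IsDefiningSystem (fun i => labelClass hl q (ξ i)) (entryCochain φ s l) := by
  refine ⟨cohomologyClass_entryCochain hl hs hn hφ,
    fun i j hij hc => coboundary_entryCochain hl hs (by omega) φ hij ?_⟩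
  rw [Fin.lt_def] at hij
  by_contra h'
  refine hc ⟨Fin.ext ?_, Fin.ext ?_⟩
  · simp only [Fin.val_zero]; omega
  · simp only [Fin.val_last]; omega

lemma kronecker_eq_of_cochain (hl : IsLabel S l) (hs : IsSectionMod n p s) {z : Cochain S 2}
    (hz : z ∈ cocycles S 2) {f : GradedQuotient F n →+ ℤ} {e : Cochain S 1}
    (h : ∀ σ, z σ = f (defectCochain hl hs σ) + coboundary S 1 e σ) (c : Homology S 2) :
    kronecker 2 (cohomologyClass 2 ⟨z, hz⟩) c = f (defectHom hl hs c) := by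
  obtain ⟨c, rfl⟩ := cycleClass_surjective 1 c
  rw [kronecker_cycleClass, defectHom, homologyEval_cycleClass, ← evalChain_comp]
  have e1 : evalChain z = evalChain (fun σ => f (defectCochain hl hs σ)) +
      evalChain (coboundaryOf e) := by
    ext σ
    rw [← coboundary_eq_coboundaryOf]
    simp [evalChain_single, h σ]
  change evalChain z c.1 = _
  rw [e1, AddMonoidHom.add_apply, ← evalChain_boundary, c.2, map_zero, add_zero]

/-- A class in `H²(S)` is determined by its values on `H₂(S)`. -/
lemma cohomology_ext (hl : IsLabel S l) {ι : Type w} (b : FreeGroupBasis ι F)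
    (hs : IsSectionMod n p s) (hn : 2 ≤ n) {β β' : Cohomology S 2}
    (h : ∀ c, kronecker 2 β c = kronecker 2 β' c) : β = β' := by
  obtain ⟨z, rfl⟩ := QuotientAddGroup.mk_surjective β
  obtain ⟨z', rfl⟩ := QuotientAddGroup.mk_surjective β'
  obtain ⟨e, he⟩ := exists_coboundaryOf_eq hl b hs hn (z'.1 - z.1) (by
    intro c hc
    have h1 := h (cycleClass 1 ⟨c, hc⟩)
    have e1 : evalChain (z'.1 - z.1) = evalChain z'.1 - evalChain z.1 := by
      ext σ
      simp [evalChain_single]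
    rw [e1, AddMonoidHom.sub_apply, sub_eq_zero]
    exact ((kronecker_cycleClass z' _).symm.trans h1.symm).trans (kronecker_cycleClass z _))
  exact (cohomologyClass_eq_iff z z').2 ⟨e, by rw [coboundary_eq_coboundaryOf, he]⟩

end MasseyRepresentation


/-! ### Massey products and the obstruction class -/

section MasseyValues

variable {S : SSet.{u}} {K : Type u} [Group K] {l : Simplex S 1 → K}
  {F : Type v} [Group F] {p : F →* K} {n : ℕ} {s : K → F}
  {H : Type u} [AddCommGroup H] {q : K →* Multiplicative H}
  {ι : Type w} (b : FreeGroupBasis ι F)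

lemma IsAbelianization.comp (hq : IsAbelianization q) (hp : IsNEquivalence 2 p) :
    IsAbelianization (q.comp p) := by
  rw [isNEquivalence_iff] at hp
  refine ⟨fun h => ?_, fun x hx => hp.1 x (hq.mem_lcs _ hx)⟩
  obtain ⟨k, rfl⟩ := hq.surjective h
  obtain ⟨f, hf⟩ := hp.2 k
  have := map_eq_one_of_comm le_rfl q _ hf
  rw [map_mul, map_inv, inv_mul_eq_one] at this
  exact ⟨f, this⟩

/-- The homomorphism `θ : H₂(S) → Lₙ(H)` that corresponds to the obstruction class under the
isomorphism `Lₙ(H) ≅ Fₙ/Fₙ₊₁`. -/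
noncomputable def obstructionHom (hq : IsAbelianization (q.comp p)) (hn : 1 ≤ n) (hl : IsLabel S l)
    (hs : IsSectionMod n p s) : Homology S 2 →+ freeLieDegree H n :=
  (AddEquiv.ofBijective _ (hq.degreeMap_bijective b hn)).symm.toAddMonoidHom.comp (defectHom hl hs)

lemma degreeMap_obstructionHom (hq : IsAbelianization (q.comp p)) (hn : 1 ≤ n) (hl : IsLabel S l)
    (hs : IsSectionMod n p s) (c : Homology S 2) :
    degreeMap hq.degreeOneMap n (obstructionHom b hq hn hl hs c) = defectHom hl hs c :=
  (AddEquiv.ofBijective _ (hq.degreeMap_bijective b hn)).apply_symm_apply _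

include b

/-- A representation of the free group with prescribed superdiagonal provides a defining system. -/
lemma massey_nonempty (hl : IsLabel S l) (hs : IsSectionMod n p s) (hq : IsAbelianization q)
    {k : ℕ} (hk : 2 ≤ k) (hkn : k ≤ n) (α : Fin k → Cohomology S 1) : (massey α).Nonempty := by
  choose ξ hξ using fun i => labelClass_surjective hl hq (α i)
  obtain rfl : (fun i => labelClass hl q (ξ i)) = α := funext hξ
  obtain ⟨φ, hφ⟩ := exists_superdiag_comp_eq b fun i =>
    ((AddMonoidHom.toMultiplicative (ξ i)).comp q).comp p
  have ha := isDefiningSystem_entryCochain hl hs (by omega) hkn (φ := φ) (ξ := ξ) (q := q)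
    fun i x => by rw [hφ]; rfl
  exact ⟨_, _, ha, masseyCochain_mem_cocycles hl b hs hk hkn ha, rfl⟩

/-- A representation by unitriangular matrices of size `k + 1 ≤ n` is trivial on `Fₙ`, hence on the
obstruction class. -/
lemma kronecker_massey_of_lt (hl : IsLabel S l) (hs : IsSectionMod n p s) {k : ℕ} (hk : 2 ≤ k)
    (hkn : k < n) {α : Fin k → Cohomology S 1} {β : Cohomology S 2} (hβ : β ∈ massey α)
    (c : Homology S 2) : kronecker 2 β c = 0 := by
  obtain ⟨a, ha, h, rfl⟩ := hβ
  obtain ⟨φ, e, g, h1, -⟩ := exists_representation hl b hs hk hkn.le ha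
  rw [kronecker_eq_of_cochain hl hs h h1]
  obtain ⟨x, hx, hx'⟩ := gradedClass_surjective (defectHom hl hs c)
  rw [← hx', cornerHom_gradedClass,
    eq_one_of_mem_unitriSubgroup hkn (map_mem_unitriSubgroup φ (by omega) hx),
    corner_one (by omega)]

/-- The values of a Massey product of length `n` on `H₂(S)`. -/
lemma kronecker_massey (hl : IsLabel S l) (hs : IsSectionMod n p s) (hq : IsAbelianization q)
    (hqp : IsAbelianization (q.comp p)) (hn : 2 ≤ n) {ξ : Fin n → H →+ ℤ} {β : Cohomology S 2}
    (hβ : β ∈ massey fun i => labelClass hl q (ξ i)) (c : Homology S 2) :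
    kronecker 2 β c =
      contraction ξ (toTensor (obstructionHom b hqp (by omega) hl hs c).1) := by
  obtain ⟨a, ha, h, rfl⟩ := hβ
  obtain ⟨φ, e, g, h1, h2⟩ := exists_representation hl b hs hn le_rfl ha
  rw [kronecker_eq_of_cochain hl hs h h1, ← degreeMap_obstructionHom b hqp (by omega) hl hs]
  -- The superdiagonal entries of `φ` are the functionals `ξ i`, because both give the class of the
  -- cocycle `a i.castSucc i.succ`.
  have key : ∀ i x, ξ i (Multiplicative.toAdd (q (p x))) =
      Multiplicative.toAdd (superdiag i (φ x)) := by
    intro i x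
    have hχ := map_eq_one_of_comm hn ((superdiag i).comp φ)
    obtain ⟨η, hη⟩ := hq.exists_lift (MonoidHom.mk' (fun k => superdiag i (φ (s k)))
      (hs.map_mul ((superdiag i).comp φ) hχ))
    have e1 : labelClass hl q η = labelClass hl q (ξ i) := by
      obtain ⟨h3, h4⟩ := ha.1 i
      refine Eq.trans ?_ h4
      refine (cohomologyClass_eq_iff _ _).2 ⟨g i, funext fun σ => ?_⟩
      simp only [Pi.sub_apply]
      rw [h2, hη]
      change _ = -Multiplicative.toAdd (superdiag i (φ (s (l σ)))) + _ -
        -Multiplicative.toAdd (superdiag i (φ (s (l σ))))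
      ring
    rw [← labelClass_injective hl hq e1, hη]
    exact congrArg Multiplicative.toAdd
      (map_eq_of_mk_eq ((superdiag i).comp φ) hχ (hs.section_apply x))
  refine cornerHom_degreeMap _ (fun h => ?_) _
  obtain ⟨x, rfl, hx⟩ := hqp.exists_degreeOneMap_eq h
  exact ⟨x, hx, fun i => key i x⟩

lemma massey_eq_zero_of_lt (hl : IsLabel S l) (hs : IsSectionMod n p s) (hq : IsAbelianization q)
    {k : ℕ} (hk : 2 ≤ k) (hkn : k < n) (α : Fin k → Cohomology S 1) : massey α = {0} := by
  rw [Set.eq_singleton_iff_nonempty_unique_mem]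
  refine ⟨massey_nonempty b hl hs hq hk hkn.le α, fun β hβ => ?_⟩
  refine cohomology_ext hl b hs (by omega) fun c => ?_
  rw [kronecker_massey_of_lt b hl hs hk hkn hβ, map_zero, AddMonoidHom.zero_apply]

/-- The homomorphism `θ` determines the Massey products of length `n`. -/
lemma mem_massey_iff (hl : IsLabel S l) (hs : IsSectionMod n p s) (hq : IsAbelianization q)
    (hqp : IsAbelianization (q.comp p)) (hn : 2 ≤ n) (ξ : Fin n → H →+ ℤ) (β : Cohomology S 2) :
    β ∈ massey (fun i => labelClass hl q (ξ i)) ↔ ∀ c, kronecker 2 β c =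
      contraction ξ (toTensor (obstructionHom b hqp (by omega) hl hs c).1) := by
  refine ⟨kronecker_massey b hl hs hq hqp hn, fun h => ?_⟩
  obtain ⟨β', hβ'⟩ := massey_nonempty b hl hs hq hn le_rfl fun i => labelClass hl q (ξ i)
  obtain rfl : β = β' := cohomology_ext hl b hs hn fun c => by
    rw [h, kronecker_massey b hl hs hq hqp hn hβ']
  exact hβ'

lemma existsUnique_mem_massey (hl : IsLabel S l) (hs : IsSectionMod n p s)
    (hq : IsAbelianization q) (hqp : IsAbelianization (q.comp p)) (hn : 2 ≤ n)
    (α : Fin n → Cohomology S 1) : ∃! β, β ∈ massey α := by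
  choose ξ hξ using fun i => labelClass_surjective hl hq (α i)
  obtain rfl : (fun i => labelClass hl q (ξ i)) = α := funext hξ
  obtain ⟨β, hβ⟩ := massey_nonempty b hl hs hq hn le_rfl fun i => labelClass hl q (ξ i)
  refine ⟨β, hβ, fun β' hβ' => cohomology_ext hl b hs hn fun c => ?_⟩
  rw [kronecker_massey b hl hs hq hqp hn hβ', kronecker_massey b hl hs hq hqp hn hβ]

omit b in
/-- The homomorphisms from `Lₙ(H)` to `Fₙ/Fₙ₊₁` and to `Kₙ/Kₙ₊₁` are compatible. -/
lemma gradedQuotientMap_degreeMap (hq : IsAbelianization q) (hqp : IsAbelianization (q.comp p))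
    (hn : 1 ≤ n) (z : freeLieDegree H n) :
    gradedQuotientMap p n (degreeMap hqp.degreeOneMap n z) = degreeMap hq.degreeOneMap n z := by
  refine DFunLike.congr_fun (f := (gradedQuotientMap p n).comp (degreeMap hqp.degreeOneMap n))
    (freeLieDegree_hom_ext fun h => ?_) z
  choose f hf hf' using fun i => hqp.exists_degreeOneMap_eq (h i)
  rw [AddMonoidHom.comp_apply, degreeMap_bracketElt hn hf', gradedQuotientMap_commutatorClass,
    degreeMap_bracketElt hn (g := fun i => p (f i)) fun i => ?_]
  rw [← hf i]
  exact hq.degreeOneMap_apply _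

lemma exact_obstructionHom (hl : IsLabel S l) (hs : IsSectionMod n p s) (hq : IsAbelianization q)
    (hqp : IsAbelianization (q.comp p)) (hn : 2 ≤ n) :
    Function.Exact (obstructionHom b hqp (by omega) hl hs) (degreeMap hq.degreeOneMap n) := by
  intro z
  rw [← gradedQuotientMap_degreeMap hq hqp (by omega)]
  constructor
  · intro hz
    obtain ⟨c, hc⟩ := mem_range_defectHom hl b hs hn hz
    refine ⟨c, (hqp.degreeMap_bijective b (by omega)).1 ?_⟩
    rw [degreeMap_obstructionHom, hc]
  · rintro ⟨c, rfl⟩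
    rw [degreeMap_obstructionHom, gradedQuotientMap_defectHom]

/-- If all Massey products of length less than `n` contain zero, then the obstruction classes
vanish one after the other. -/
lemma isNEquivalence_of_weaklyVanishing (hl : IsLabel S l) (hq : IsAbelianization q)
    (hp : IsNEquivalence 2 p) (hn : 2 ≤ n) (h : HasWeaklyVanishingMassey S n) :
    IsNEquivalence n p := by
  induction n, hn using Nat.le_induction with
  | base => exact hp
  | succ k hk ih =>
    have hk' := ih fun j h1 h2 => h j h1 (by omega)
    obtain ⟨s, hs⟩ := exists_isSectionMod hk'
    have hqp := hq.comp hp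
    have hθ : ∀ c, obstructionHom b hqp (by omega) hl hs c = 0 := by
      refine fun c => hqp.eq_zero_of_contraction b fun ξ => ?_
      rw [← kronecker_massey b hl hs hq hqp hk (h k hk (by omega) _), map_zero,
        AddMonoidHom.zero_apply]
    have hsurj : Function.Surjective (gradedQuotientMap p k) := by
      intro x
      obtain ⟨z, rfl⟩ := degreeMap_surjective (n := k) (by omega) hq.degreeOneMap_surjective x
      exact ⟨_, gradedQuotientMap_degreeMap hq hqp (by omega) z⟩
    refine isNEquivalence_succ hk' ⟨(injective_iff_map_eq_zero _).2 fun x hx => ?_, hsurj⟩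
    obtain ⟨c, rfl⟩ := mem_range_defectHom hl b hs hk hx
    rw [← degreeMap_obstructionHom b hqp (by omega), hθ, map_zero]

end MasseyValues

/-! ### The cyclicity relation -/

section Cyclicity

variable {S : SSet.{u}} {K : Type u} [Group K] {l : Simplex S 1 → K}
  {F : Type v} [Group F] {p : F →* K} {n : ℕ} {s : K → F}
  {H : Type u} [AddCommGroup H] {q : K →* Multiplicative H}

/-- The two ways of decomposing the sum of `x j * y j k * t k` over all `0 < j < k < n + 1`. -/
lemma sum_Ioo_triple (hn : 2 ≤ n) (x t : Fin (n + 2) → ℤ) (y : Fin (n + 2) → Fin (n + 2) → ℤ) :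
    ∑ k ∈ Finset.Ioo 1 (Fin.last n).castSucc,
        ((∑ j ∈ Finset.Ioo 0 k, x j * y j k) * t k -
          x k * ∑ j ∈ Finset.Ioo k (Fin.last (n + 1)), y k j * t j) =
      x 1 * ∑ k ∈ Finset.Ioo 1 (Fin.last (n + 1)), y 1 k * t k -
        (∑ j ∈ Finset.Ioo 0 (Fin.last n).castSucc, x j * y j (Fin.last n).castSucc) *
          t (Fin.last n).castSucc := by
  have hsplit : Finset.Ioo 0 (Fin.last (n + 1)) =
      insert 1 (insert (Fin.last n).castSucc (Finset.Ioo 1 (Fin.last n).castSucc)) := by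
    ext j
    simp only [Finset.mem_Ioo, Finset.mem_insert, Fin.lt_def, Fin.ext_iff, Fin.val_zero,
      Fin.val_last, Fin.val_castSucc, Fin.val_one]
    omega
  have h1 : (1 : Fin (n + 2)) ∉
      insert (Fin.last n).castSucc (Finset.Ioo 1 (Fin.last n).castSucc) := by
    simp only [Finset.mem_insert, Finset.mem_Ioo, lt_self_iff_false, false_and, or_false,
      Fin.ext_iff, Fin.val_one, Fin.val_castSucc, Fin.val_last]
    omega
  have h2 : (Fin.last n).castSucc ∉ Finset.Ioo 1 (Fin.last n).castSucc := by simp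
  have hA : ∑ k ∈ Finset.Ioo 0 (Fin.last (n + 1)), ∑ j ∈ Finset.Ioo 0 k, x j * y j k * t k =
      ∑ j ∈ Finset.Ioo 0 (Fin.last (n + 1)), ∑ k ∈ Finset.Ioo j (Fin.last (n + 1)),
        x j * y j k * t k := by
    refine Finset.sum_comm' fun k j => ?_
    simp only [Finset.mem_Ioo]
    constructor
    · rintro ⟨⟨h1, h2⟩, h3, h4⟩
      exact ⟨⟨h4, h2⟩, h3, h4.trans h2⟩
    · rintro ⟨⟨h1, h2⟩, h3, h4⟩
      exact ⟨⟨h3.trans h1, h2⟩, h3, h1⟩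
  have h01 : Finset.Ioo 0 (1 : Fin (n + 2)) = ∅ := by
    ext j
    simp only [Finset.mem_Ioo, Fin.lt_def, Fin.val_zero, Fin.val_one, Finset.notMem_empty,
      iff_false]
    omega
  have hnl : Finset.Ioo (Fin.last n).castSucc (Fin.last (n + 1)) = ∅ := by
    ext j
    simp only [Finset.mem_Ioo, Fin.lt_def, Fin.val_castSucc, Fin.val_last, Finset.notMem_empty,
      iff_false]
    omega
  rw [hsplit, Finset.sum_insert h1, Finset.sum_insert h2, Finset.sum_insert h1,
    Finset.sum_insert h2, h01, hnl, Finset.sum_empty, Finset.sum_empty] at hA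
  rw [Finset.sum_sub_distrib]
  simp only [Finset.mul_sum, Finset.sum_mul, ← mul_assoc]
  linarith

lemma cup₁₁_frontFace (a b : Cochain S 1) (σ : Simplex S 3) :
    cup₁₁ a b (frontFace 2 (by omega) σ) =
      a (frontFace 1 (by omega) σ) * b (backFace 1 1 rfl (frontFace 2 (by omega) σ)) := by
  rw [← face_last_frontFace (p := 1) (n := 3) (by omega) σ, cup₁₁_apply,
    ← face_zero_backFace (p := 0) (q := 1) (n := 2) rfl (frontFace 2 (by omega) σ)]
  congr 3
  rw [backFace, show SimplexCategory.subinterval (n := 2) 0 2 (by omega) = 𝟙 _ from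
    hom_ext_val _ _ fun x => by rw [subinterval_val]; rfl]
  simp

lemma cup₁₁_backFace (a b : Cochain S 1) (σ : Simplex S 3) :
    cup₁₁ a b (backFace 1 2 rfl σ) =
      a (backFace 1 1 rfl (frontFace 2 (by omega) σ)) * b (backFace 2 1 rfl σ) := by
  rw [cup₁₁_apply, face_zero_backFace (p := 1) (q := 1) (n := 3) rfl σ]
  congr 2
  have e : S.map (SimplexCategory.subinterval (n := 2) 1 1 (by omega)).op
      (S.map (SimplexCategory.subinterval (n := 3) 0 2 (by omega)).op σ) =
      S.map (SimplexCategory.subinterval (n := 3) 1 1 (by omega)).op σ := by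
    rw [← Functor.map_comp_apply, ← op_comp]
    congr 2
  refine Eq.trans ?_ e.symm
  refine face_map_eq _ _ _ (hom_ext_val _ _ fun x => ?_) σ
  simp only [SimplexCategory.comp_toOrderHom, OrderHom.comp_coe, Function.comp_apply,
    subinterval_val, delta_val]
  have := x.isLt
  unfold skip
  split_ifs <;> simp at * <;> omega

lemma cup_sum_left {ι : Type*} (A : Finset ι) (x y : ι → Cochain S 1) (t : Cochain S 1)
    (σ : Simplex S 3) : cup (show 2 + 1 = 3 from rfl) (∑ j ∈ A, cup₁₁ (x j) (y j)) t σ =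
      (∑ j ∈ A, x j (frontFace 1 (by omega) σ) *
        y j (backFace 1 1 rfl (frontFace 2 (by omega) σ))) * t (backFace 2 1 rfl σ) := by
  change (∑ j ∈ A, cup₁₁ (x j) (y j)) (frontFace 2 _ σ) * _ = _
  rw [Finset.sum_apply]
  simp_rw [cup₁₁_frontFace]

lemma cup_sum_right {ι : Type*} (A : Finset ι) (x : Cochain S 1) (y t : ι → Cochain S 1)
    (σ : Simplex S 3) : cup (show 1 + 2 = 3 from rfl) x (∑ j ∈ A, cup₁₁ (y j) (t j)) σ =
      x (frontFace 1 (by omega) σ) * ∑ j ∈ A, y j (backFace 1 1 rfl (frontFace 2 (by omega) σ)) *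
        t j (backFace 2 1 rfl σ) := by
  change _ * (∑ j ∈ A, cup₁₁ (y j) (t j)) (backFace 1 2 _ σ) = _
  rw [Finset.sum_apply]
  simp_rw [cup₁₁_backFace]

variable {ι : Type w} (b : FreeGroupBasis ι F)

include b

/-- The cyclicity relation for Massey products of length `n`. -/
lemma cupProduct_massey (hl : IsLabel S l) (hs : IsSectionMod n p s) (hq : IsAbelianization q)
    (hqp : IsAbelianization (q.comp p)) (hn : 2 ≤ n) (α : Fin (n + 1) → Cohomology S 1)
    {β β' : Cohomology S 2} (hβ : β ∈ massey fun i : Fin n => α i.castSucc)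
    (hβ' : β' ∈ massey fun i : Fin n => α i.succ) :
    cupProduct (show 1 + 2 = 3 from rfl) (α 0) β' =
      cupProduct (show 2 + 1 = 3 from rfl) β (α (Fin.last n)) := by
  choose ξ hξ using fun i => labelClass_surjective hl hq (α i)
  obtain ⟨φ, hφ⟩ := exists_superdiag_comp_eq b fun i =>
    ((AddMonoidHom.toMultiplicative (ξ i)).comp q).comp p
  -- The entries of `φ` form a defining system for `α`, except for the two products of length `n`.
  set a := entryCochain φ s l with ha
  have h1 : ∀ i : Fin (n + 1), ∃ h : a i.castSucc i.succ ∈ cocycles S 1,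
      cohomologyClass 1 ⟨a i.castSucc i.succ, h⟩ = α i := by
    intro i
    rw [← hξ i]
    exact cohomologyClass_entryCochain hl hs hn (q := q) (ξ := ξ) (fun i x => by rw [hφ]; rfl) i
  have h2 : ∀ i j : Fin (n + 2), i < j → j.val < i.val + n →
      coboundary S 1 (a i j) = ∑ k ∈ Finset.Ioo i j, cup₁₁ (a i k) (a k j) :=
    fun i j hij h => coboundary_entryCochain hl hs (by omega) φ hij h
  have hlt : ∀ i j : Fin (n + 1), i < j → ¬(i = 0 ∧ j = Fin.last n) → j.val < i.val + n := by
    intro i j hij hc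
    by_contra h
    refine hc ⟨Fin.ext ?_, Fin.ext ?_⟩
    · simp only [Fin.val_zero]; omega
    · simp only [Fin.val_last]; omega
  have hL : IsDefiningSystem (fun i : Fin n => α i.castSucc)
      fun i j => a i.castSucc j.castSucc := by
    refine ⟨fun i => h1 i.castSucc, fun i j hij hc => ?_⟩
    rw [h2 _ _ (Fin.castSucc_lt_castSucc_iff.2 hij) (hlt i j hij hc), ← Fin.map_castSuccEmb_Ioo,
      Finset.sum_map]
    rfl
  have hR : IsDefiningSystem (fun i : Fin n => α i.succ) fun i j => a i.succ j.succ := by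
    refine ⟨fun i => h1 i.succ, fun i j hij hc => ?_⟩
    rw [h2 _ _ (Fin.succ_lt_succ_iff.2 hij) (by
      have := hlt i j hij hc; simp only [Fin.val_succ]; omega), ← Fin.map_succEmb_Ioo,
      Finset.sum_map]
    rfl
  have zL := masseyCochain_mem_cocycles hl b hs hn le_rfl hL
  have zR := masseyCochain_mem_cocycles hl b hs hn le_rfl hR
  obtain rfl : cohomologyClass 2 ⟨_, zL⟩ = β :=
    (existsUnique_mem_massey b hl hs hq hqp hn _).unique ⟨_, hL, zL, rfl⟩ hβ
  obtain rfl : cohomologyClass 2 ⟨_, zR⟩ = β' :=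
    (existsUnique_mem_massey b hl hs hq hqp hn _).unique ⟨_, hR, zR, rfl⟩ hβ'
  have eL : masseyCochain (fun i j : Fin (n + 1) => a i.castSucc j.castSucc) =
      ∑ j ∈ Finset.Ioo 0 (Fin.last n).castSucc, cup₁₁ (a 0 j) (a j (Fin.last n).castSucc) := by
    rw [show (0 : Fin (n + 2)) = (0 : Fin (n + 1)).castSucc from rfl, ← Fin.map_castSuccEmb_Ioo,
      Finset.sum_map]
    rfl
  have eR : masseyCochain (fun i j : Fin (n + 1) => a i.succ j.succ) =
      ∑ j ∈ Finset.Ioo 1 (Fin.last (n + 1)), cup₁₁ (a 1 j) (a j (Fin.last (n + 1))) := by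
    rw [show (1 : Fin (n + 2)) = (0 : Fin (n + 1)).succ from rfl, ← Fin.succ_last,
      ← Fin.map_succEmb_Ioo, Finset.sum_map]
    rfl
  obtain ⟨c0, e0⟩ := h1 0
  obtain ⟨cn, en⟩ := h1 (Fin.last n)
  rw [← e0, ← en, cupProduct_class, cupProduct_class, eq_comm, cohomologyClass_eq_iff]
  -- The two products of length `n` are the terms that are missing from the defining equation of a
  -- Massey product of length `n + 1`, whose remaining terms give this cochain.
  refine ⟨∑ k ∈ Finset.Ioo 1 (Fin.last n).castSucc, cup₁₁ (a 0 k) (a k (Fin.last (n + 1))), ?_⟩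
  have hδ : ∀ k ∈ Finset.Ioo 1 (Fin.last n).castSucc,
      coboundary S 2 (cup₁₁ (a 0 k) (a k (Fin.last (n + 1)))) =
        cup (show 2 + 1 = 3 from rfl) (∑ j ∈ Finset.Ioo 0 k, cup₁₁ (a 0 j) (a j k))
          (a k (Fin.last (n + 1))) -
        cup (show 1 + 2 = 3 from rfl) (a 0 k)
          (∑ j ∈ Finset.Ioo k (Fin.last (n + 1)), cup₁₁ (a k j) (a j (Fin.last (n + 1)))) := by
    intro k hk
    simp only [Finset.mem_Ioo, Fin.lt_def, Fin.val_one, Fin.val_castSucc, Fin.val_last] at hk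
    rw [coboundary_cup, h2 0 k (by rw [Fin.lt_def, Fin.val_zero]; omega)
        (by rw [Fin.val_zero]; omega),
      h2 k (Fin.last (n + 1)) (by rw [Fin.lt_def]; simp; omega) (by simp; omega), pow_one, neg_smul,
      one_smul, ← sub_eq_add_neg]
  rw [map_sum, Finset.sum_congr rfl hδ]
  funext σ
  dsimp only
  rw [eL, eR, Finset.sum_apply, Pi.sub_apply]
  simp_rw [Pi.sub_apply]
  simp_rw [cup_sum_left, cup_sum_right]
  exact sum_Ioo_triple hn (fun j => a 0 j (frontFace 1 (by omega) σ))
    (fun k => a k (Fin.last (n + 1)) (backFace 2 1 rfl σ))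
    (fun j k => a j k (backFace 1 1 rfl (frontFace 2 (by omega) σ)))

end Cyclicity


/-! ### The labelling of the classifying space of a group -/

section ClassifyingSpace

variable {K : Type u} [Group K]

/-- The label of an edge of `BG` is the inverse of the corresponding group element, because
composition in the category with one object is the opposite of multiplication. -/
def classifyingLabel (K : Type u) [Group K] (σ : Simplex (BG K) 1) : K :=
  (show K from ComposableArrows.hom σ)⁻¹

/-- The edge of `BG` with a given label. -/
def classifyingEdge (g : K) : Simplex (BG K) 1 :=
  ComposableArrows.mk₁ (X₀ := SingleObj.star K) (X₁ := SingleObj.star K) (g⁻¹ : K)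

lemma classifyingLabel_edge (g : K) : classifyingLabel K (classifyingEdge g) = g := inv_inv g

lemma classifyingEdge_label (σ : Simplex (BG K) 1) :
    classifyingEdge (classifyingLabel K σ) = σ := by
  obtain ⟨X₀, X₁, f, hf⟩ := ComposableArrows.mk₁_surjective (C := SingleObj K) σ
  subst hf
  change ComposableArrows.mk₁ (X₀ := SingleObj.star K) (X₁ := SingleObj.star K)
    ((show K from f)⁻¹⁻¹ : K) = _
  rw [inv_inv]

/-- The nerve of `K`, seen as a category with one object, is labelled by `K`. -/
lemma isLabel_classifying (K : Type u) [Group K] : IsLabel (BG K) (classifyingLabel K) where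
  mul σ := by
    have h : (show K from ComposableArrows.map' (C := SingleObj K) (n := 2) σ 0 2) =
        (show K from ComposableArrows.map' (C := SingleObj K) (n := 2) σ 1 2) *
          (show K from ComposableArrows.map' (C := SingleObj K) (n := 2) σ 0 1) :=
      ComposableArrows.map'_comp (C := SingleObj K) (n := 2) σ 0 1 2
    have h' := congrArg (fun g : K => g⁻¹) h
    rw [mul_inv_rev] at h'
    exact h'
  factor_aux E _ w hw := by
    refine ⟨MonoidHom.mk' (fun g => w (classifyingEdge g)) fun g h => ?_, fun _ => 1, fun σ => ?_⟩
    · let τ : Simplex (BG K) 2 := ComposableArrows.mk₂ (X₀ := SingleObj.star K)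
        (X₁ := SingleObj.star K) (X₂ := SingleObj.star K) (g⁻¹ : K) (h⁻¹ : K)
      have h1 : (BG K).δ 1 τ = classifyingEdge (g * h) := by
        refine (nerve.δ₁_mk₂_eq (C := SingleObj K) _ _).trans ?_
        rw [classifyingEdge, mul_inv_rev]
        rfl
      have h2 : (BG K).δ 2 τ = classifyingEdge g := nerve.δ₂_mk₂_eq (C := SingleObj K) _ _
      have h0 : (BG K).δ 0 τ = classifyingEdge h := nerve.δ₀_mk₂_eq (C := SingleObj K) _ _
      have := hw τ
      rwa [h0, h1, h2] at this
    · rw [one_mul, inv_one, mul_one]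
      change w σ = w (classifyingEdge (classifyingLabel K σ))
      rw [classifyingEdge_label]
  exists_loop := by
    refine ⟨ComposableArrows.mk₀ (SingleObj.star K), fun k =>
      ⟨classifyingEdge k, classifyingLabel_edge k, ?_, ?_⟩⟩
    · exact ComposableArrows.ext₀ (C := SingleObj K) rfl
    · exact ComposableArrows.ext₀ (C := SingleObj K) rfl

end ClassifyingSpace


/-! ### Multiplicative functions on singular edges -/

section SingularEdges

variable {X : Type u} [TopologicalSpace X]

/-- The singular simplex given by a continuous map. -/
noncomputable def singSimplex {n : ℕ} (f : C(stdSimplex ℝ (Fin (n + 1)), X)) : Simplex (Sing X) n :=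
  ((TopCat.of X).toSSetObjEquiv (op (SimplexCategory.mk n))).symm f

/-- The continuous map underlying a singular simplex. -/
noncomputable def simplexMap {n : ℕ} (σ : Simplex (Sing X) n) : C(stdSimplex ℝ (Fin (n + 1)), X) :=
  (TopCat.of X).toSSetObjEquiv (op (SimplexCategory.mk n)) σ

lemma simplexMap_singSimplex {n : ℕ} (f : C(stdSimplex ℝ (Fin (n + 1)), X)) :
    simplexMap (singSimplex f) = f := Equiv.apply_symm_apply _ f

lemma simplexMap_injective {n : ℕ} : Function.Injective (simplexMap (X := X) (n := n)) :=
  Equiv.injective _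

lemma simplexMap_face_apply {n : ℕ} (i : Fin (n + 2)) (σ : Simplex (Sing X) (n + 1))
    (t : stdSimplex ℝ (Fin (n + 1))) :
    simplexMap ((Sing X).δ i σ) t = simplexMap σ (stdSimplex.map i.succAbove t) :=
  TopCat.toSSetObjEquiv_δ_apply (X := TopCat.of X) σ i t

/-- The point of `X` given by a singular vertex. -/
noncomputable def vertexPoint (v : Simplex (Sing X) 0) : X := simplexMap v (stdSimplex.vertex 0)

/-- The path traced out by a singular edge. -/
noncomputable def edgePath (σ : Simplex (Sing X) 1) :
    Path (simplexMap σ (stdSimplex.vertex 0)) (simplexMap σ (stdSimplex.vertex 1)) where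
  toFun t := simplexMap σ (stdSimplexHomeomorphUnitInterval.symm t)
  source' := by
    rw [← stdSimplexHomeomorphUnitInterval_zero, Homeomorph.symm_apply_apply]
  target' := by
    rw [← stdSimplexHomeomorphUnitInterval_one, Homeomorph.symm_apply_apply]

lemma simplexMap_pathSimplex {y z : X} (γ : Path y z) (t : stdSimplex ℝ (Fin 2)) :
    simplexMap (pathSimplex γ) t = γ (stdSimplexHomeomorphUnitInterval t) := rfl

lemma pathSimplex_edgePath (σ : Simplex (Sing X) 1) : pathSimplex (edgePath σ) = σ := by
  refine simplexMap_injective (ContinuousMap.ext fun t => ?_)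
  rw [simplexMap_pathSimplex]
  exact congrArg (simplexMap σ) (Homeomorph.symm_apply_apply _ t)

lemma vertexPoint_face_one (σ : Simplex (Sing X) 1) :
    vertexPoint ((Sing X).δ 1 σ) = simplexMap σ (stdSimplex.vertex 0) := by
  rw [vertexPoint, simplexMap_face_apply, stdSimplex.map_vertex]
  rfl

lemma vertexPoint_face_zero (σ : Simplex (Sing X) 1) :
    vertexPoint ((Sing X).δ 0 σ) = simplexMap σ (stdSimplex.vertex 1) := by
  rw [vertexPoint, simplexMap_face_apply, stdSimplex.map_vertex]
  rfl

lemma stdSimplex_map_succAbove_apply {n : ℕ} (i : Fin (n + 2)) (t : stdSimplex ℝ (Fin (n + 1)))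
    (j : Fin (n + 1)) : stdSimplex.map i.succAbove t (i.succAbove j) = t j := by
  rw [stdSimplex.map_coe, FunOnFinite.linearMap_apply_apply, Finset.sum_eq_single j]
  · intro k hk hkj
    simp only [Finset.mem_filter, Finset.mem_univ, true_and] at hk
    exact absurd (Fin.succAbove_right_injective hk) hkj
  · intro h
    simp at h

lemma stdSimplex_map_succAbove_self {n : ℕ} (i : Fin (n + 2)) (t : stdSimplex ℝ (Fin (n + 1))) :
    stdSimplex.map i.succAbove t i = 0 := by
  rw [stdSimplex.map_coe, FunOnFinite.linearMap_apply_apply]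
  refine Finset.sum_eq_zero fun k hk => ?_
  simp only [Finset.mem_filter, Finset.mem_univ, true_and] at hk
  exact absurd hk (Fin.succAbove_ne i k)

section Segment

variable {V : Type} [AddCommGroup V] [Module ℝ V] [TopologicalSpace V] [IsTopologicalAddGroup V]
  [ContinuousSMul ℝ V]

/-- The image of a line segment under a continuous map. -/
def segmentPath (G : C(V, X)) (P Q : V) : Path (G P) (G Q) where
  toFun t := G ((1 - (t : ℝ)) • P + (t : ℝ) • Q)
  source' := by simp
  target' := by simp

variable {E : Type*} [Group E] {w : Simplex (Sing X) 1 → E}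

/-- The three sides of an affine triangle bound a singular simplex. -/
lemma IsMultiplicative.segment (hw : IsMultiplicative w) (G : C(V, X)) (P Q R : V) :
    w (pathSimplex (segmentPath G P R)) =
      w (pathSimplex (segmentPath G P Q)) * w (pathSimplex (segmentPath G Q R)) := by
  let τ : Simplex (Sing X) 2 := singSimplex
    ⟨fun t => G (t 0 • P + t 1 • Q + t 2 • R), G.continuous.comp (by
      have h : ∀ i, Continuous fun t : stdSimplex ℝ (Fin 3) => t i :=
        fun i => (continuous_apply i).comp continuous_subtype_val
      exact (((h 0).smul continuous_const).add ((h 1).smul continuous_const)).add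
        ((h 2).smul continuous_const))⟩
  have hτ : ∀ t, simplexMap τ t = G (t 0 • P + t 1 • Q + t 2 • R) :=
    fun t => DFunLike.congr_fun (simplexMap_singSimplex _) t
  have ht : ∀ t : stdSimplex ℝ (Fin 2), (1 - (stdSimplexHomeomorphUnitInterval t : ℝ)) = t 0 ∧
      (stdSimplexHomeomorphUnitInterval t : ℝ) = t 1 := by
    intro t
    have h1 : (stdSimplexHomeomorphUnitInterval t : ℝ) = t 1 := rfl
    have h2 := stdSimplex.add_eq_one t
    exact ⟨by rw [h1]; linarith, h1⟩
  have h0 : (Sing X).δ 0 τ = pathSimplex (segmentPath G Q R) := by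
    refine simplexMap_injective (ContinuousMap.ext fun t => ?_)
    have e0 := stdSimplex_map_succAbove_self 0 t
    have e1 := stdSimplex_map_succAbove_apply 0 t 0
    have e2 := stdSimplex_map_succAbove_apply 0 t 1
    change stdSimplex.map _ t 1 = _ at e1
    change stdSimplex.map _ t 2 = _ at e2
    rw [simplexMap_face_apply, hτ, e0, e1, e2, simplexMap_pathSimplex]
    change _ = G ((1 - (stdSimplexHomeomorphUnitInterval t : ℝ)) • Q +
      (stdSimplexHomeomorphUnitInterval t : ℝ) • R)
    rw [(ht t).1, (ht t).2, zero_smul, zero_add]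
  have h1 : (Sing X).δ 1 τ = pathSimplex (segmentPath G P R) := by
    refine simplexMap_injective (ContinuousMap.ext fun t => ?_)
    have e0 := stdSimplex_map_succAbove_self 1 t
    have e1 := stdSimplex_map_succAbove_apply 1 t 0
    have e2 := stdSimplex_map_succAbove_apply 1 t 1
    change stdSimplex.map _ t 0 = _ at e1
    change stdSimplex.map _ t 2 = _ at e2
    rw [simplexMap_face_apply, hτ, e0, e1, e2, simplexMap_pathSimplex]
    change _ = G ((1 - (stdSimplexHomeomorphUnitInterval t : ℝ)) • P +
      (stdSimplexHomeomorphUnitInterval t : ℝ) • R)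
    rw [(ht t).1, (ht t).2, zero_smul, add_zero]
  have h2 : (Sing X).δ 2 τ = pathSimplex (segmentPath G P Q) := by
    refine simplexMap_injective (ContinuousMap.ext fun t => ?_)
    have e0 := stdSimplex_map_succAbove_self 2 t
    have e1 := stdSimplex_map_succAbove_apply 2 t 0
    have e2 := stdSimplex_map_succAbove_apply 2 t 1
    change stdSimplex.map _ t 0 = _ at e1
    change stdSimplex.map _ t 1 = _ at e2
    rw [simplexMap_face_apply, hτ, e0, e1, e2, simplexMap_pathSimplex]
    change _ = G ((1 - (stdSimplexHomeomorphUnitInterval t : ℝ)) • P +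
      (stdSimplexHomeomorphUnitInterval t : ℝ) • Q)
    rw [(ht t).1, (ht t).2, zero_smul, add_zero]
  have := hw τ
  rwa [h0, h1, h2] at this

end Segment

variable {E : Type*} [Group E] {w : Simplex (Sing X) 1 → E}

lemma pathSimplex_congr {y z y' z' : X} {γ : Path y z} {γ' : Path y' z'} (h : ∀ t, γ t = γ' t) :
    pathSimplex γ = pathSimplex γ' :=
  simplexMap_injective (ContinuousMap.ext fun _ => h _)

lemma IsMultiplicative.pathSimplex_refl (hw : IsMultiplicative w) (y : X) :
    w (pathSimplex (Path.refl y)) = 1 := by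
  have h := hw.segment (ContinuousMap.const ℝ y) 0 0 0
  have e : pathSimplex (segmentPath (ContinuousMap.const ℝ y) 0 0) = pathSimplex (Path.refl y) :=
    pathSimplex_congr fun _ => rfl
  rwa [e, left_eq_mul] at h

/-- A multiplicative function takes the same value on homotopic paths: the diagonal divides the
square into two triangles. -/
lemma IsMultiplicative.pathSimplex_eq (hw : IsMultiplicative w) {y z : X} {γ γ' : Path y z}
    (h : γ.Homotopic γ') : w (pathSimplex γ) = w (pathSimplex γ') := by
  obtain ⟨T⟩ := h
  let G : C(ℝ × ℝ, X) := ⟨fun s => T (Set.projIcc 0 1 zero_le_one s.1, Set.projIcc 0 1 zero_le_one s.2),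
    T.continuous.comp ((continuous_projIcc.comp continuous_fst).prodMk
      (continuous_projIcc.comp continuous_snd))⟩
  have hG : ∀ s : ℝ × ℝ, G s =
    T (Set.projIcc 0 1 zero_le_one s.1, Set.projIcc 0 1 zero_le_one s.2) := fun s => rfl
  have hI : ∀ t : unitInterval, Set.projIcc (0 : ℝ) 1 zero_le_one t = t := fun t => Set.projIcc_val _ t
  have e1 : pathSimplex (segmentPath G (0, 0) (0, 1)) = pathSimplex γ := by
    refine pathSimplex_congr fun t => ?_
    change G _ = _
    simp [hG, hI]
  have e2 : pathSimplex (segmentPath G (0, 0) (1, 0)) = pathSimplex (Path.refl y) := by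
    refine pathSimplex_congr fun t => ?_
    change G _ = _
    simp [hG]
  have e3 : pathSimplex (segmentPath G (1, 0) (1, 1)) = pathSimplex γ' := by
    refine pathSimplex_congr fun t => ?_
    change G _ = _
    simp [hG, hI]
  have e4 : pathSimplex (segmentPath G (1, 1) (0, 1)) = pathSimplex (Path.refl z) := by
    refine pathSimplex_congr fun t => ?_
    change G _ = _
    simp [hG]
  rw [← e1, hw.segment G (0, 0) (1, 1) (0, 1), hw.segment G (0, 0) (1, 0) (1, 1), e2, e3, e4,
    hw.pathSimplex_refl, hw.pathSimplex_refl, one_mul, mul_one]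

lemma IsMultiplicative.pathSimplex_trans (hw : IsMultiplicative w) {y z z' : X} (γ : Path y z)
    (γ' : Path z z') :
    w (pathSimplex (γ.trans γ')) = w (pathSimplex γ) * w (pathSimplex γ') := by
  let G : C(ℝ, X) := (γ.trans γ').extend
  have hG : ∀ s : unitInterval, G s = (γ.trans γ') s := fun s => Path.extend_apply _ s.2
  have e1 : pathSimplex (segmentPath G 0 1) = pathSimplex (γ.trans γ') := by
    refine pathSimplex_congr fun t => ?_
    rw [← hG]
    change G _ = _
    simp
  have e2 : pathSimplex (segmentPath G 0 (1 / 2)) = pathSimplex γ := by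
    refine pathSimplex_congr fun t => ?_
    change G _ = _
    have ht : (1 - (t : ℝ)) • (0 : ℝ) + (t : ℝ) • (1 / 2 : ℝ) = (t : ℝ) / 2 := by
      simp; ring
    have h1 := t.2.1
    have h2 := t.2.2
    rw [ht]
    refine (hG ⟨(t : ℝ) / 2, by linarith, by linarith⟩).trans ?_
    rw [Path.trans_apply, dif_pos (by simp only; linarith)]
    congr 1
    ext
    simp only; ring
  have e3 : pathSimplex (segmentPath G (1 / 2) 1) = pathSimplex γ' := by
    refine pathSimplex_congr fun t => ?_
    change G _ = _
    have ht : (1 - (t : ℝ)) • (1 / 2 : ℝ) + (t : ℝ) • (1 : ℝ) = (1 + (t : ℝ)) / 2 := by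
      simp; ring
    have h1 := t.2.1
    have h2 := t.2.2
    rw [ht]
    refine (hG ⟨(1 + (t : ℝ)) / 2, by linarith, by linarith⟩).trans ?_
    rw [Path.trans_apply]
    split_ifs with h
    · have h0 : (t : ℝ) = 0 := by simp only at h; linarith
      have h0' : t = 0 := Subtype.ext h0
      subst h0'
      rw [γ'.source]
      refine Eq.trans ?_ γ.target
      congr 1
      ext
      simp
    · congr 1
      ext
      simp only; ring
  rw [← e1, ← e2, ← e3]
  exact hw.segment G 0 (1 / 2) 1

lemma IsMultiplicative.pathSimplex_symm (hw : IsMultiplicative w) {y z : X} (γ : Path y z) :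
    w (pathSimplex γ.symm) = (w (pathSimplex γ))⁻¹ := by
  rw [eq_inv_iff_mul_eq_one, ← hw.pathSimplex_trans,
    hw.pathSimplex_eq ⟨(Path.Homotopy.reflSymmTrans γ).symm⟩, hw.pathSimplex_refl]

/-- The homomorphism from the fundamental group given by a multiplicative function on the
singular edges. It takes a loop to the inverse of its value, because the product in the fundamental
group is opposite to the concatenation of paths. -/
noncomputable def IsMultiplicative.loopHom (hw : IsMultiplicative w) (x : X) :
    FundamentalGroup X x →* E :=
  MonoidHom.mk' (Quotient.lift (fun γ : Path x x => (w (pathSimplex γ))⁻¹)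
    fun _ _ h => congrArg _ (hw.pathSimplex_eq h)) fun g h => by
      induction g using Path.Homotopic.Quotient.ind with | mk γ
      induction h using Path.Homotopic.Quotient.ind with | mk γ'
      change (w (pathSimplex (γ'.trans γ)))⁻¹ = (w (pathSimplex γ))⁻¹ * (w (pathSimplex γ'))⁻¹
      rw [hw.pathSimplex_trans, mul_inv_rev]

lemma IsMultiplicative.loopHom_loopElt (hw : IsMultiplicative w) {x : X} (γ : Path x x) :
    hw.loopHom x (loopElt γ) = (w (pathSimplex γ))⁻¹ := rfl

end SingularEdges

/-! ### The labelling of the singular simplicial set -/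

section SingularLabel

variable {X : Type u} [TopologicalSpace X] [PathConnectedSpace X] (x : X)

/-- A path turned into a loop at the basepoint by means of a fixed choice of paths from the
basepoint to all points. -/
noncomputable def framedLoop {y z : X} (γ : Path y z) : Path x x :=
  ((PathConnectedSpace.somePath x y).trans γ).trans (PathConnectedSpace.somePath x z).symm

/-- The label of a singular edge: the inverse of the class of the loop that it defines. The
inverse is there because the product in the fundamental group is opposite to the concatenation
of paths. -/
noncomputable def singularLabel (σ : Simplex (Sing X) 1) : FundamentalGroup X x :=
  (loopElt (framedLoop x (edgePath σ)))⁻¹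

lemma singularLabel_pathSimplex {y z : X} (γ : Path y z) :
    singularLabel x (pathSimplex γ) = (loopElt (framedLoop x γ))⁻¹ := by
  have key : ∀ {y z y' z' : X} (γ : Path y z) (γ' : Path y' z'), (∀ t, γ t = γ' t) →
      loopElt (framedLoop x γ) = loopElt (framedLoop x γ') := by
    intro y z y' z' γ γ' h
    obtain rfl : y = y' := by rw [← γ.source, h, γ'.source]
    obtain rfl : z = z' := by rw [← γ.target, h, γ'.target]
    obtain rfl : γ = γ' := Path.ext (funext h)
    rfl
  have h : ∀ t, edgePath (pathSimplex γ) t = γ t := by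
    intro t
    change γ (stdSimplexHomeomorphUnitInterval (stdSimplexHomeomorphUnitInterval.symm t)) = _
    rw [Homeomorph.apply_symm_apply]
  rw [singularLabel, key _ _ h]

/-- The class of a path in the fundamental groupoid. -/
abbrev pathClass {y z : X} (γ : Path y z) : FundamentalGroupoid.mk y ⟶ FundamentalGroupoid.mk z :=
  Path.Homotopic.Quotient.mk γ

lemma loopElt_framedLoop {y z : X} (γ : Path y z) : loopElt (framedLoop x γ) =
    (pathClass (PathConnectedSpace.somePath x y) ≫ pathClass γ) ≫
      Groupoid.inv (pathClass (PathConnectedSpace.somePath x z)) := rfl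

lemma loopElt_framedLoop_eq {y z : X} {γ γ' : Path y z} (h : γ.Homotopic γ') :
    loopElt (framedLoop x γ) = loopElt (framedLoop x γ') := by
  rw [loopElt_framedLoop, loopElt_framedLoop,
    show pathClass γ = pathClass γ' from Path.Homotopic.Quotient.eq.2 h]

lemma loopElt_framedLoop_trans {y z z' : X} (γ : Path y z) (γ' : Path z z') :
    loopElt (framedLoop x (γ.trans γ')) =
      loopElt (framedLoop x γ') * loopElt (framedLoop x γ) := by
  rw [End.mul_def, loopElt_framedLoop, loopElt_framedLoop, loopElt_framedLoop,
    show pathClass (γ.trans γ') = pathClass γ ≫ pathClass γ' from rfl]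
  have e : ∀ {W} (f : FundamentalGroupoid.mk z ⟶ W),
      Groupoid.inv (pathClass (PathConnectedSpace.somePath x z)) ≫
        pathClass (PathConnectedSpace.somePath x z) ≫ f = f := by
    intro W f
    rw [← Category.assoc, Groupoid.inv_comp, Category.id_comp]
  simp only [Category.assoc, e]

/-- The edge of the standard triangle from the vertex `i` to the vertex `j`. -/
noncomputable def trianglePath (i j : Fin 3) :
    Path (stdSimplex.vertex (S := ℝ) i) (stdSimplex.vertex (S := ℝ) j) where
  toFun t := stdSimplex.map ![i, j] (stdSimplexHomeomorphUnitInterval.symm t)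
  continuous_toFun := (stdSimplex.continuous_map _).comp (Homeomorph.continuous _)
  source' := by
    rw [← stdSimplexHomeomorphUnitInterval_zero, Homeomorph.symm_apply_apply]
    exact stdSimplex.map_vertex _ _
  target' := by
    rw [← stdSimplexHomeomorphUnitInterval_one, Homeomorph.symm_apply_apply]
    exact stdSimplex.map_vertex _ _

omit [PathConnectedSpace X] in
lemma face_eq_pathSimplex (σ : Simplex (Sing X) 2) {k i j : Fin 3} (h : k.succAbove = ![i, j]) :
    (Sing X).δ k σ = pathSimplex ((trianglePath i j).map (simplexMap σ).continuous) := by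
  refine simplexMap_injective (ContinuousMap.ext fun t => ?_)
  rw [simplexMap_face_apply, simplexMap_pathSimplex, h]
  change _ = simplexMap σ (stdSimplex.map ![i, j] (stdSimplexHomeomorphUnitInterval.symm
    (stdSimplexHomeomorphUnitInterval t)))
  rw [Homeomorph.symm_apply_apply]

lemma trianglePath_homotopic :
    (trianglePath 0 2).Homotopic ((trianglePath 0 1).trans (trianglePath 1 2)) := by
  have : ContractibleSpace (stdSimplex ℝ (Fin 3)) :=
    (convex_stdSimplex ℝ (Fin 3)).contractibleSpace ⟨_, single_mem_stdSimplex ℝ 0⟩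
  exact SimplyConnectedSpace.paths_homotopic _ _

lemma isMultiplicative_singularLabel : IsMultiplicative (singularLabel (X := X) x) := by
  intro σ
  rw [face_eq_pathSimplex σ (k := 0) (i := 1) (j := 2) (by ext i; fin_cases i <;> rfl),
    face_eq_pathSimplex σ (k := 1) (i := 0) (j := 2) (by ext i; fin_cases i <;> rfl),
    face_eq_pathSimplex σ (k := 2) (i := 0) (j := 1) (by ext i; fin_cases i <;> rfl),
    singularLabel_pathSimplex, singularLabel_pathSimplex, singularLabel_pathSimplex, ← mul_inv_rev]
  congr 1
  have h := trianglePath_homotopic.map (simplexMap σ)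
  rw [Path.map_trans] at h
  rw [loopElt_framedLoop_eq x h, loopElt_framedLoop_trans]

/-- The singular simplicial set of a path-connected space is labelled by the fundamental group. -/
lemma isLabel_singular : IsLabel (Sing X) (singularLabel x) where
  mul := isMultiplicative_singularLabel x
  factor_aux E _ w hw := by
    refine ⟨hw.loopHom x, fun v => (w (pathSimplex
      (PathConnectedSpace.somePath x (vertexPoint v))))⁻¹, fun σ => ?_⟩
    dsimp only
    rw [vertexPoint_face_one, vertexPoint_face_zero, singularLabel, map_inv,
      hw.loopHom_loopElt, framedLoop, hw.pathSimplex_trans, hw.pathSimplex_trans,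
      hw.pathSimplex_symm, pathSimplex_edgePath]
    group
  exists_loop := by
    -- Conjugating by the chosen loop at `x` compensates for the framing.
    let a : FundamentalGroup X x := loopElt (PathConnectedSpace.somePath x x)
    refine ⟨singSimplex (ContinuousMap.const _ x), fun k => ?_⟩
    obtain ⟨γ, hγ⟩ := Path.Homotopic.Quotient.mk_surjective (a * k⁻¹ * a⁻¹)
    refine ⟨pathSimplex γ, ?_, simplexMap_injective (face_pathSimplex γ 1),
      simplexMap_injective (face_pathSimplex γ 0)⟩
    rw [singularLabel_pathSimplex, inv_eq_iff_eq_inv]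
    change a⁻¹ * (loopElt γ * a) = _
    rw [show loopElt γ = a * k⁻¹ * a⁻¹ from hγ]
    group

end SingularLabel


/-! ### The first homology group of a path-connected space -/

section Hurewicz

variable {X : Type u} [TopologicalSpace X]

/-- The group of 1-chains modulo boundaries. -/
abbrev ChainQuotient (S : SSet.{u}) : Type u := Chain S 1 ⧸ (boundary S 1).range

/-- The class of an edge modulo boundaries. -/
noncomputable def edgeClass {S : SSet.{u}} (σ : Simplex S 1) : ChainQuotient S :=
  QuotientAddGroup.mk (Finsupp.single σ 1)

lemma coboundaryOf_edgeClass {S : SSet.{u}} : coboundaryOf (edgeClass (S := S)) = 0 := by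
  funext σ
  rw [coboundaryOf_one]
  refine (QuotientAddGroup.eq_zero_iff _).2 ⟨Finsupp.single σ 1, ?_⟩
  exact boundary_single_two σ

lemma isMultiplicative_edgeClass {S : SSet.{u}} :
    IsMultiplicative fun σ : Simplex S 1 => Multiplicative.ofAdd (edgeClass σ) := by
  intro σ
  have h := congrFun (coboundaryOf_edgeClass (S := S)) σ
  rw [coboundaryOf_one, Pi.zero_apply] at h
  rw [← ofAdd_add]
  refine congrArg _ (sub_eq_zero.1 (Eq.trans ?_ (neg_eq_zero.2 h)))
  abel

/-- The inclusion of `H₁(S)` into the quotient of the chains by the boundaries. -/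
noncomputable def homologyInclusion (S : SSet.{u}) : Homology S 1 →+ ChainQuotient S :=
  homologyEval (n := 0) edgeClass coboundaryOf_edgeClass

lemma evalChain_edgeClass {S : SSet.{u}} (z : Chain S 1) :
    evalChain edgeClass z = QuotientAddGroup.mk z := by
  have : evalChain edgeClass = QuotientAddGroup.mk' (boundary S 1).range := by
    ext σ
    simp only [AddMonoidHom.comp_apply, Finsupp.singleAddHom_apply, evalChain_single, one_smul]
    rfl
  exact DFunLike.congr_fun this z

lemma homologyInclusion_injective (S : SSet.{u}) : Function.Injective (homologyInclusion S) := by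
  rw [injective_iff_map_eq_zero]
  intro c hc
  obtain ⟨z, rfl⟩ := cycleClass_surjective 0 c
  rw [homologyInclusion, homologyEval_cycleClass, evalChain_edgeClass,
    QuotientAddGroup.eq_zero_iff] at hc
  exact (cycleClass_eq_zero_iff z).2 hc

lemma boundary_single_pathSimplex {x : X} (γ : Path x x) :
    boundary (Sing X) 0 (Finsupp.single (pathSimplex γ) 1) = 0 := by
  apply chainHom_injective
  rw [← chainHom_d, chainHom_single, one_smul, pathSimplex_cycle, map_zero]

lemma homologyEval_loopClass {A : Type*} [AddCommGroup A] (a : Simplex (Sing X) 1 → A)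
    (ha : coboundaryOf a = 0) {x : X} (γ : Path x x) :
    homologyEval (n := 0) a ha (loopClass γ) = a (pathSimplex γ) := by
  rw [loopClass, simplexClass_eq_cycleClass _ _ (boundary_single_pathSimplex γ),
    homologyEval_cycleClass, evalChain_single, one_smul]

lemma loopClass_eq {x : X} {γ γ' : Path x x} (h : γ.Homotopic γ') :
    loopClass γ = loopClass γ' := by
  apply homologyInclusion_injective
  rw [homologyInclusion, homologyEval_loopClass, homologyEval_loopClass]
  exact congrArg Multiplicative.toAdd (isMultiplicative_edgeClass.pathSimplex_eq h)

lemma loopClass_trans {x : X} (γ γ' : Path x x) :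
    loopClass (γ.trans γ') = loopClass γ + loopClass γ' := by
  apply homologyInclusion_injective
  rw [map_add, homologyInclusion, homologyEval_loopClass, homologyEval_loopClass,
    homologyEval_loopClass]
  exact congrArg Multiplicative.toAdd (isMultiplicative_edgeClass.pathSimplex_trans γ γ')

/-- The Hurewicz homomorphism. -/
noncomputable def hurewicz (x : X) : FundamentalGroup X x →* Multiplicative (Homology (Sing X) 1) :=
  MonoidHom.mk' (Quotient.lift (fun γ : Path x x => Multiplicative.ofAdd (loopClass γ))
    fun _ _ h => congrArg _ (loopClass_eq h)) fun g h => by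
      induction g using Path.Homotopic.Quotient.ind with | mk γ
      induction h using Path.Homotopic.Quotient.ind with | mk γ'
      change Multiplicative.ofAdd (loopClass (γ'.trans γ)) =
        Multiplicative.ofAdd (loopClass γ) * Multiplicative.ofAdd (loopClass γ')
      rw [loopClass_trans, add_comm]
      rfl

variable [PathConnectedSpace X] (x : X)

/-- The Hurewicz theorem in degree one. -/
lemma isAbelianization_hurewicz : IsAbelianization (hurewicz x) := by
  constructor
  · intro c
    obtain ⟨z, hz⟩ := cycleClass_surjective 0 (Multiplicative.toAdd c)
    -- The image of the Hurewicz homomorphism.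
    let R : AddSubgroup (Homology (Sing X) 1) := (MonoidHom.toAdditiveLeft (hurewicz x)).range
    have hR : ∀ g, Multiplicative.toAdd (hurewicz x g) ∈ R := fun g => ⟨Additive.ofMul g, rfl⟩
    -- A cycle is homologous to the sum of the loops obtained by framing its edges.
    let r : Simplex (Sing X) 1 → Homology (Sing X) 1 := fun σ => loopClass (framedLoop x (edgePath σ))
    have hr : evalChain r z.1 ∈ R := by
      have h0 : ∀ y, evalChain r y ∈ R := by
        intro y
        induction y using Finsupp.induction_linear with
        | zero => rw [map_zero]; exact zero_mem _
        | add a b ha hb => rw [map_add]; exact add_mem ha hb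
        | single σ m =>
          rw [evalChain_single]
          exact zsmul_mem (hR (loopElt (framedLoop x (edgePath σ)))) m
      exact h0 z.1
    have hd : cycleClass 0 z = evalChain r z.1 := by
      apply homologyInclusion_injective
      let d : Simplex (Sing X) 0 → ChainQuotient (Sing X) := fun v =>
        edgeClass (pathSimplex (PathConnectedSpace.somePath x (vertexPoint v)))
      have e : (fun σ => homologyInclusion (Sing X) (r σ)) = edgeClass - coboundaryOf d := by
        funext σ
        have hm := isMultiplicative_edgeClass (S := Sing X)
        have h1 := congrArg Multiplicative.toAdd ((hm.pathSimplex_trans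
          ((PathConnectedSpace.somePath x _).trans (edgePath σ))
            (PathConnectedSpace.somePath x _).symm).trans
          (congrArg₂ (· * ·) (hm.pathSimplex_trans (PathConnectedSpace.somePath x _) (edgePath σ))
            (hm.pathSimplex_symm (PathConnectedSpace.somePath x _))))
        simp only [toAdd_mul, toAdd_inv, toAdd_ofAdd, pathSimplex_edgePath] at h1
        rw [homologyInclusion, homologyEval_loopClass]
        refine Eq.trans h1 ?_
        have h2 : coboundaryOf d σ = d ((Sing X).δ 0 σ) - d ((Sing X).δ 1 σ) := by
          simp [coboundaryOf, Fin.sum_univ_two, sub_eq_add_neg]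
        rw [Pi.sub_apply, h2]
        dsimp only [d]
        rw [vertexPoint_face_one, vertexPoint_face_zero]
        abel
      have e' : evalChain (edgeClass - coboundaryOf d) = evalChain edgeClass -
          evalChain (coboundaryOf d) := by
        ext σ
        simp [evalChain_single]
      rw [← evalChain_comp, e, e', AddMonoidHom.sub_apply, ← evalChain_boundary, z.2, map_zero,
        sub_zero, homologyInclusion, homologyEval_cycleClass]
    rw [← hd, hz] at hr
    obtain ⟨g, hg⟩ := hr
    exact ⟨Additive.toMul g, hg⟩
  · intro g hg
    induction g using Path.Homotopic.Quotient.ind with | mk γ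
    -- Conversely, the labels give a homomorphism from `H₁` to the abelianization.
    let ab := Abelianization.of (G := FundamentalGroup X x)
    let a : Simplex (Sing X) 1 → Additive (Abelianization (FundamentalGroup X x)) :=
      fun σ => Additive.ofMul (ab (singularLabel x σ))
    have ha : coboundaryOf a = 0 := by
      funext σ
      rw [coboundaryOf_one]
      simp only [a]
      rw [isMultiplicative_singularLabel x σ, map_mul, ofMul_mul, Pi.zero_apply]
      abel
    have h1 := homologyEval_loopClass a ha γ
    have h2 : loopClass γ = 0 := congrArg Multiplicative.toAdd hg
    rw [h2, map_zero] at h1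
    have h3 : ab (singularLabel x (pathSimplex γ)) = 1 := congrArg Additive.toMul h1.symm
    have h4 : singularLabel x (pathSimplex γ) =
        ((loopElt (PathConnectedSpace.somePath x x))⁻¹ *
          (loopElt γ * loopElt (PathConnectedSpace.somePath x x)))⁻¹ :=
      singularLabel_pathSimplex x γ
    rw [h4, map_inv, inv_eq_one, map_mul, map_mul, map_inv, mul_comm (ab (loopElt γ)),
      inv_mul_cancel_left] at h3
    have h5 : loopElt γ ∈ (Abelianization.of (G := FundamentalGroup X x)).ker := h3
    rw [Abelianization.ker_of] at h5
    exact h5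

lemma exists_loopClass_eq (h : Homology (Sing X) 1) : ∃ γ : Path x x, loopClass γ = h := by
  obtain ⟨g, hg⟩ := (isAbelianization_hurewicz x).surjective (Multiplicative.ofAdd h)
  induction g using Path.Homotopic.Quotient.ind with | mk γ
  exact ⟨γ, congrArg Multiplicative.toAdd hg⟩

/-- The class of degree one given by a functional on `H₁(X)` induces this functional. -/
lemma kronecker_labelClass (ξ : Homology (Sing X) 1 →+ ℤ) :
    kronecker 1 (labelClass (isLabel_singular x) (hurewicz x) ξ) = ξ := by
  ext h
  obtain ⟨γ, rfl⟩ := exists_loopClass_eq x h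
  refine (kronecker_simplexClass _ _ _).trans ?_
  change -ξ (Multiplicative.toAdd (hurewicz x (singularLabel x (pathSimplex γ)))) = _
  have h4 : singularLabel x (pathSimplex γ) =
      ((loopElt (PathConnectedSpace.somePath x x))⁻¹ *
        (loopElt γ * loopElt (PathConnectedSpace.somePath x x)))⁻¹ :=
    singularLabel_pathSimplex x γ
  have h5 : hurewicz x (singularLabel x (pathSimplex γ)) = (hurewicz x (loopElt γ))⁻¹ := by
    rw [h4, map_inv, map_mul, map_mul, map_inv (hurewicz x), mul_comm (hurewicz x (loopElt γ)),
      inv_mul_cancel_left]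
  rw [h5, toAdd_inv, map_neg, neg_neg]
  rfl

lemma labelClass_kronecker (α : Cohomology (Sing X) 1) :
    labelClass (isLabel_singular x) (hurewicz x) (kronecker 1 α) = α := by
  obtain ⟨ξ, rfl⟩ := labelClass_surjective (isLabel_singular x) (isAbelianization_hurewicz x) α
  rw [kronecker_labelClass]

end Hurewicz


/-! ### The maps of the exact sequence for a space -/

section ExactSequence

variable {X : Type u} [TopologicalSpace X] [PathConnectedSpace X] {x : X}
  {F : Type v} [Group F] {ι : Type w} (b : FreeGroupBasis ι F) {p : F →* FundamentalGroup X x}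
  {n : ℕ} {s : FundamentalGroup X x → F}

include b

lemma tfae_isNEquivalence_massey (hp : IsNEquivalence 2 p) (hn : 2 ≤ n) :
    [ IsNEquivalence n p,
      HasVanishingMassey (Sing X) n,
      HasWeaklyVanishingMassey (Sing X) n,
      HasVanishingMassey (BG (FundamentalGroup X x)) n,
      HasWeaklyVanishingMassey (BG (FundamentalGroup X x)) n ].TFAE := by
  have hq := isAbelianization_hurewicz x
  tfae_have 1 → 2 := fun h k hk hkn α => by
    obtain ⟨s, hs⟩ := exists_isSectionMod h
    exact massey_eq_zero_of_lt b (isLabel_singular x) hs hq hk hkn α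
  tfae_have 2 → 3 := fun h k hk hkn α => by rw [h k hk hkn α]; rfl
  tfae_have 3 → 1 := isNEquivalence_of_weaklyVanishing b (isLabel_singular x) hq hp hn
  tfae_have 1 → 4 := fun h k hk hkn α => by
    obtain ⟨s, hs⟩ := exists_isSectionMod h
    exact massey_eq_zero_of_lt b (isLabel_classifying _) hs hq hk hkn α
  tfae_have 4 → 5 := fun h k hk hkn α => by rw [h k hk hkn α]; rfl
  tfae_have 5 → 1 := isNEquivalence_of_weaklyVanishing b (isLabel_classifying _) hq hp hn
  tfae_finish

lemma encodesMassey_obstructionHom (hqp : IsAbelianization ((hurewicz x).comp p))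
    (hs : IsSectionMod n p s) (hn : 2 ≤ n) :
    EncodesMassey n (obstructionHom b hqp (by omega) (isLabel_singular x) hs) := by
  intro α β hβ c
  rw [← kronecker_massey b (isLabel_singular x) hs (isAbelianization_hurewicz x) hqp hn
    (ξ := fun i => kronecker 1 (α i)) (by simpa only [labelClass_kronecker] using hβ)]

/-- The homomorphism `θ` is determined by the Massey products, because tensor products of functionals
separate the elements of `Lₙ(H₁(X))` and every functional comes from `H¹(X)`. -/
lemma EncodesMassey.ext (hqp : IsAbelianization ((hurewicz x).comp p))
    (hs : IsSectionMod n p s) (hn : 2 ≤ n)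
    {θ θ' : Homology (Sing X) 2 →+ freeLieDegree (Homology (Sing X) 1) n}
    (hθ : EncodesMassey n θ) (hθ' : EncodesMassey n θ') : θ = θ' := by
  ext1 c
  rw [← sub_eq_zero]
  refine hqp.eq_zero_of_contraction b fun ξ => ?_
  obtain ⟨β, hβ⟩ := massey_nonempty b (isLabel_singular x) hs (isAbelianization_hurewicz x) hn
    le_rfl fun i => labelClass (isLabel_singular x) (hurewicz x) (ξ i)
  have h := (hθ _ β hβ c).symm.trans (hθ' _ β hβ c)
  simp only [kronecker_labelClass] at h
  rw [AddSubgroup.coe_sub, map_sub, map_sub, h, sub_self]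

omit b

lemma isInducedByBracket_degreeMap (hn : 1 ≤ n) :
    IsInducedByBracket x n (degreeMap (isAbelianization_hurewicz x).degreeOneMap n) :=
  fun γ => degreeMap_bracketElt hn fun i =>
    (isAbelianization_hurewicz x).degreeOneMap_apply (loopElt (γ i))

lemma IsInducedByBracket.ext
    {ψ ψ' : freeLieDegree (Homology (Sing X) 1) n →+ GradedQuotient (FundamentalGroup X x) n}
    (hψ : IsInducedByBracket x n ψ) (hψ' : IsInducedByBracket x n ψ') : ψ = ψ' := by
  refine freeLieDegree_hom_ext fun h => ?_
  choose γ hγ using fun i => exists_loopClass_eq x (h i)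
  obtain rfl := funext hγ
  rw [hψ, hψ']

include b

lemma EncodesMassey.mem_massey_iff (hqp : IsAbelianization ((hurewicz x).comp p))
    (hs : IsSectionMod n p s) (hn : 2 ≤ n)
    {θ : Homology (Sing X) 2 →+ freeLieDegree (Homology (Sing X) 1) n} (hθ : EncodesMassey n θ)
    (α : Fin n → Cohomology (Sing X) 1) (β : Cohomology (Sing X) 2) :
    β ∈ massey α ↔ ∀ c : Homology (Sing X) 2,
      kronecker 2 β c = contraction (fun i => kronecker 1 (α i)) (toTensor (θ c).1) := by
  rw [hθ.ext b hqp hs hn (encodesMassey_obstructionHom b hqp hs hn),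
    ← UniversalMassey.mem_massey_iff b (isLabel_singular x) hs (isAbelianization_hurewicz x) hqp hn]
  simp only [labelClass_kronecker]

omit [PathConnectedSpace X] in
lemma EncodesMassey.eq_finsum (hqp : IsAbelianization ((hurewicz x).comp p))
    {θ : Homology (Sing X) 2 →+ freeLieDegree (Homology (Sing X) 1) n} (hθ : EncodesMassey n θ)
    {γ : ι → Path x x} {ξ : ι → Cohomology (Sing X) 1} {m : (Fin n → ι) → Cohomology (Sing X) 2}
    (hγ : ∀ i, loopElt (γ i) = p (b i)) (h1 : ∀ i, kronecker 1 (ξ i) (loopClass (γ i)) = 1)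
    (h0 : ∀ i j, i ≠ j → kronecker 1 (ξ i) (loopClass (γ j)) = 0)
    (hm : ∀ I : Fin n → ι, m I ∈ massey fun k => ξ (I k)) (c : Homology (Sing X) 2) :
    {I : Fin n → ι | kronecker 2 (m I) c ≠ 0}.Finite ∧
      toTensor (θ c).1 = ∑ᶠ I : Fin n → ι, kronecker 2 (m I) c •
        TensorAlgebra.tprod ℤ (Homology (Sing X) 1) n fun k => loopClass (γ (I k)) := by
  obtain ⟨t, ht⟩ := hqp.exists_basis b
  have hcl : AddSubgroup.closure (Set.range fun i => loopClass (γ i)) = ⊤ := by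
    have e : (fun i => loopClass (γ i)) = t := funext fun i => by
      rw [ht, MonoidHom.comp_apply, ← hγ]
      rfl
    rw [e, ← Submodule.span_int_eq_addSubgroupClosure, t.span_eq]
    rfl
  simp only [fun I => hθ _ _ (hm I) c]
  exact eq_finsum_contraction (ξ := fun i => kronecker 1 (ξ i)) h1 h0
    (toTensor_mem_tensorWords hcl (θ c))

end ExactSequence

end UniversalMassey

open UniversalMassey in
theorem mainTheorem1 {X : Type u} [TopologicalSpace X] [PathConnectedSpace X] (x : X)
    {F : Type v} [Group F] {ι : Type w} (b : FreeGroupBasis ι F)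
    (p : F →* FundamentalGroup X x) (hp : IsNEquivalence 2 p) (n : ℕ) (hn : 2 ≤ n) :
    -- (i) vanishing of Massey products
    [ IsNEquivalence n p,
      HasVanishingMassey (Sing X) n,
      HasWeaklyVanishingMassey (Sing X) n,
      HasVanishingMassey (BG (FundamentalGroup X x)) n,
      HasWeaklyVanishingMassey (BG (FundamentalGroup X x)) n ].TFAE ∧
    (IsNEquivalence n p →
      -- the Massey products of length `n` are defined and have no indeterminacy
      (∀ α : Fin n → Cohomology (Sing X) 1, ∃! β, β ∈ massey α) ∧
      (∀ α : Fin n → Cohomology (BG (FundamentalGroup X x)) 1, ∃! β, β ∈ massey α) ∧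
      -- (ii) the exact sequence `H₂(X) → Lₙ(H₁(X)) → πₙ/πₙ₊₁ → 0`
      (∃! θ : Homology (Sing X) 2 →+ freeLieDegree (Homology (Sing X) 1) n, EncodesMassey n θ) ∧
      (∃! ψ : freeLieDegree (Homology (Sing X) 1) n →+ GradedQuotient (FundamentalGroup X x) n,
        IsInducedByBracket x n ψ) ∧
      (∀ (θ : Homology (Sing X) 2 →+ freeLieDegree (Homology (Sing X) 1) n)
        (ψ : freeLieDegree (Homology (Sing X) 1) n →+ GradedQuotient (FundamentalGroup X x) n),
        EncodesMassey n θ → IsInducedByBracket x n ψ →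
          Function.Exact θ ψ ∧ Function.Surjective ψ) ∧
      -- the first map determines the Massey products of length `n`, and is given by them
      (∀ θ : Homology (Sing X) 2 →+ freeLieDegree (Homology (Sing X) 1) n, EncodesMassey n θ →
        (∀ (α : Fin n → Cohomology (Sing X) 1) (β : Cohomology (Sing X) 2),
          β ∈ massey α ↔ ∀ c : Homology (Sing X) 2,
            kronecker 2 β c = contraction (fun i => kronecker 1 (α i)) (toTensor (θ c).1)) ∧
        (∀ (γ : ι → Path x x) (ξ : ι → Cohomology (Sing X) 1)
          (m : (Fin n → ι) → Cohomology (Sing X) 2),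
          (∀ i, loopElt (γ i) = p (b i)) →
          (∀ i, kronecker 1 (ξ i) (loopClass (γ i)) = 1) →
          (∀ i j, i ≠ j → kronecker 1 (ξ i) (loopClass (γ j)) = 0) →
          (∀ I : Fin n → ι, m I ∈ massey (fun k => ξ (I k))) →
          ∀ c : Homology (Sing X) 2,
            {I : Fin n → ι | kronecker 2 (m I) c ≠ 0}.Finite ∧
            toTensor (θ c).1 = ∑ᶠ I : Fin n → ι, kronecker 2 (m I) c •
              TensorAlgebra.tprod ℤ (Homology (Sing X) 1) n (fun k => loopClass (γ (I k))))) ∧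
      -- (iii) the cyclicity relation, for `X` and for its fundamental group
      (∀ (α : Fin (n + 1) → Cohomology (Sing X) 1),
        ∀ β ∈ massey (fun i : Fin n => α i.castSucc), ∀ β' ∈ massey (fun i : Fin n => α i.succ),
          cupProduct (show 1 + 2 = 3 from rfl) (α 0) β' =
            cupProduct (show 2 + 1 = 3 from rfl) β (α (Fin.last n))) ∧
      (∀ (α : Fin (n + 1) → Cohomology (BG (FundamentalGroup X x)) 1),
        ∀ β ∈ massey (fun i : Fin n => α i.castSucc), ∀ β' ∈ massey (fun i : Fin n => α i.succ),
          cupProduct (show 1 + 2 = 3 from rfl) (α 0) β' =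
            cupProduct (show 2 + 1 = 3 from rfl) β (α (Fin.last n)))) := by
  refine ⟨tfae_isNEquivalence_massey b hp hn, fun h => ?_⟩
  have hq := isAbelianization_hurewicz x
  have hqp := hq.comp hp
  obtain ⟨s, hs⟩ := exists_isSectionMod h
  have hθ := encodesMassey_obstructionHom b hqp hs hn
  have hψ := isInducedByBracket_degreeMap (x := x) (show 1 ≤ n by omega)
  refine ⟨existsUnique_mem_massey b (isLabel_singular x) hs hq hqp hn,
    existsUnique_mem_massey b (isLabel_classifying _) hs hq hqp hn,
    ⟨_, hθ, fun θ h' => h'.ext b hqp hs hn hθ⟩, ⟨_, hψ, fun ψ h' => h'.ext hψ⟩, ?_, ?_, ?_, ?_⟩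
  · intro θ ψ hθ' hψ'
    rw [hθ'.ext b hqp hs hn hθ, hψ'.ext hψ]
    exact ⟨exact_obstructionHom b (isLabel_singular x) hs hq hqp hn,
      degreeMap_surjective (by omega) hq.degreeOneMap_surjective⟩
  · exact fun θ hθ' => ⟨hθ'.mem_massey_iff b hqp hs hn,
      fun γ ξ m hγ h1 h0 hm => hθ'.eq_finsum b hqp hγ h1 h0 hm⟩
  · exact fun α β hβ β' hβ' => cupProduct_massey b (isLabel_singular x) hs hq hqp hn α hβ hβ'
  · exact fun α β hβ β' hβ' => cupProduct_massey b (isLabel_classifying _) hs hq hqp hn α hβ hβ'
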